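/- Let $\mathcal C$ be a category with a Grothendieck topology given by covering families $\{U_i\to X\}$: isomorphisms are covers, for every cover $\{U_i\to X\}$ and every $Y\to X$ the fiber products $U_i\times_X Y$ exist and the projections $\{U_i\times_X Y\to Y\}$ form a cover, and composites of covers are covers. A functor $p:\mathcal E\to\mathcal C$ is a *category fibered in groupoids* if (i) for $f:Y\to X$ in $\mathcal C$ and $X'\in\mathcal E$ with $p(X')=X$ there is $f':Y'\to X'$ with $p(f')=f$; and (ii) for $f':Y'\to X'$, $g':Z'\to X'$ in $\mathcal E$ and $h:p(Y')\to p(Z')$ with $p(g')\circ h=p(f')$ there is a unique $h':Y'\to Z'$ with $g'\circ h'=f'$ and $p(h')=h$. Write $\mathcal E_X$ for the fiber groupoid over $X$ (objects over $X$, morphisms over $\mathrm{id}_X$), $a\mapsto a|_Y$ for chosen pullback functors $\mathcal E_X\to\mathcal E_Y$, and $U_{i_0\cdots i_n}=U_{i_0}\times_X\cdots\times_X U_{i_n}$. Canonical isomorphisms $(a|_Y)|_Z\cong a|_Z$ are suppressed. The category fibered in groupoids $\mathcal E$ is a *stack* if for every cover $\{U_i\to X\}$: 1. for all $a,b\in\mathcal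 E_X$ the diagram $\mathrm{Hom}_{\mathcal E_X}(a,b)\to\prod_i\mathrm{Hom}_{\mathcal E_{U_i}}(a|_{U_i},b|_{U_i})\rightrightarrows\prod_{i,j}\mathrm{Hom}_{\mathcal E_{U_{ij}}}(a|_{U_{ij}},b|_{U_{ij}})$ is an equalizer; 2. given $a_i\in\mathcal E_{U_i}$ and isomorphisms $\alpha_{ij}:a_i|_{U_{ij}}\to a_j|_{U_{ij}}$ with $\alpha_{jk}|_{U_{ijk}}\circ\alpha_{ij}|_{U_{ijk}}=\alpha_{ik}|_{U_{ijk}}$ for all $i,j,k$, there are $a\in\mathcal E_X$ and isomorphisms $\beta_i:a|_{U_i}\to a_i$ with $\alpha_{ij}\circ\beta_i|_{U_{ij}}=\beta_j|_{U_{ij}}$ for all $i,j$. For $X\in\mathcal C$ let $\mathcal E(X)$ be the groupoid of functors $\mathcal C/X\to\mathcal E$ over $\mathcal C$, with natural isomorphisms over $\mathrm{id}_{\mathcal C}$ as morphisms; it is contravariantly functorial in $X$ by composition. For a small category $I$ and a diagram $G:I\to\mathrm{Grpd}$ of groupoids, the homotopy limit $\operatorname{holim}G$ is the equalizer in $\mathrm{Grpd}$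 of the two natural maps $$\prod_{i}G(i)^{N(I/i)}\rightrightarrows\prod_{j\to i}G(i)^{N(I/j)},$$ where, for a category $D$, $G(i)^{N(D)}$ is the groupoid of functors to $G(i)$ from the fundamental groupoid of the nerve $N(D)$, i.e. from the free groupoid on $D$. A strict cone over $G$ with vertex $H$ induces a canonical functor $H\to\operatorname{holim}G$ through constant functors. **Theorem.** A category fibered in groupoids $\mathcal E\to\mathcal C$ is a stack if and only if for every cover $\{U_i\to X\}$ in $\mathcal C$ the canonical functor, induced by restriction along the maps $U_{i_0\cdots i_n}\to X$, $$\mathcal E(X)\longrightarrow\operatorname{holim}\Bigl(\prod_i\mathcal E(U_i)\rightrightarrows\prod_{i,j}\mathcal E(U_{ij})\ \substack{\to\\[-0.6ex]\to\\[-0.6ex]\to}\ \prod_{i,j,k}\mathcal E(U_{ijk})\cdots\Bigr)$$ is an equivalence of categories, where the homotopy limit is taken over the full cosimplicial groupoid $[n]\mapsto\prod_{i_0,\dots,i_n}\mathcal E(U_{i_0\cdots i_n})$. -/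

import Mathlib

open CategoryTheory CategoryTheory.Limits CategoryTheory.Functor

universe w v u v₁ u₁ v₂ u₂

noncomputable section

namespace HomotopySheaf

/-! ### Categories fibered in groupoids -/

section Fibered

variable {C : Type u} [Category.{v} C] {E : Type u₂} [Category.{v₂} E]

/-- `p : E ⥤ C` is a category fibered in groupoids: morphisms of the base lift along any
prescribed target, and every factorization in the base of (the image of) one morphism of `E`
through (the image of) another one lifts uniquely to `E`. -/
class IsFiberedInGroupoids (p : E ⥤ C) : Prop where
  exists_lift {X' : E} {Y : C} (f : Y ⟶ p.obj X') :
    ∃ (Y' : E) (f' : Y' ⟶ X'), p.IsHomLift f f'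
  existsUnique_lift {X' Y' Z' : E} (f' : Y' ⟶ X') (g' : Z' ⟶ X')
    (h : p.obj Y' ⟶ p.obj Z') (w : h ≫ p.map g' = p.map f') :
    ∃! h' : Y' ⟶ Z', p.map h' = h ∧ h' ≫ g' = f'

variable (p : E ⥤ C) [IsFiberedInGroupoids p]

theorem isStronglyCartesian {X Y : C} {a b : E} (f : Y ⟶ X) (φ : b ⟶ a) [p.IsHomLift f φ] :
    p.IsStronglyCartesian f φ where
  universal_property' {c} g φ' hφ' := by
    subst_hom_lift p f φ
    have h1 : g ≫ p.map φ = p.map φ' := IsHomLift.eq_of_isHomLift p _ _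
    obtain ⟨h', ⟨e1, e2⟩, huniq⟩ :=
      IsFiberedInGroupoids.existsUnique_lift (p := p) φ' φ g h1
    refine ⟨h', ⟨?_, e2⟩, ?_⟩
    · subst e1; infer_instance
    · rintro χ ⟨hχ, hχ'⟩
      exact huniq χ ⟨(IsHomLift.eq_of_isHomLift p g χ).symm, hχ'⟩

instance isFibered : p.IsFibered :=
  IsFibered.of_exists_isStronglyCartesian fun _ _ f => by
    obtain ⟨b, φ, h⟩ := IsFiberedInGroupoids.exists_lift (p := p) f
    exact ⟨b, φ, isStronglyCartesian p f φ⟩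

/-- Morphisms over an identity are isomorphisms. -/
theorem isIso_of_isHomLift_id {X : C} {a b : E} (φ : a ⟶ b) [p.IsHomLift (𝟙 X) φ] : IsIso φ :=
  have := isStronglyCartesian p (𝟙 X) φ
  IsStronglyCartesian.isIso_of_base_isIso p (𝟙 X) φ

/-- The fiber categories are groupoids. -/
instance fiber_isIso {X : C} {a b : p.Fiber X} (φ : a ⟶ b) : IsIso φ := by
  have := φ.2
  have := isIso_of_isHomLift_id p (X := X) φ.1
  refine ⟨⟨⟨inv φ.1, inferInstance⟩, ?_, ?_⟩⟩
  · exact Subtype.ext (IsIso.hom_inv_id φ.1)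
  · exact Subtype.ext (IsIso.inv_hom_id φ.1)

variable {p} in
/-- The chosen pullback `f^* a` of an object `a` of the fiber over `X` along `f : Y ⟶ X`. -/
def pullObj {X Y : C} (f : Y ⟶ X) (a : p.Fiber X) : p.Fiber Y :=
  ⟨IsPreFibered.pullbackObj a.2 f, IsPreFibered.pullbackObj_proj a.2 f⟩

variable {p} in
/-- The chosen morphism `f^* a ⟶ a` lying over `f`. -/
def pullProj {X Y : C} (f : Y ⟶ X) (a : p.Fiber X) : (pullObj f a).1 ⟶ a.1 :=
  IsPreFibered.pullbackMap a.2 f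

instance pullProj_isCartesian {X Y : C} (f : Y ⟶ X) (a : p.Fiber X) :
    p.IsCartesian f (pullProj f a) :=
  IsPreFibered.pullbackMap.IsCartesian a.2 f

variable {p} in
/-- The unique morphism `b ⟶ f^* a` over the identity through which a morphism `b ⟶ a`
over `f` factors. -/
def pullLift {X Y : C} (f : Y ⟶ X) (a : p.Fiber X) (b : p.Fiber Y) (φ : b.1 ⟶ a.1)
    [p.IsHomLift f φ] : b ⟶ pullObj f a :=
  ⟨IsCartesian.map p f (pullProj f a) φ, inferInstance⟩

theorem pullLift_proj {X Y : C} (f : Y ⟶ X) (a : p.Fiber X) (b : p.Fiber Y) (φ : b.1 ⟶ a.1)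
    [p.IsHomLift f φ] : (pullLift f a b φ).1 ≫ pullProj f a = φ :=
  IsCartesian.fac p f (pullProj f a) φ

theorem pull_hom_ext {X Y : C} (f : Y ⟶ X) {a : p.Fiber X} {b : p.Fiber Y}
    (φ ψ : b ⟶ pullObj f a) (h : φ.1 ≫ pullProj f a = ψ.1 ≫ pullProj f a) : φ = ψ := by
  have := φ.2
  have := ψ.2
  exact Subtype.ext (IsCartesian.ext p f (pullProj f a) φ.1 ψ.1 h)

/-- The chosen pullback functor `f^*` between the fibers. -/
def pull {X Y : C} (f : Y ⟶ X) : p.Fiber X ⥤ p.Fiber Y where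
  obj a := pullObj f a
  map {a b} φ :=
    have := φ.2
    pullLift f b (pullObj f a) (pullProj f a ≫ φ.1)
  map_id a := by
    apply pull_hom_ext
    erw [pullLift_proj]
    exact (Category.comp_id _).trans (Category.id_comp _).symm
  map_comp {a b c} φ ψ := by
    have := φ.2
    have := ψ.2
    have h1 := pullLift_proj p f b (pullObj f a) (pullProj f a ≫ φ.1)
    have h2 := pullLift_proj p f c (pullObj f b) (pullProj f b ≫ ψ.1)
    apply pull_hom_ext
    erw [pullLift_proj]
    change pullProj f a ≫ φ.1 ≫ ψ.1 = (_ ≫ _) ≫ _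
    rw [Category.assoc]
    erw [h2]
    rw [← Category.assoc, ← Category.assoc]
    erw [h1]

/-- The canonical isomorphism `g^* (f^* a) ≅ h^* a`, where `h` is the composite of `g` and `f`;
it is the unique one over the identity which is compatible with the projections to `a`. -/
def pullComp {X Y Z : C} (g : Z ⟶ Y) (f : Y ⟶ X) (h : Z ⟶ X) (w : g ≫ f = h)
    (a : p.Fiber X) : (pull p g).obj ((pull p f).obj a) ≅ (pull p h).obj a :=
  have : p.IsHomLift h (pullProj g (pullObj f a) ≫ pullProj f a) := by
    subst w; infer_instance
  show pullObj g (pullObj f a) ≅ pullObj h a from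
    asIso (pullLift h a (pullObj g (pullObj f a)) (pullProj g (pullObj f a) ≫ pullProj f a))

/-- The restriction along `g : W ⟶ V` of a morphism `s^* a ⟶ t^* b` in the fiber over `V`,
regarded as a morphism between the restrictions of `a` and `b` to `W`. -/
def res {W V X Y : C} (g : W ⟶ V) {s : V ⟶ X} {t : V ⟶ Y} (s' : W ⟶ X) (t' : W ⟶ Y)
    (hs : g ≫ s = s') (ht : g ≫ t = t') {a : p.Fiber X} {b : p.Fiber Y}
    (φ : (pull p s).obj a ⟶ (pull p t).obj b) : (pull p s').obj a ⟶ (pull p t').obj b :=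
  (pullComp p g s s' hs a).inv ≫ (pull p g).map φ ≫ (pullComp p g t t' ht b).hom

end Fibered

/-! ### Stacks -/

section Stacks

variable {C : Type u} [Category.{v} C] {J : Precoverage C} [J.HasPullbacks]

section Overlaps

variable {X : C} (𝒰 : Precoverage.ZeroHypercover.{w} J X)

/-- `U_ij = U_i ×_X U_j` -/
abbrev U₂ (i j : 𝒰.I₀) : C := pullback (𝒰.f i) (𝒰.f j)

/-- `U_ijk = U_i ×_X U_j ×_X U_k` -/
abbrev U₃ (i j k : 𝒰.I₀) : C := pullback (pullback.fst (𝒰.f i) (𝒰.f j) ≫ 𝒰.f i) (𝒰.f k)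

variable (i j k : 𝒰.I₀)

/-- `U_ij ⟶ U_i` -/
abbrev fst₂ : U₂ 𝒰 i j ⟶ 𝒰.X i := pullback.fst _ _

/-- `U_ij ⟶ U_j` -/
abbrev snd₂ : U₂ 𝒰 i j ⟶ 𝒰.X j := pullback.snd _ _

/-- `U_ij ⟶ X` -/
abbrev base₂ : U₂ 𝒰 i j ⟶ X := fst₂ 𝒰 i j ≫ 𝒰.f i

theorem snd₂_f : snd₂ 𝒰 i j ≫ 𝒰.f j = base₂ 𝒰 i j := pullback.condition.symm

/-- `U_ijk ⟶ U_ij` -/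
abbrev proj₁₂ : U₃ 𝒰 i j k ⟶ U₂ 𝒰 i j := pullback.fst _ _

/-- `U_ijk ⟶ U_i` -/
abbrev proj₁ : U₃ 𝒰 i j k ⟶ 𝒰.X i := proj₁₂ 𝒰 i j k ≫ fst₂ 𝒰 i j

/-- `U_ijk ⟶ U_j` -/
abbrev proj₂ : U₃ 𝒰 i j k ⟶ 𝒰.X j := proj₁₂ 𝒰 i j k ≫ snd₂ 𝒰 i j

/-- `U_ijk ⟶ U_k` -/
abbrev proj₃ : U₃ 𝒰 i j k ⟶ 𝒰.X k := pullback.snd _ _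

/-- `U_ijk ⟶ U_jk` -/
abbrev proj₂₃ : U₃ 𝒰 i j k ⟶ U₂ 𝒰 j k :=
  pullback.lift (proj₂ 𝒰 i j k) (proj₃ 𝒰 i j k) (by
    rw [Category.assoc, snd₂_f, pullback.condition])

/-- `U_ijk ⟶ U_ik` -/
abbrev proj₁₃ : U₃ 𝒰 i j k ⟶ U₂ 𝒰 i k :=
  pullback.lift (proj₁ 𝒰 i j k) (proj₃ 𝒰 i j k) (by
    rw [Category.assoc, pullback.condition])

end Overlaps

variable {E : Type u₂} [Category.{v₂} E] (p : E ⥤ C) [IsFiberedInGroupoids p]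

/-- The descent conditions for `p : E ⥤ C` and a single cover `{U_i ⟶ X}`. -/
structure SatisfiesDescent {X : C} (𝒰 : Precoverage.ZeroHypercover.{w} J X) : Prop where
  /-- `Hom(a, b)` is the equalizer of
  `∏ Hom(a|U_i, b|U_i) ⇉ ∏ Hom(a|U_ij, b|U_ij)`. -/
  hom_gluing (a b : p.Fiber X)
    (φ : ∀ i, (pull p (𝒰.f i)).obj a ⟶ (pull p (𝒰.f i)).obj b)
    (hφ : ∀ i j,
      res p (fst₂ 𝒰 i j) (base₂ 𝒰 i j) (base₂ 𝒰 i j) rfl rfl (φ i) =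
        res p (snd₂ 𝒰 i j) (base₂ 𝒰 i j) (base₂ 𝒰 i j)
          (snd₂_f 𝒰 i j) (snd₂_f 𝒰 i j) (φ j)) :
    ∃! ψ : a ⟶ b, ∀ i, (pull p (𝒰.f i)).map ψ = φ i
  /-- Descent data `a_i`, `α_ij : a_i|U_ij ≅ a_j|U_ij` satisfying the cocycle condition
  on `U_ijk` are effective. -/
  obj_gluing (a : ∀ i, p.Fiber (𝒰.X i))
    (α : ∀ i j, (pull p (fst₂ 𝒰 i j)).obj (a i) ≅ (pull p (snd₂ 𝒰 i j)).obj (a j))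
    (cocycle : ∀ i j k,
      res p (proj₁₂ 𝒰 i j k) (proj₁ 𝒰 i j k) (proj₂ 𝒰 i j k) rfl rfl (α i j).hom ≫
        res p (proj₂₃ 𝒰 i j k) (proj₂ 𝒰 i j k) (proj₃ 𝒰 i j k)
          (pullback.lift_fst _ _ _) (pullback.lift_snd _ _ _) (α j k).hom =
      res p (proj₁₃ 𝒰 i j k) (proj₁ 𝒰 i j k) (proj₃ 𝒰 i j k)
          (pullback.lift_fst _ _ _) (pullback.lift_snd _ _ _) (α i k).hom) :
    ∃ (b : p.Fiber X) (β : ∀ i, (pull p (𝒰.f i)).obj b ≅ a i), ∀ i j,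
      ((pullComp p (fst₂ 𝒰 i j) (𝒰.f i) (base₂ 𝒰 i j) rfl b).inv ≫
          (pull p (fst₂ 𝒰 i j)).map (β i).hom) ≫ (α i j).hom =
        (pullComp p (snd₂ 𝒰 i j) (𝒰.f j) (base₂ 𝒰 i j) (snd₂_f 𝒰 i j) b).inv ≫
          (pull p (snd₂ 𝒰 i j)).map (β j).hom

variable (J) in
/-- A category fibered in groupoids is a stack if it satisfies descent for all covers
(with index sets in `Type w`). -/
def IsStack : Prop :=
  ∀ (X : C) (𝒰 : Precoverage.ZeroHypercover.{w} J X), SatisfiesDescent p 𝒰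

end Stacks

/-! ### The groupoids `E(X) = Hom(C/X, E)` -/

section Sections

variable {C : Type u} [Category.{v} C] {E : Type u₂} [Category.{v₂} E]

/-- `E(X)`: the functors `C/X ⥤ E` over `C`, with the natural transformations lying over the
identity of `C` as morphisms. -/
abbrev Sections (p : E ⥤ C) (X : C) :=
  BasedFunctor (BasedCategory.ofFunctor (Over.forget X)) (BasedCategory.ofFunctor p)

instance sectionsGroupoid (p : E ⥤ C) [IsFiberedInGroupoids p] (X : C) :
    Groupoid (Sections p X) :=
  Groupoid.ofIsIso fun {F G} φ => by
    have (a : (BasedCategory.ofFunctor (Over.forget X)).obj) : IsIso (φ.toNatTrans.app a) := by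
      have h := φ.isHomLift' a
      exact @isIso_of_isHomLift_id _ _ _ _ p _ _ _ _ (φ.toNatTrans.app a) h
    have : IsIso (X := F.toFunctor) φ.toNatTrans := NatIso.isIso_of_isIso_app φ.toNatTrans
    exact BasedNatIso.isIso_of_toNatTrans_isIso φ

/-- The functor `C/Y ⥤ C/X` over `C` given by composition with `f : Y ⟶ X`. -/
def overMap {X Y : C} (f : Y ⟶ X) :
    BasedFunctor (BasedCategory.ofFunctor (Over.forget Y))
      (BasedCategory.ofFunctor (Over.forget X)) where
  toFunctor := Over.map f
  w := rfl

theorem basedFunctor_ext {𝒳 : BasedCategory.{v₁, u₁} C} {𝒴 : BasedCategory.{v₂, u₂} C}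
    {F G : BasedFunctor 𝒳 𝒴} (h : F.toFunctor = G.toFunctor) : F = G := by
  cases F; cases G; cases h; rfl

theorem overMap_id (X : C) : overMap (𝟙 X) = BasedFunctor.id _ :=
  basedFunctor_ext (Over.mapId_eq X)

theorem overMap_comp {X Y Z : C} (g : Z ⟶ Y) (f : Y ⟶ X) :
    overMap (g ≫ f) = (overMap g).comp (overMap f) :=
  basedFunctor_ext (Over.mapComp_eq g f)

/-- Precomposition of functors over `C`. -/
def precomp (p : E ⥤ C) {𝒳 : BasedCategory.{v₁, u₁} C} {𝒴 : BasedCategory.{v₁, u₁} C}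
    (H : BasedFunctor 𝒳 𝒴) :
    BasedFunctor 𝒴 (BasedCategory.ofFunctor p) ⥤ BasedFunctor 𝒳 (BasedCategory.ofFunctor p) where
  obj F := H.comp F
  map φ := BasedCategory.whiskerLeft H φ

/-- The restriction functor `E(X) ⥤ E(Y)` along `f : Y ⟶ X`. -/
def restrict (p : E ⥤ C) {X Y : C} (f : Y ⟶ X) : Sections p X ⥤ Sections p Y :=
  precomp p (overMap f)

theorem restrict_id (p : E ⥤ C) (X : C) : restrict p (𝟙 X) = 𝟭 _ := by
  rw [restrict, overMap_id]; rfl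

theorem restrict_comp (p : E ⥤ C) {X Y Z : C} (g : Z ⟶ Y) (f : Y ⟶ X) :
    restrict p (g ≫ f) = restrict p f ⋙ restrict p g := by
  rw [restrict, overMap_comp]; rfl

end Sections

/-! ### Homotopy limits of groupoids -/

section HoLim

/-- The equalizer of two functors in the category of categories. -/
structure StrictEqualizer {A : Type u₁} [Category.{v₁} A] {B : Type u₂} [Category.{v₂} B]
    (P Q : A ⥤ B) where
  obj : A
  eq : P.obj obj = Q.obj obj

namespace StrictEqualizer

variable {A : Type u₁} [Category.{v₁} A] {B : Type u₂} [Category.{v₂} B] {P Q : A ⥤ B}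

/-- A morphism of the equalizer: a morphism of `A` with the same image under both functors. -/
@[ext]
structure Hom (a b : StrictEqualizer P Q) where
  hom : a.obj ⟶ b.obj
  eq : P.map hom = eqToHom a.eq ≫ Q.map hom ≫ eqToHom b.eq.symm

instance : Category (StrictEqualizer P Q) where
  Hom := Hom
  id a := ⟨𝟙 _, by simp⟩
  comp φ ψ := ⟨φ.hom ≫ ψ.hom, by simp [φ.eq, ψ.eq]⟩
  id_comp φ := Hom.ext (Category.id_comp φ.hom)
  comp_id φ := Hom.ext (Category.comp_id φ.hom)
  assoc φ ψ χ := Hom.ext (Category.assoc φ.hom ψ.hom χ.hom)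

end StrictEqualizer

variable {I : Type u₁} [Category.{v₁} I] (X : I ⥤ Grpd.{v, u})

/-- `∏_i X(i)^{N(I/i)}`. The cotensor `G^K` of a groupoid `G` with a simplicial set `K` is the
groupoid of functors to `G` from the fundamental groupoid of `K`; when `K` is the nerve of a
category `D`, the fundamental groupoid is the free groupoid on the category `D`. -/
abbrev HoLimSource := ∀ i : I, FreeGroupoid (Over i) ⥤ X.obj i

/-- `∏_{α : j ⟶ i} X(i)^{N(I/j)}` -/
abbrev HoLimTarget := ∀ α : Arrow I, FreeGroupoid (Over α.left) ⥤ X.obj α.right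

/-- The map with components `X(i)^{N(I/i)} ⥤ X(i)^{N(I/j)}` for `α : j ⟶ i`. -/
def holimLeft : HoLimSource X ⥤ HoLimTarget X :=
  Functor.pi' fun α => Pi.eval _ α.right ⋙
    (whiskeringLeft _ _ _).obj (FreeGroupoid.map (Over.map α.hom))

/-- The map with components `X(j)^{N(I/j)} ⥤ X(i)^{N(I/j)}` for `α : j ⟶ i`. -/
def holimRight : HoLimSource X ⥤ HoLimTarget X :=
  Functor.pi' fun α => Pi.eval _ α.left ⋙
    (whiskeringRight _ _ _).obj (X.map α.hom : X.obj α.left ⥤ X.obj α.right)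

/-- The homotopy limit of a diagram of groupoids: the equalizer of
`∏_i X(i)^{N(I/i)} ⇉ ∏_{α : j ⟶ i} X(i)^{N(I/j)}`. -/
abbrev HoLim := StrictEqualizer (holimLeft X) (holimRight X)

instance : Groupoid (HoLim X) :=
  Groupoid.ofIsIso fun {F G} φ => by
    have : IsIso φ.hom := by
      have (i : I) : IsIso (φ.hom i) := NatIso.isIso_of_isIso_app _
      exact ⟨⟨fun i => inv (φ.hom i), by ext; simp, by ext; simp⟩⟩
    refine ⟨⟨⟨inv φ.hom, ?_⟩, ?_, ?_⟩⟩
    · rw [Functor.map_inv, Functor.map_inv, IsIso.inv_eq_of_hom_inv_id]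
      simp [φ.eq]
    · exact StrictEqualizer.Hom.ext (IsIso.hom_inv_id φ.hom)
    · exact StrictEqualizer.Hom.ext (IsIso.inv_hom_id φ.hom)

theorem toHoLim_aux {G : Type u₂} [Category.{v₂} G] (c : ∀ i : I, G ⥤ X.obj i)
    (hc : ∀ {j i : I} (α : j ⟶ i), c j ⋙ X.map α = c i) {j i : I} (α : j ⟶ i) (g : G) :
    FreeGroupoid.map (Over.map α) ⋙ (Functor.const _).obj ((c i).obj g) =
      (Functor.const _).obj ((c j).obj g) ⋙ (X.map α : X.obj j ⥤ X.obj i) := by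
  rw [← hc α]
  refine CategoryTheory.Functor.ext (fun _ => rfl) (fun _ _ _ => ?_)
  simp

/-- The canonical functor to the homotopy limit induced by a (strict) cone: it sends `g` to the
family of constant functors at the images of `g`. -/
def toHoLim {G : Type u₂} [Category.{v₂} G] (c : ∀ i : I, G ⥤ X.obj i)
    (hc : ∀ {j i : I} (α : j ⟶ i), c j ⋙ X.map α = c i) : G ⥤ HoLim X where
  obj g :=
    { obj := fun i => (Functor.const _).obj ((c i).obj g)
      eq := by
        funext α
        exact toHoLim_aux X c hc α.hom g }
  map {g g'} φ :=
    { hom := fun i => (Functor.const _).map ((c i).map φ)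
      eq := by
        funext α
        ext k
        simp only [Pi.comp_apply, CategoryTheory.Functor.eqToHom_proj, NatTrans.comp_app, eqToHom_app]
        exact CategoryTheory.Functor.congr_hom (hc α.hom).symm φ }
  map_id g := StrictEqualizer.Hom.ext (by funext i; ext; simp; rfl)
  map_comp φ ψ := StrictEqualizer.Hom.ext (by funext i; ext; simp; rfl)

end HoLim

/-! ### The cosimplicial groupoid of a cover -/

section Cech

variable {C : Type u} [Category.{v} C] {J : Precoverage C} [J.HasPullbacks] {X : C}
  (𝒰 : Precoverage.ZeroHypercover.{w} J X)

instance hasWidePullback : ∀ {n : ℕ} (x : Fin (n + 1) → 𝒰.I₀),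
    HasWidePullback X (fun k => 𝒰.X (x k)) (fun k => 𝒰.f (x k))
  | 0, x => by
    refine ⟨⟨⟨WidePullbackCone.mk (𝒰.f (x 0))
      (Fin.cases (𝟙 _) (fun k => k.elim0)) ?_, ?_⟩⟩⟩
    · exact Fin.cases (Category.id_comp _) (fun k => k.elim0)
    · refine WidePullbackCone.IsLimit.mk _ (fun t => t.π 0) ?_ ?_ ?_
      · intro t
        exact t.condition 0
      · intro t
        exact Fin.cases (Category.comp_id _) (fun k => k.elim0)
      · intro t m _ h
        exact (Category.comp_id _).symm.trans (h 0)
  | n + 1, x => by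
    have := hasWidePullback (fun k : Fin (n + 1) => x k.succ)
    let b := WidePullback.base (fun k : Fin (n + 1) => 𝒰.f (x k.succ))
    let q₁ := pullback.fst (𝒰.f (x 0)) b
    let q₂ := pullback.snd (𝒰.f (x 0)) b
    have hq : q₁ ≫ 𝒰.f (x 0) = q₂ ≫ b := pullback.condition
    refine ⟨⟨⟨WidePullbackCone.mk (q₁ ≫ 𝒰.f (x 0))
      (Fin.cases q₁ (fun k => q₂ ≫ WidePullback.π _ k)) ?_, ?_⟩⟩⟩
    · refine Fin.cases rfl (fun k => ?_)
      rw [hq]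
      exact (Category.assoc _ _ _).trans (congrArg (q₂ ≫ ·) (WidePullback.π_arrow _ k))
    · let L (t : WidePullbackCone (fun k => 𝒰.f (x k))) :=
        WidePullback.lift (arrows := fun k : Fin (n + 1) => 𝒰.f (x k.succ)) t.base
          (fun k => t.π k.succ) (fun k => t.condition k.succ)
      have hL (t : WidePullbackCone (fun k => 𝒰.f (x k))) : t.π 0 ≫ 𝒰.f (x 0) = L t ≫ b :=
        (t.condition 0).trans (WidePullback.lift_base _ _ _ _).symm
      have hLπ (t : WidePullbackCone (fun k => 𝒰.f (x k))) (k : Fin (n + 1)) :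
          L t ≫ WidePullback.π (fun k : Fin (n + 1) => 𝒰.f (x k.succ)) k = t.π k.succ :=
        WidePullback.lift_π (fun k : Fin (n + 1) => 𝒰.f (x k.succ)) _ _ _ k
      have h₁ t : pullback.lift _ _ (hL t) ≫ q₁ = t.π 0 := pullback.lift_fst _ _ _
      have h₂ t : pullback.lift _ _ (hL t) ≫ q₂ = L t := pullback.lift_snd _ _ _
      refine WidePullbackCone.IsLimit.mk _ (fun t => pullback.lift _ _ (hL t)) ?_ ?_ ?_
      · intro t
        exact (Category.assoc _ _ _).symm.trans ((congrArg (· ≫ 𝒰.f (x 0)) (h₁ t)).trans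
          (t.condition 0))
      · intro t
        refine Fin.cases (h₁ t) (fun k => ?_)
        exact (Category.assoc _ _ _).symm.trans
          ((congrArg (· ≫ WidePullback.π _ k) (h₂ t)).trans (hLπ t k))
      · intro t m hb h
        apply pullback.hom_ext
        · exact (h 0).trans (h₁ t).symm
        · refine Eq.trans ?_ (h₂ t).symm
          apply WidePullback.hom_ext
          · intro k
            refine (Category.assoc _ _ _).trans ((h k.succ).trans ?_)
            exact (hLπ t k).symm
          · refine (Category.assoc _ _ _).trans ?_
            refine Eq.trans ?_ (WidePullback.lift_base _ _ _ _).symm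
            rw [← hb]
            exact congrArg (m ≫ ·) hq.symm

/-- `U_{i_0 … i_n} = U_{i_0} ×_X ⋯ ×_X U_{i_n}` -/
abbrev cechObj {n : ℕ} (x : Fin (n + 1) → 𝒰.I₀) : C :=
  widePullback X (fun k => 𝒰.X (x k)) (fun k => 𝒰.f (x k))

/-- The structure map `U_{i_0 … i_n} ⟶ X` -/
abbrev cechBase {n : ℕ} (x : Fin (n + 1) → 𝒰.I₀) : cechObj 𝒰 x ⟶ X :=
  WidePullback.base (fun k => 𝒰.f (x k))

/-- The simplicial structure of the nerve of the cover: for `σ : [m] ⟶ [n]` the map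
`U_{i_0 … i_n} ⟶ U_{i_σ(0) … i_σ(m)}` whose `k`-th component is the `σ(k)`-th projection. -/
def cechMap {m n : ℕ} (σ : Fin (m + 1) → Fin (n + 1)) (x : Fin (n + 1) → 𝒰.I₀) :
    cechObj 𝒰 x ⟶ cechObj 𝒰 (x ∘ σ) :=
  WidePullback.lift (cechBase 𝒰 x) (fun k => WidePullback.π (fun k => 𝒰.f (x k)) (σ k))
    (fun k => WidePullback.π_arrow _ (σ k))

theorem cechMap_base {m n : ℕ} (σ : Fin (m + 1) → Fin (n + 1)) (x : Fin (n + 1) → 𝒰.I₀) :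
    cechMap 𝒰 σ x ≫ cechBase 𝒰 (x ∘ σ) = cechBase 𝒰 x :=
  WidePullback.lift_base _ _ _ _

theorem cechMap_id {n : ℕ} (x : Fin (n + 1) → 𝒰.I₀) :
    cechMap 𝒰 (fun k => k) x = 𝟙 (cechObj 𝒰 x) := by
  apply WidePullback.hom_ext
  · intro k
    exact (WidePullback.lift_π _ _ _ _ _).trans (Category.id_comp _).symm
  · exact (WidePullback.lift_base _ _ _ _).trans (Category.id_comp _).symm

theorem cechMap_comp {l m n : ℕ} (τ : Fin (l + 1) → Fin (m + 1)) (σ : Fin (m + 1) → Fin (n + 1))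
    (x : Fin (n + 1) → 𝒰.I₀) :
    cechMap 𝒰 (fun k => σ (τ k)) x = cechMap 𝒰 σ x ≫ cechMap 𝒰 τ (x ∘ σ) := by
  apply WidePullback.hom_ext
  · intro k
    rw [Category.assoc]
    erw [WidePullback.lift_π, WidePullback.lift_π, WidePullback.lift_π]
  · rw [Category.assoc]
    erw [cechMap_base, cechMap_base, cechMap_base]

variable {E : Type u₂} [Category.{v₂} E] (p : E ⥤ C)

variable (n : ℕ) in
/-- `∏ E(U_{i_0 … i_n})`, the product being taken over all multi-indices. -/
abbrev CechSections : Type _ := ∀ x : Fin (n + 1) → 𝒰.I₀, Sections p (cechObj 𝒰 x)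

/-- The functor `∏ E(U_{i_0 … i_m}) ⥤ ∏ E(U_{i_0 … i_n})` induced by `σ : [m] ⟶ [n]`. -/
def cechRestrict {m n : ℕ} (σ : Fin (m + 1) → Fin (n + 1)) :
    CechSections 𝒰 p m ⥤ CechSections 𝒰 p n :=
  Functor.pi' fun x => Pi.eval _ (x ∘ σ) ⋙ restrict p (cechMap 𝒰 σ x)

theorem cechRestrict_id (n : ℕ) :
    cechRestrict 𝒰 p (fun k : Fin (n + 1) => k) = 𝟭 (CechSections 𝒰 p n) := by
  have h : (fun x : Fin (n + 1) → 𝒰.I₀ =>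
      Pi.eval (fun x => Sections p (cechObj 𝒰 x)) x ⋙ restrict p (cechMap 𝒰 (fun k => k) x)) =
      fun x => Pi.eval (fun x => Sections p (cechObj 𝒰 x)) x ⋙ 𝟭 _ := by
    funext x
    rw [← restrict_id, ← cechMap_id]
  exact congrArg Functor.pi' h

theorem cechRestrict_comp {l m n : ℕ} (τ : Fin (l + 1) → Fin (m + 1))
    (σ : Fin (m + 1) → Fin (n + 1)) :
    cechRestrict 𝒰 p (fun k => σ (τ k)) = cechRestrict 𝒰 p τ ⋙ cechRestrict 𝒰 p σ := by
  have h : (fun x : Fin (n + 1) → 𝒰.I₀ =>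
      Pi.eval (fun x => Sections p (cechObj 𝒰 x)) (fun k => x (σ (τ k))) ⋙
        restrict p (cechMap 𝒰 (fun k => σ (τ k)) x)) =
      fun x => Pi.eval (fun x => Sections p (cechObj 𝒰 x)) (fun k => x (σ (τ k))) ⋙
        restrict p (cechMap 𝒰 τ (x ∘ σ)) ⋙ restrict p (cechMap 𝒰 σ x) := by
    funext x
    rw [← restrict_comp, ← cechMap_comp]
  exact congrArg Functor.pi' h

/-- The cosimplicial groupoid `∏ E(U_i) ⇉ ∏ E(U_ij) ⇛ ∏ E(U_ijk) ⋯`. -/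
def cechGroupoid [IsFiberedInGroupoids p] :
    CosimplicialObject Grpd.{max u v v₂ w, max u v u₂ v₂ w} where
  obj n := Grpd.of (CechSections 𝒰 p n.len)
  map σ := cechRestrict 𝒰 p σ.toOrderHom
  map_id n := cechRestrict_id 𝒰 p n.len
  map_comp τ σ := cechRestrict_comp 𝒰 p τ.toOrderHom σ.toOrderHom

/-- The canonical map `E(X) ⥤ holim (∏ E(U_i) ⇉ ∏ E(U_ij) ⇛ ∏ E(U_ijk) ⋯)`, induced by the
restrictions along `U_{i_0 … i_n} ⟶ X`. -/
def comparison [IsFiberedInGroupoids p] : Sections p X ⥤ HoLim (cechGroupoid 𝒰 p) :=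
  toHoLim (cechGroupoid 𝒰 p) (fun _ => Functor.pi' fun x => restrict p (cechBase 𝒰 x))
    (fun {_ n} σ => congrArg Functor.pi' (funext fun x : Fin (n.len + 1) → 𝒰.I₀ =>
      (restrict_comp p _ _).symm.trans (congrArg (restrict p) (cechMap_base 𝒰 σ.toOrderHom x))))

end Cech

end HomotopySheaf

end

-- Both conditions range over covers, and for each fixed cover each of them says that one and the
-- same restriction functor is an equivalence. Let `SieveCat 𝒰` be the category of objects over `X`
-- with a chosen factorization through some `U_i`, with all morphisms over `X`; up to equivalence it
-- is the sieve generated by the cover. The functor in question, `sieveRestrict`, restricts functors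
-- over `C` from `C/X` to `SieveCat 𝒰`.
--
-- Descent side. By the fibered Yoneda lemma (`yon`), the fiber over `X` is equivalent to `E(X)`, so
-- the fiber may replace `E(X)`. A functor on `SieveCat 𝒰` over `C` amounts to a descent datum: its
-- values at the `U_i` are the objects, and the morphisms over identities joining two factorizations
-- of one map `V ⟶ X` give the transitions, whose composition law is the cocycle condition.
-- Conversely, every morphism is a change of factorization followed by a triangle over a single
-- `U_i`. Hence unique gluing of morphisms is full faithfulness (`homGluing_iff`), and effectivity
-- is essential surjectivity (`ObjGluing.essSurj`, `objGluing_of_essSurj`).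
--
-- Homotopy limit side. An object of the equalizer is determined up to isomorphism by its values at
-- the terminal objects of the slices and the transitions between them, that is, by a pseudocone
-- (`holimToCone`). By a Grothendieck construction (`coneToCech`), pseudocones on the cosimplicial
-- groupoid of the cover are functors over `C` on `CechCat 𝒰`, whose objects are tuples of points of
-- the cover with a common map to `X`. Restriction along the initial vertex functor `CechCat 𝒰 ⥤
-- SieveCat 𝒰` is again an equivalence (`vertexRestrict`): inclusions of vertices lie over
-- identities and so become invertible in `E`, edges then compare points with the same map to `X`,
-- and triangles make these comparisons compose. Simplices of higher dimension add nothing.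
--
-- The two routes from `E(X)` to functors on `CechCat 𝒰` agree up to isomorphism (`sectionsIso`),
-- and two-out-of-three for equivalences concludes. Throughout, every morphism of `E` is strongly
-- cartesian, so equalities of morphisms may be tested after composition with a further morphism
-- (`eq_of_comp_eq`).

universe v₃ u₃

noncomputable section

namespace HomotopySheaf

/-! ### Functors over a base -/

section FunOver

variable {C : Type u} [Category.{v} C] {E : Type u₂} [Category.{v₂} E]
  {D : Type u₁} [Category.{v₁} D] {D₁ : Type u₃} [Category.{v₃} D₁]

/-- The functors `D ⥤ E` over `C`. -/
abbrev FunOver (π : D ⥤ C) (p : E ⥤ C) :=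
  BasedFunctor (BasedCategory.ofFunctor π) (BasedCategory.ofFunctor p)

namespace FunOver

variable {π : D ⥤ C} {p : E ⥤ C}

/-- The underlying functor of a functor over `C`. -/
def fn (F : FunOver π p) : D ⥤ E := F.toFunctor

theorem proj_obj (F : FunOver π p) (d : D) : p.obj (F.fn.obj d) = π.obj d :=
  BasedFunctor.w_obj F d

instance isHomLift_map (F : FunOver π p) {d e : D} (f : d ⟶ e) :
    p.IsHomLift (π.map f) (F.fn.map f) :=
  have : (BasedCategory.ofFunctor π).p.IsHomLift (π.map f) f := IsHomLift.map π f
  BasedFunctor.preserves_isHomLift F (π.map f) f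

/-- Constructor for functors over `C`. -/
def mk' (F : D ⥤ E) (h₀ : ∀ d, p.obj (F.obj d) = π.obj d)
    (h : ∀ {d e : D} (f : d ⟶ e), p.IsHomLift (π.map f) (F.map f)) : FunOver π p where
  toFunctor := F
  w := CategoryTheory.Functor.ext h₀ fun d e f => by
    have := h f
    exact IsHomLift.fac' p (π.map f) (F.map f)

/-- The underlying natural transformation of a morphism of functors over `C`. -/
def homFn {F G : FunOver π p} (φ : F ⟶ G) : F.fn ⟶ G.fn := φ.toNatTrans

instance isHomLift_homFn {F G : FunOver π p} (φ : F ⟶ G) (d : D) :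
    p.IsHomLift (𝟙 (π.obj d)) ((homFn φ).app d) := φ.isHomLift' d

theorem hom_ext {F G : FunOver π p} {φ ψ : F ⟶ G}
    (h : ∀ d, (homFn φ).app d = (homFn ψ).app d) : φ = ψ :=
  BasedNatTrans.homCategory.ext φ ψ (NatTrans.ext (funext h))

/-- Constructor for morphisms of functors over `C`. -/
def mkHom {F G : FunOver π p} (app : ∀ d, F.fn.obj d ⟶ G.fn.obj d)
    (naturality : ∀ {d e : D} (f : d ⟶ e), F.fn.map f ≫ app e = app d ≫ G.fn.map f)
    (h : ∀ d, p.IsHomLift (𝟙 (π.obj d)) (app d)) : F ⟶ G where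
  toNatTrans := { app := app, naturality := fun _ _ f => naturality f }
  isHomLift' := h

/-- The components lie over identities and are therefore invertible. Thus a natural transformation
over `C` in one direction already proves two functors over `C` isomorphic. -/
theorem isIso_hom [IsFiberedInGroupoids p] {F G : FunOver π p} (φ : F ⟶ G) : IsIso φ := by
  have (d : D) : IsIso ((homFn φ).app d) := isIso_of_isHomLift_id p (X := π.obj d) _
  have : IsIso (X := F.toFunctor) φ.toNatTrans := NatIso.isIso_of_isIso_app (homFn φ)
  exact BasedNatIso.isIso_of_toNatTrans_isIso φ

/-- Precomposition with a functor over `C`. -/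
def pre (p : E ⥤ C) {π' : D₁ ⥤ C} (H : D₁ ⥤ D) (hH : H ⋙ π = π') :
    FunOver π p ⥤ FunOver π' p where
  obj F :=
    { toFunctor := H ⋙ F.fn
      w := (congrArg (H ⋙ ·) F.w).trans hH }
  map φ :=
    { toNatTrans := Functor.whiskerLeft H (homFn φ)
      isHomLift' := fun a => by
        subst hH
        exact φ.isHomLift' (H.obj a) }

end FunOver

end FunOver

/-! ### Lifting morphisms in a category fibered in groupoids -/

section Assoc

variable {E : Type u₂} [Category.{v₂} E]

theorem comp_assoc_of_eq {a b c : E} {f : a ⟶ b} {g : b ⟶ c} {k : a ⟶ c} (h : f ≫ g = k)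
    {d : E} (z : c ⟶ d) : f ≫ g ≫ z = k ≫ z := by
  rw [← Category.assoc, h]

theorem comp_assoc_of_square {a b b' c : E} {f : a ⟶ b} {g : b ⟶ c} {f' : a ⟶ b'} {g' : b' ⟶ c}
    (h : f ≫ g = f' ≫ g') {d : E} (z : c ⟶ d) : f ≫ g ≫ z = f' ≫ g' ≫ z := by
  rw [← Category.assoc, h, Category.assoc]

end Assoc

section Lift

variable {C : Type u} [Category.{v} C] {E : Type u₂} [Category.{v₂} E]

theorem isHomLift_comp (p : E ⥤ C) {R S T : C} {a b c : E} (f : R ⟶ S) (g : S ⟶ T) (h : R ⟶ T)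
    (w : f ≫ g = h) (φ : a ⟶ b) (ψ : b ⟶ c) [p.IsHomLift f φ] [p.IsHomLift g ψ] :
    p.IsHomLift h (φ ≫ ψ) := by
  subst w; infer_instance

variable (p : E ⥤ C) [IsFiberedInGroupoids p]

/-- Every morphism `χ` of `E` is strongly cartesian over its image, so a morphism into its source is
determined by its image in `C` and its composite with `χ`. This cancellation drives nearly all later
identities between chosen pullbacks. -/
theorem eq_of_comp_eq {R S : C} {a b c : E} (f : R ⟶ S) {φ φ' : a ⟶ b} (χ : b ⟶ c)
    (h : φ ≫ χ = φ' ≫ χ) (h₁ : p.IsHomLift f φ := by infer_instance)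
    (h₂ : p.IsHomLift f φ' := by infer_instance) : φ = φ' := by
  obtain rfl := IsHomLift.codomain_eq p f φ
  have := isStronglyCartesian p (p.map χ) χ
  exact IsStronglyCartesian.ext p (p.map χ) χ f h

/-- The unique lift of `f` through which a lift `ψ` of `h = f ≫ g` factors over a
lift `χ` of `g`. -/
def factor {R S T : C} {a b c : E} (f : R ⟶ S) (g : S ⟶ T) (h : R ⟶ T) (w : f ≫ g = h)
    (χ : b ⟶ c) [p.IsHomLift g χ] (ψ : a ⟶ c) [p.IsHomLift h ψ] : a ⟶ b :=
  have := isStronglyCartesian p g χ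
  IsStronglyCartesian.map p g χ w.symm ψ

instance isHomLift_factor {R S T : C} {a b c : E} (f : R ⟶ S) (g : S ⟶ T) (h : R ⟶ T)
    (w : f ≫ g = h) (χ : b ⟶ c) [p.IsHomLift g χ] (ψ : a ⟶ c) [p.IsHomLift h ψ] :
    p.IsHomLift f (factor p f g h w χ ψ) := by
  have := isStronglyCartesian p g χ
  unfold factor
  infer_instance

theorem factor_comp {R S T : C} {a b c : E} (f : R ⟶ S) (g : S ⟶ T) (h : R ⟶ T) (w : f ≫ g = h)
    (χ : b ⟶ c) [p.IsHomLift g χ] (ψ : a ⟶ c) [p.IsHomLift h ψ] :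
    factor p f g h w χ ψ ≫ χ = ψ := by
  have := isStronglyCartesian p g χ
  exact IsStronglyCartesian.fac p g χ w.symm ψ

end Lift

/-! ### Chosen pullbacks and restrictions -/

section Fiber

variable {C : Type u} [Category.{v} C] {E : Type u₂} [Category.{v₂} E] {p : E ⥤ C} {X : C}

/-- The object of `E` underlying an object of a fiber. -/
def fobj (a : p.Fiber X) : E := a.1

/-- The morphism of `E` underlying a morphism of a fiber. -/
def fhom {a b : p.Fiber X} (φ : a ⟶ b) : fobj a ⟶ fobj b := φ.1

instance isHomLift_fhom {a b : p.Fiber X} (φ : a ⟶ b) : p.IsHomLift (𝟙 X) (fhom φ) := φ.2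

theorem fhom_id (a : p.Fiber X) : fhom (𝟙 a) = 𝟙 (fobj a) := rfl

theorem fhom_comp {a b c : p.Fiber X} (φ : a ⟶ b) (ψ : b ⟶ c) :
    fhom (φ ≫ ψ) = fhom φ ≫ fhom ψ := rfl

theorem fhom_injective {a b : p.Fiber X} {φ ψ : a ⟶ b} (h : fhom φ = fhom ψ) : φ = ψ :=
  Subtype.ext h

/-- A morphism in a fiber from a morphism of `E` over the identity. -/
def fhomMk {a b : p.Fiber X} (φ : fobj a ⟶ fobj b) (h : p.IsHomLift (𝟙 X) φ) : a ⟶ b := ⟨φ, h⟩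

theorem fhom_fhomMk {a b : p.Fiber X} (φ : fobj a ⟶ fobj b) (h : p.IsHomLift (𝟙 X) φ) :
    fhom (fhomMk φ h) = φ := rfl

end Fiber

section Pull

variable {C : Type u} [Category.{v} C] {E : Type u₂} [Category.{v₂} E]
  (p : E ⥤ C) [IsFiberedInGroupoids p]

/-- The chosen morphism `f^* a ⟶ a` over `f`. -/
def proj {X Y : C} (f : Y ⟶ X) (a : p.Fiber X) : fobj ((pull p f).obj a) ⟶ fobj a :=
  pullProj f a

instance isHomLift_proj {X Y : C} (f : Y ⟶ X) (a : p.Fiber X) : p.IsHomLift f (proj p f a) :=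
  (pullProj_isCartesian p f a).toIsHomLift

/-- The canonical morphism `h^* a ⟶ f^* a` over `g`, where `h` is the composite of `g` and `f`. -/
def pullTrans {X Y Z : C} (g : Z ⟶ Y) (f : Y ⟶ X) (h : Z ⟶ X) (w : g ≫ f = h) (a : p.Fiber X) :
    fobj ((pull p h).obj a) ⟶ fobj ((pull p f).obj a) :=
  factor p g f h w (proj p f a) (proj p h a)

instance isHomLift_pullTrans {X Y Z : C} (g : Z ⟶ Y) (f : Y ⟶ X) (h : Z ⟶ X) (w : g ≫ f = h)
    (a : p.Fiber X) : p.IsHomLift g (pullTrans p g f h w a) := by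
  unfold pullTrans; infer_instance

theorem pullTrans_proj {X Y Z : C} (g : Z ⟶ Y) (f : Y ⟶ X) (h : Z ⟶ X) (w : g ≫ f = h)
    (a : p.Fiber X) : pullTrans p g f h w a ≫ proj p f a = proj p h a :=
  factor_comp p g f h w _ _

theorem pullTrans_comp {X Y Z W : C} (k : W ⟶ Z) (g : Z ⟶ Y) (f : Y ⟶ X) (h : Z ⟶ X)
    (w : g ≫ f = h) (h' : W ⟶ X) (w' : k ≫ h = h') (kg : W ⟶ Y) (w'' : k ≫ g = kg)
    (a : p.Fiber X) :
    pullTrans p k h h' w' a ≫ pullTrans p g f h w a =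
      pullTrans p kg f h' (by rw [← w'', Category.assoc, w, w']) a := by
  have := isHomLift_comp p k g kg w'' (pullTrans p k h h' w' a) (pullTrans p g f h w a)
  refine eq_of_comp_eq p kg (proj p f a) ?_
  rw [Category.assoc, pullTrans_proj, pullTrans_proj, pullTrans_proj]

theorem pullTrans_id {X Y : C} (f : Y ⟶ X) (a : p.Fiber X) :
    pullTrans p (𝟙 Y) f f (Category.id_comp f) a = 𝟙 _ := by
  have : p.IsHomLift (𝟙 Y) (𝟙 (fobj ((pull p f).obj a))) := IsHomLift.id ((pull p f).obj a).2
  refine eq_of_comp_eq p (𝟙 Y) (proj p f a) ?_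
  rw [pullTrans_proj, Category.id_comp]

theorem pull_map_proj {X Y : C} (f : Y ⟶ X) {a b : p.Fiber X} (φ : a ⟶ b) :
    fhom ((pull p f).map φ) ≫ proj p f b = proj p f a ≫ fhom φ :=
  have : p.IsHomLift f (pullProj f a ≫ φ.1) :=
    inferInstanceAs (p.IsHomLift f (proj p f a ≫ fhom φ))
  pullLift_proj p f b (pullObj f a) (pullProj f a ≫ φ.1)

theorem pull_map_trans {X Y Z : C} (g : Z ⟶ Y) (f : Y ⟶ X) (h : Z ⟶ X) (w : g ≫ f = h)
    {a b : p.Fiber X} (φ : a ⟶ b) :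
    fhom ((pull p h).map φ) ≫ pullTrans p g f h w b =
      pullTrans p g f h w a ≫ fhom ((pull p f).map φ) := by
  refine eq_of_comp_eq p g (proj p f b) ?_
  rw [Category.assoc, Category.assoc, pullTrans_proj, pull_map_proj, pull_map_proj,
    comp_assoc_of_eq (pullTrans_proj p g f h w a)]

theorem pullComp_hom_trans {X Y Z : C} (g : Z ⟶ Y) (f : Y ⟶ X) (h : Z ⟶ X) (w : g ≫ f = h)
    (a : p.Fiber X) :
    fhom (pullComp p g f h w a).hom ≫ pullTrans p g f h w a = proj p g ((pull p f).obj a) := by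
  have h1 : p.IsHomLift h (pullProj g (pullObj f a) ≫ pullProj f a) := by
    subst w; infer_instance
  refine eq_of_comp_eq p g (proj p f a) ?_
  rw [Category.assoc, pullTrans_proj]
  exact pullLift_proj p h a (pullObj g (pullObj f a)) (pullProj g (pullObj f a) ≫ pullProj f a)

theorem pullComp_inv_proj {X Y Z : C} (g : Z ⟶ Y) (f : Y ⟶ X) (h : Z ⟶ X) (w : g ≫ f = h)
    (a : p.Fiber X) :
    fhom (pullComp p g f h w a).inv ≫ proj p g ((pull p f).obj a) = pullTrans p g f h w a := by
  rw [← pullComp_hom_trans p g f h w a, ← Category.assoc, ← fhom_comp, Iso.inv_hom_id, fhom_id,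
    Category.id_comp]

section Res

variable {W V X Y : C} (g : W ⟶ V) {s : V ⟶ X} {t : V ⟶ Y} (s' : W ⟶ X) (t' : W ⟶ Y)
    (hs : g ≫ s = s') (ht : g ≫ t = t') {a : p.Fiber X} {b : p.Fiber Y}

/-- This square absorbs the two `pullComp` isomorphisms in `res`. Since `pullTrans` can be
cancelled, it also characterizes the restriction (`res_eq`), and `res` need not be unfolded again.
-/
theorem res_trans (φ : (pull p s).obj a ⟶ (pull p t).obj b) :
    fhom (res p g s' t' hs ht φ) ≫ pullTrans p g t t' ht b =
      pullTrans p g s s' hs a ≫ fhom φ := by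
  unfold res
  rw [fhom_comp, fhom_comp, Category.assoc, Category.assoc, pullComp_hom_trans, pull_map_proj,
    comp_assoc_of_eq (pullComp_inv_proj p g s s' hs a)]

theorem res_eq (φ : (pull p s).obj a ⟶ (pull p t).obj b)
    (χ : (pull p s').obj a ⟶ (pull p t').obj b)
    (h : fhom χ ≫ pullTrans p g t t' ht b = pullTrans p g s s' hs a ≫ fhom φ) :
    res p g s' t' hs ht φ = χ := by
  refine fhom_injective (eq_of_comp_eq p (𝟙 W) (pullTrans p g t t' ht b) ?_)
  rw [res_trans, h]

theorem res_comp {Z : C} {r : V ⟶ Z} (r' : W ⟶ Z) (hr : g ≫ r = r') {c : p.Fiber Z}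
    (φ : (pull p s).obj a ⟶ (pull p t).obj b) (ψ : (pull p t).obj b ⟶ (pull p r).obj c) :
    res p g s' r' hs hr (φ ≫ ψ) = res p g s' t' hs ht φ ≫ res p g t' r' ht hr ψ := by
  apply res_eq
  rw [fhom_comp, fhom_comp, Category.assoc, res_trans,
    comp_assoc_of_square (res_trans p g s' t' hs ht φ)]

theorem res_res {W' : C} (k : W' ⟶ W) (s'' : W' ⟶ X) (t'' : W' ⟶ Y) (hs' : k ≫ s' = s'')
    (ht' : k ≫ t' = t'') (kg : W' ⟶ V) (w : k ≫ g = kg)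
    (φ : (pull p s).obj a ⟶ (pull p t).obj b) :
    res p k s'' t'' hs' ht' (res p g s' t' hs ht φ) =
      res p kg s'' t'' (by rw [← w, Category.assoc, hs, hs'])
        (by rw [← w, Category.assoc, ht, ht']) φ := by
  symm
  apply res_eq
  rw [← pullTrans_comp p k g t t' ht t'' ht' kg w, ← pullTrans_comp p k g s s' hs s'' hs' kg w,
    comp_assoc_of_square (res_trans p k s'' t'' hs' ht' _), Category.assoc, res_trans]

end Res

theorem res_id {V X Y : C} {s : V ⟶ X} {t : V ⟶ Y} {a : p.Fiber X} {b : p.Fiber Y}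
    (φ : (pull p s).obj a ⟶ (pull p t).obj b) :
    res p (𝟙 V) s t (Category.id_comp s) (Category.id_comp t) φ = φ := by
  apply res_eq
  rw [pullTrans_id, pullTrans_id, Category.comp_id, Category.id_comp]

theorem res_pull_map {W V X : C} (g : W ⟶ V) (s : V ⟶ X) (s' : W ⟶ X) (hs : g ≫ s = s')
    {a b : p.Fiber X} (φ : a ⟶ b) :
    res p g s' s' hs hs ((pull p s).map φ) = (pull p s').map φ :=
  res_eq p g s' s' hs hs _ _ (pull_map_trans p g s s' hs φ)

end Pull

/-! ### The sections over `X` and the fiber over `X` -/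

section Yoneda

variable {C : Type u} [Category.{v} C] {E : Type u₂} [Category.{v₂} E]
  (p : E ⥤ C) [IsFiberedInGroupoids p] (X : C)

/-- The section of `E` over `C/X` given by the chosen pullbacks of an object over `X`. -/
def yonObj (a : p.Fiber X) : FunOver (Over.forget X) p :=
  FunOver.mk'
    { obj := fun u => fobj ((pull p u.hom).obj a)
      map := fun {u u'} h => pullTrans p h.left u'.hom u.hom (Over.w h) a
      map_id := fun u => pullTrans_id p u.hom a
      map_comp := fun {u u' u''} h h' =>
        (pullTrans_comp p h.left h'.left u''.hom u'.hom (Over.w h') u.hom (Over.w h) _ rfl a).symm }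
    (fun u => ((pull p u.hom).obj a).2)
    (fun {u u'} h => isHomLift_pullTrans p h.left u'.hom u.hom (Over.w h) a)

/-- The functor from the fiber over `X` to the sections over `C/X` given by chosen pullbacks. -/
def yon : p.Fiber X ⥤ FunOver (Over.forget X) p where
  obj a := yonObj p X a
  map {a b} φ := FunOver.mkHom (F := yonObj p X a) (G := yonObj p X b)
    (fun u => fhom ((pull p u.hom).map φ))
    (fun {u u'} h => (pull_map_trans p h.left u'.hom u.hom (Over.w h) φ).symm)
    (fun u => isHomLift_fhom ((pull p u.hom).map φ))
  map_id a := FunOver.hom_ext fun u =>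
    congrArg Subtype.val ((pull p u.hom).map_id a)
  map_comp φ ψ := FunOver.hom_ext fun u =>
    congrArg Subtype.val ((pull p u.hom).map_comp φ ψ)

instance isIso_proj_id (a : p.Fiber X) : IsIso (proj p (𝟙 X) a) :=
  isIso_of_isHomLift_id p (X := X) _

/-- The component at `𝟙 X` already determines the morphism, because the projection from the chosen
pullback along `𝟙 X` is invertible. -/
instance : (yon p X).Faithful where
  map_injective {a b φ ψ} h := by
    have h1 : fhom ((pull p (𝟙 X)).map φ) = fhom ((pull p (𝟙 X)).map ψ) :=
      congrArg (fun η => (FunOver.homFn η).app (Over.mk (𝟙 X))) h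
    have h2 : proj p (𝟙 X) a ≫ fhom φ = proj p (𝟙 X) a ≫ fhom ψ := by
      rw [← pull_map_proj, h1, pull_map_proj]
    exact fhom_injective ((cancel_epi _).1 h2)

/-- Conjugating the component at `𝟙 X` by the projections gives the only candidate; naturality along
`u ⟶ 𝟙 X` in `C/X` shows that it induces every component. -/
instance : (yon p X).Full where
  map_surjective {a b} η := by
    let app (u : Over X) : fobj ((pull p u.hom).obj a) ⟶ fobj ((pull p u.hom).obj b) :=
      (FunOver.homFn η).app u
    have happ (u : Over X) : p.IsHomLift (𝟙 u.left) (app u) := FunOver.isHomLift_homFn η u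
    have nat (u : Over X) : pullTrans p u.hom (𝟙 X) u.hom (Category.comp_id _) a ≫
        app (Over.mk (𝟙 X)) = app u ≫ pullTrans p u.hom (𝟙 X) u.hom (Category.comp_id _) b :=
      (FunOver.homFn η).naturality (Over.homMk u.hom : u ⟶ Over.mk (𝟙 X))
    have : p.IsHomLift (𝟙 X) (app (Over.mk (𝟙 X))) := happ (Over.mk (𝟙 X))
    let ψ : fobj a ⟶ fobj b := inv (proj p (𝟙 X) a) ≫ app (Over.mk (𝟙 X)) ≫ proj p (𝟙 X) b
    have hψ : proj p (𝟙 X) a ≫ ψ = app (Over.mk (𝟙 X)) ≫ proj p (𝟙 X) b :=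
      IsIso.hom_inv_id_assoc _ _
    have : p.IsHomLift (𝟙 X) ψ := by
      have h1 := isHomLift_comp p (𝟙 X) (𝟙 X) (𝟙 X) (Category.id_comp _)
        (app (Over.mk (𝟙 X))) (proj p (𝟙 X) b)
      exact isHomLift_comp p (𝟙 X) (𝟙 X) (𝟙 X) (Category.id_comp _) _ _
    refine ⟨fhomMk ψ this, FunOver.hom_ext fun u => ?_⟩
    refine eq_of_comp_eq p (𝟙 u.left) (proj p u.hom b) ?_
      (isHomLift_fhom ((pull p u.hom).map _)) (happ u)
    refine (pull_map_proj p u.hom _).trans ?_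
    rw [fhom_fhomMk]
    change _ = app u ≫ _
    rw [← pullTrans_proj p u.hom (𝟙 X) u.hom (Category.comp_id _) a,
      ← pullTrans_proj p u.hom (𝟙 X) u.hom (Category.comp_id _) b, Category.assoc, hψ,
      comp_assoc_of_square (nat u)]

/-- The image under `F` of the map from `u` to the terminal object of `C/X` is cartesian, so `F` at
`u` is a pullback of its value at `𝟙 X` and is compared with the chosen one. -/
instance : (yon p X).EssSurj where
  mem_essImage F := by
    let a : p.Fiber X := ⟨F.fn.obj (Over.mk (𝟙 X)), F.proj_obj (Over.mk (𝟙 X))⟩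
    let m (u : Over X) : F.fn.obj u ⟶ fobj a := F.fn.map (Over.homMk u.hom : u ⟶ Over.mk (𝟙 X))
    have hm (u : Over X) : p.IsHomLift u.hom (m u) :=
      F.isHomLift_map (Over.homMk u.hom : u ⟶ Over.mk (𝟙 X))
    let e (u : Over X) : fobj ((pull p u.hom).obj a) ⟶ F.fn.obj u :=
      factor p (𝟙 u.left) u.hom u.hom (Category.id_comp _) (m u) (proj p u.hom a)
    have he (u : Over X) : e u ≫ m u = proj p u.hom a := factor_comp p _ _ _ _ _ _
    have he' (u : Over X) : p.IsHomLift (𝟙 u.left) (e u) := isHomLift_factor p _ _ _ _ _ _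
    let η : (yon p X).obj a ⟶ F := FunOver.mkHom e
      (fun {u u'} h => by
        have : p.IsHomLift h.left (F.fn.map h) := F.isHomLift_map h
        have hh : F.fn.map h ≫ m u' = m u := by
          refine (F.fn.map_comp _ _).symm.trans (congrArg F.fn.map ?_)
          ext
          simp
        change pullTrans p h.left u'.hom u.hom (Over.w h) a ≫ e u' = e u ≫ F.fn.map h
        refine eq_of_comp_eq p h.left (m u') ?_
        rw [Category.assoc, Category.assoc, he, hh, he, pullTrans_proj])
      he'
    have := FunOver.isIso_hom η
    exact ⟨a, ⟨asIso η⟩⟩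

instance : (yon p X).IsEquivalence where

end Yoneda

/-! ### The category of objects mapping to a cover -/

section Sieve

variable {C : Type u} [Category.{v} C] {J : Precoverage C} {X : C}
  (𝒰 : Precoverage.ZeroHypercover.{w} J X)

/-- A point of the cover with values in `V`: a morphism from `V` to one of the `U_i`. -/
structure CoverPoint (V : C) where
  idx : 𝒰.I₀
  hom : V ⟶ 𝒰.X idx

namespace CoverPoint

variable {𝒰} {V W : C}

/-- The underlying morphism to `X`. -/
def base (P : CoverPoint 𝒰 V) : V ⟶ X := P.hom ≫ 𝒰.f P.idx

/-- The pullback of a point. -/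
def pullback (h : W ⟶ V) (P : CoverPoint 𝒰 V) : CoverPoint 𝒰 W := ⟨P.idx, h ≫ P.hom⟩

theorem base_pullback (h : W ⟶ V) (P : CoverPoint 𝒰 V) :
    (P.pullback h).base = h ≫ P.base := Category.assoc _ _ _

theorem pullback_id (P : CoverPoint 𝒰 V) : P.pullback (𝟙 V) = P :=
  congrArg (CoverPoint.mk P.idx) (Category.id_comp P.hom)

theorem pullback_comp {Z : C} (k : Z ⟶ W) (h : W ⟶ V) (P : CoverPoint 𝒰 V) :
    P.pullback (k ≫ h) = (P.pullback h).pullback k :=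
  congrArg (CoverPoint.mk P.idx) (Category.assoc k h P.hom)

end CoverPoint

/-- The objects over `X` together with a factorization through a member of the cover. -/
structure SieveCat where
  left : C
  pt : CoverPoint 𝒰 left

namespace SieveCat

variable {𝒰}

/-- The morphisms are all the morphisms over `X`. -/
@[ext]
structure Hom (a b : SieveCat 𝒰) where
  left : a.left ⟶ b.left
  w : left ≫ b.pt.base = a.pt.base

instance : Category (SieveCat 𝒰) where
  Hom := Hom
  id a := ⟨𝟙 _, Category.id_comp _⟩
  comp f g := ⟨f.left ≫ g.left, by rw [Category.assoc, g.w, f.w]⟩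
  id_comp f := Hom.ext (Category.id_comp _)
  comp_id f := Hom.ext (Category.comp_id _)
  assoc f g h := Hom.ext (Category.assoc _ _ _)

/-- Constructor for morphisms. -/
def homMk {a b : SieveCat 𝒰} (h : a.left ⟶ b.left) (w : h ≫ b.pt.base = a.pt.base) : a ⟶ b :=
  ⟨h, w⟩

theorem hom_ext {a b : SieveCat 𝒰} {f g : a ⟶ b} (h : Hom.left f = Hom.left g) : f = g :=
  Hom.ext h

variable (𝒰)

/-- The projection to `C`. -/
def forget : SieveCat 𝒰 ⥤ C where
  obj a := a.left
  map f := Hom.left f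

/-- The inclusion into the category of all objects over `X`. -/
def toOver : SieveCat 𝒰 ⥤ Over X where
  obj a := Over.mk a.pt.base
  map f := Over.homMk (Hom.left f) (Hom.w f)

end SieveCat

variable {E : Type u₂} [Category.{v₂} E] (p : E ⥤ C) [IsFiberedInGroupoids p]

/-- The restriction of the sections over `X` to the objects mapping to the cover. -/
def sieveRestrict : FunOver (Over.forget X) p ⥤ FunOver (SieveCat.forget 𝒰) p :=
  FunOver.pre p (SieveCat.toOver 𝒰) rfl

instance isHomLift_sieve_app {T T' : FunOver (SieveCat.forget 𝒰) p} (η : T ⟶ T')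
    (a : SieveCat 𝒰) : p.IsHomLift (𝟙 a.left) ((FunOver.homFn η).app a) :=
  FunOver.isHomLift_homFn η a

/-- Restriction of the objects over `X` to the cover. -/
def fiberRestrict : p.Fiber X ⥤ FunOver (SieveCat.forget 𝒰) p := yon p X ⋙ sieveRestrict 𝒰 p

theorem isEquivalence_sieveRestrict_iff :
    (sieveRestrict 𝒰 p).IsEquivalence ↔ (fiberRestrict 𝒰 p).IsEquivalence := by
  constructor
  · intro h
    exact inferInstanceAs (yon p X ⋙ sieveRestrict 𝒰 p).IsEquivalence
  · intro h
    have : (yon p X ⋙ sieveRestrict 𝒰 p).IsEquivalence := h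
    exact Functor.isEquivalence_of_comp_left (yon p X) (sieveRestrict 𝒰 p)

end Sieve

/-! ### Descent along a cover and the category of objects mapping to the cover -/

section Descent

variable {C : Type u} [Category.{v} C] {J : Precoverage C} {X : C}
  {𝒰 : Precoverage.ZeroHypercover.{w} J X}
  {E : Type u₂} [Category.{v₂} E] {p : E ⥤ C} [IsFiberedInGroupoids p]

/-- The components of a morphism between restrictions of objects over `X`, in the fibers. -/
def sieveComponent {a b : p.Fiber X} (η : (fiberRestrict 𝒰 p).obj a ⟶ (fiberRestrict 𝒰 p).obj b)
    (P : SieveCat 𝒰) : (pull p P.pt.base).obj a ⟶ (pull p P.pt.base).obj b :=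
  fhomMk ((FunOver.homFn η).app P) (isHomLift_sieve_app 𝒰 p η P)

theorem res_sieveComponent {a b : p.Fiber X}
    (η : (fiberRestrict 𝒰 p).obj a ⟶ (fiberRestrict 𝒰 p).obj b) {P Q : SieveCat 𝒰} (h : P ⟶ Q) :
    res p (SieveCat.Hom.left h) P.pt.base P.pt.base (SieveCat.Hom.w h) (SieveCat.Hom.w h)
      (sieveComponent η Q) = sieveComponent η P :=
  res_eq p _ _ _ _ _ _ _ ((FunOver.homFn η).naturality h).symm

theorem sieveComponent_map {a b : p.Fiber X} (ψ : a ⟶ b) (P : SieveCat 𝒰) :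
    sieveComponent ((fiberRestrict 𝒰 p).map ψ) P = (pull p P.pt.base).map ψ := rfl

theorem sieveComponent_ext {a b : p.Fiber X}
    {η η' : (fiberRestrict 𝒰 p).obj a ⟶ (fiberRestrict 𝒰 p).obj b}
    (h : ∀ P, sieveComponent η P = sieveComponent η' P) : η = η' :=
  FunOver.hom_ext fun P => congrArg fhom (h P)

/-- A morphism between restrictions of objects over `X` from compatible morphisms in the fibers. -/
def sieveHomMk {a b : p.Fiber X}
    (φ : ∀ P : SieveCat 𝒰, (pull p P.pt.base).obj a ⟶ (pull p P.pt.base).obj b)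
    (hφ : ∀ {P Q : SieveCat 𝒰} (h : P ⟶ Q),
      res p (SieveCat.Hom.left h) P.pt.base P.pt.base (SieveCat.Hom.w h) (SieveCat.Hom.w h)
        (φ Q) = φ P) :
    (fiberRestrict 𝒰 p).obj a ⟶ (fiberRestrict 𝒰 p).obj b :=
  FunOver.mkHom (fun P => fhom (φ P))
    (fun {P Q} h => by
      rw [← hφ h]
      exact (res_trans p (SieveCat.Hom.left h) P.pt.base P.pt.base _ _ (φ Q)).symm)
    (fun P => isHomLift_fhom (φ P))

variable (𝒰) in
/-- The member `U_i` of the cover. -/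
def member (i : 𝒰.I₀) : SieveCat 𝒰 := ⟨𝒰.X i, ⟨i, 𝟙 _⟩⟩

variable (𝒰) in
theorem member_base (i : 𝒰.I₀) : (member 𝒰 i).pt.base = 𝒰.f i := Category.id_comp _

/-- The morphism to a member of the cover given by a point. -/
def toMember (P : SieveCat 𝒰) : P ⟶ member 𝒰 P.pt.idx :=
  SieveCat.homMk P.pt.hom (congrArg (P.pt.hom ≫ ·) (member_base 𝒰 _))

/-- The components on the members of the cover of a morphism between restrictions. -/
def memberComponent {a b : p.Fiber X}
    (η : (fiberRestrict 𝒰 p).obj a ⟶ (fiberRestrict 𝒰 p).obj b) (i : 𝒰.I₀) :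
    (pull p (𝒰.f i)).obj a ⟶ (pull p (𝒰.f i)).obj b :=
  res p (𝟙 _) (𝒰.f i) (𝒰.f i) ((Category.id_comp _).trans (member_base 𝒰 i))
    ((Category.id_comp _).trans (member_base 𝒰 i)) (sieveComponent η (member 𝒰 i))

/-- Every object of `SieveCat 𝒰` maps to the member through which it factors, so naturality along
`toMember` recovers all components from those at the `U_i`. -/
theorem res_memberComponent {a b : p.Fiber X}
    (η : (fiberRestrict 𝒰 p).obj a ⟶ (fiberRestrict 𝒰 p).obj b) (P : SieveCat 𝒰) :
    res p P.pt.hom P.pt.base P.pt.base rfl rfl (memberComponent η P.pt.idx) =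
      sieveComponent η P := by
  refine (res_res p (𝟙 _) _ _ _ _ P.pt.hom _ _ _ _ P.pt.hom (Category.comp_id _) _).trans ?_
  exact res_sieveComponent η (toMember P)

/-- Two factorizations of the same map `V ⟶ X` are joined by a morphism over `𝟙 V`; naturality along
it yields the compatibility on overlaps. -/
theorem res_memberComponent_eq {a b : p.Fiber X}
    (η : (fiberRestrict 𝒰 p).obj a ⟶ (fiberRestrict 𝒰 p).obj b) {V : C} (i j : 𝒰.I₀)
    (s : V ⟶ 𝒰.X i) (t : V ⟶ 𝒰.X j) (hst : t ≫ 𝒰.f j = s ≫ 𝒰.f i) :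
    res p s (s ≫ 𝒰.f i) (s ≫ 𝒰.f i) rfl rfl (memberComponent η i) =
      res p t (s ≫ 𝒰.f i) (s ≫ 𝒰.f i) hst hst (memberComponent η j) := by
  let P : SieveCat 𝒰 := ⟨V, ⟨i, s⟩⟩
  let Q : SieveCat 𝒰 := ⟨V, ⟨j, t⟩⟩
  let h : P ⟶ Q := SieveCat.homMk (𝟙 V) ((Category.id_comp _).trans hst)
  refine (res_memberComponent η P).trans ((res_sieveComponent η h).symm.trans ?_)
  rw [← res_memberComponent η Q]
  exact res_res p t _ _ _ _ (𝟙 V) _ _ _ _ t (Category.id_comp _) _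

variable [J.HasPullbacks]

/-- The statement that morphisms glue uniquely along a cover. -/
def HomGluing (p : E ⥤ C) [IsFiberedInGroupoids p] (𝒰 : Precoverage.ZeroHypercover.{w} J X) :
    Prop :=
  ∀ (a b : p.Fiber X)
    (φ : ∀ i, (pull p (𝒰.f i)).obj a ⟶ (pull p (𝒰.f i)).obj b)
    (_ : ∀ i j,
      res p (fst₂ 𝒰 i j) (base₂ 𝒰 i j) (base₂ 𝒰 i j) rfl rfl (φ i) =
        res p (snd₂ 𝒰 i j) (base₂ 𝒰 i j) (base₂ 𝒰 i j)
          (snd₂_f 𝒰 i j) (snd₂_f 𝒰 i j) (φ j)),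
    ∃! ψ : a ⟶ b, ∀ i, (pull p (𝒰.f i)).map ψ = φ i

/-- Morphisms between the restrictions of `a` and `b` correspond to families on the `U_i` compatible
on the overlaps, so unique gluing is bijectivity of the restriction on morphisms. -/
theorem homGluing_iff : HomGluing p 𝒰 ↔
    (fiberRestrict 𝒰 p).Full ∧ (fiberRestrict 𝒰 p).Faithful := by
  constructor
  · intro H
    have hloc {a b : p.Fiber X} (η : (fiberRestrict 𝒰 p).obj a ⟶ (fiberRestrict 𝒰 p).obj b)
        (ψ : a ⟶ b) : (fiberRestrict 𝒰 p).map ψ = η ↔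
          ∀ i, (pull p (𝒰.f i)).map ψ = memberComponent η i := by
      constructor
      · rintro rfl i
        exact (res_pull_map p _ _ _ _ ψ).symm
      · intro h
        refine sieveComponent_ext fun P => ?_
        rw [sieveComponent_map, ← res_memberComponent, ← h]
        exact (res_pull_map p _ _ _ _ ψ).symm
    have hex {a b : p.Fiber X} (η : (fiberRestrict 𝒰 p).obj a ⟶ (fiberRestrict 𝒰 p).obj b) :
        ∃! ψ : a ⟶ b, (fiberRestrict 𝒰 p).map ψ = η := by
      simp only [hloc]
      exact H a b (memberComponent η) fun i j =>
        res_memberComponent_eq η i j _ _ (snd₂_f 𝒰 i j)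
    exact ⟨⟨fun {a b} η => (hex η).exists⟩,
      ⟨fun {a b} ψ ψ' h => (hex ((fiberRestrict 𝒰 p).map ψ')).unique h rfl⟩⟩
  · rintro ⟨_, _⟩ a b φ hφ
    let η : (fiberRestrict 𝒰 p).obj a ⟶ (fiberRestrict 𝒰 p).obj b :=
      sieveHomMk (fun P => res p P.pt.hom P.pt.base P.pt.base rfl rfl (φ P.pt.idx))
        (fun {P Q} h => by
          have hk : P.pt.hom ≫ 𝒰.f P.pt.idx =
              (SieveCat.Hom.left h ≫ Q.pt.hom) ≫ 𝒰.f Q.pt.idx :=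
            (SieveCat.Hom.w h).symm.trans (Category.assoc _ _ _).symm
          -- The factorization of `P` and the one pulled back from `Q` have the same composite to
          -- `X`, hence define a map to the overlap. Naturality along `h` is the restriction of `hφ`
          -- along this map.
          let k : P.left ⟶ U₂ 𝒰 P.pt.idx Q.pt.idx := pullback.lift _ _ hk
          have e := congrArg (res p k P.pt.base P.pt.base
            (by rw [← Category.assoc, pullback.lift_fst]; rfl)
            (by rw [← Category.assoc, pullback.lift_fst]; rfl)) (hφ P.pt.idx Q.pt.idx)
          rw [res_res p _ _ _ _ _ k _ _ _ _ _ (pullback.lift_fst _ _ _),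
            res_res p _ _ _ _ _ k _ _ _ _ _ (pullback.lift_snd _ _ _)] at e
          refine Eq.trans ?_ e.symm
          exact res_res p _ _ _ _ _ _ _ _ _ _ _ rfl _)
    have hη (i : 𝒰.I₀) : memberComponent η i = φ i := by
      refine (res_res p _ _ _ _ _ (𝟙 _) _ _ _ _ (𝟙 _) (Category.id_comp _) _).trans ?_
      exact res_id p (φ i)
    obtain ⟨ψ, hψ⟩ := (fiberRestrict 𝒰 p).map_surjective η
    have hloc (ψ' : a ⟶ b) : (∀ i, (pull p (𝒰.f i)).map ψ' = φ i) ↔ ψ' = ψ := by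
      constructor
      · intro h
        apply (fiberRestrict 𝒰 p).map_injective
        rw [hψ]
        refine sieveComponent_ext fun P => ?_
        rw [sieveComponent_map, ← res_memberComponent, hη, ← h]
        exact (res_pull_map p _ _ _ _ ψ').symm
      · rintro rfl i
        rw [← hη, ← hψ]
        exact (res_pull_map p _ _ _ _ ψ').symm
    exact ⟨ψ, (hloc ψ).2 rfl, fun ψ' h => (hloc ψ').1 h⟩

end Descent

/-- Source of the unit laws: composition laws applied to equal indices make self-transitions
idempotent, and these are invertible. -/
theorem eq_id_of_comp_self {E : Type u₂} [Category.{v₂} E] {a : E} {f : a ⟶ a} [IsIso f]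
    (h : f ≫ f = f) : f = 𝟙 a :=
  (cancel_epi f).1 (h.trans (Category.comp_id f).symm)

/-! ### Descent data from functors on the category of objects mapping to the cover -/

section FromSieve

variable {C : Type u} [Category.{v} C] {J : Precoverage C} {X : C}
  {𝒰 : Precoverage.ZeroHypercover.{w} J X}
  {E : Type u₂} [Category.{v₂} E] {p : E ⥤ C}

/-- An object of `SieveCat 𝒰`, given by a morphism `s : V ⟶ U_i`. -/
abbrev sieveMk {V : C} {i : 𝒰.I₀} (s : V ⟶ 𝒰.X i) : SieveCat 𝒰 := ⟨V, ⟨i, s⟩⟩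

/-- The morphism of `SieveCat 𝒰` given by a commutative triangle over `U_i`. -/
def sieveTriangle {V W : C} {i : 𝒰.I₀} (g : W ⟶ V) (s : V ⟶ 𝒰.X i) (s' : W ⟶ 𝒰.X i)
    (w : g ≫ s = s') : sieveMk s' ⟶ sieveMk s :=
  SieveCat.homMk g ((Category.assoc g s (𝒰.f i)).symm.trans (congrArg (· ≫ 𝒰.f i) w))

/-- The morphism of `SieveCat 𝒰` over the identity between two points with the same base. -/
def sieveChange {V : C} {i j : 𝒰.I₀} (s : V ⟶ 𝒰.X i) (t : V ⟶ 𝒰.X j)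
    (w : s ≫ 𝒰.f i = t ≫ 𝒰.f j) : sieveMk s ⟶ sieveMk t :=
  SieveCat.homMk (𝟙 V) ((Category.id_comp _).trans w.symm)

theorem SieveCat.hom_triangle {P Q : SieveCat 𝒰} (h : P ⟶ Q) (t : P.left ⟶ 𝒰.X Q.pt.idx)
    (w : SieveCat.Hom.left h ≫ Q.pt.hom = t) :
    P.pt.hom ≫ 𝒰.f P.pt.idx = t ≫ 𝒰.f Q.pt.idx := by
  rw [← w, Category.assoc]; exact (SieveCat.Hom.w h).symm

variable (T : FunOver (SieveCat.forget 𝒰) p)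

instance isHomLift_map_triangle {V W : C} {i : 𝒰.I₀} (g : W ⟶ V) (s : V ⟶ 𝒰.X i)
    (s' : W ⟶ 𝒰.X i) (w : g ≫ s = s') : p.IsHomLift g (T.fn.map (sieveTriangle g s s' w)) :=
  T.isHomLift_map (sieveTriangle g s s' w)

instance isHomLift_map_change {V : C} {i j : 𝒰.I₀} (s : V ⟶ 𝒰.X i) (t : V ⟶ 𝒰.X j)
    (w : s ≫ 𝒰.f i = t ≫ 𝒰.f j) : p.IsHomLift (𝟙 V) (T.fn.map (sieveChange s t w)) :=
  T.isHomLift_map (sieveChange s t w)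

/-- A morphism of `SieveCat 𝒰` is determined by its underlying morphism of `C`; for changes of
factorization this turns functoriality of `T` into the cocycle condition. -/
theorem map_change_comp {V : C} {i j k : 𝒰.I₀} (s : V ⟶ 𝒰.X i) (t : V ⟶ 𝒰.X j) (r : V ⟶ 𝒰.X k)
    (w : s ≫ 𝒰.f i = t ≫ 𝒰.f j) (w' : t ≫ 𝒰.f j = r ≫ 𝒰.f k) :
    T.fn.map (sieveChange s t w) ≫ T.fn.map (sieveChange t r w') =
      T.fn.map (sieveChange s r (w.trans w')) := by
  rw [← T.fn.map_comp]
  exact congrArg T.fn.map (SieveCat.hom_ext (Category.id_comp _))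

theorem map_triangle_comp {V W Z : C} {i : 𝒰.I₀} (k : Z ⟶ W) (g : W ⟶ V) (s : V ⟶ 𝒰.X i)
    (s' : W ⟶ 𝒰.X i) (w : g ≫ s = s') (s'' : Z ⟶ 𝒰.X i) (w' : k ≫ s' = s'') (kg : Z ⟶ V)
    (hkg : k ≫ g = kg) :
    T.fn.map (sieveTriangle k s' s'' w') ≫ T.fn.map (sieveTriangle g s s' w) =
      T.fn.map (sieveTriangle kg s s'' (by rw [← hkg, Category.assoc, w, w'])) := by
  rw [← T.fn.map_comp]
  exact congrArg T.fn.map (SieveCat.hom_ext hkg)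

theorem map_triangle_change {V W : C} {i j : 𝒰.I₀} (g : W ⟶ V) (s : V ⟶ 𝒰.X i) (t : V ⟶ 𝒰.X j)
    (s' : W ⟶ 𝒰.X i) (t' : W ⟶ 𝒰.X j) (hs : g ≫ s = s') (ht : g ≫ t = t')
    (w : s ≫ 𝒰.f i = t ≫ 𝒰.f j) (w' : s' ≫ 𝒰.f i = t' ≫ 𝒰.f j) :
    T.fn.map (sieveTriangle g s s' hs) ≫ T.fn.map (sieveChange s t w) =
      T.fn.map (sieveChange s' t' w') ≫ T.fn.map (sieveTriangle g t t' ht) := by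
  rw [← T.fn.map_comp, ← T.fn.map_comp]
  exact congrArg T.fn.map (SieveCat.hom_ext ((Category.comp_id _).trans (Category.id_comp _).symm))

/-- The value on the member `U_i` of the cover. -/
def memberFiber (i : 𝒰.I₀) : p.Fiber (𝒰.X i) :=
  ⟨T.fn.obj (sieveMk (𝟙 (𝒰.X i))), T.proj_obj (sieveMk (𝟙 (𝒰.X i)))⟩

/-- The morphism from the value at `s : V ⟶ U_i` to the value at `U_i`. -/
def toMemberFiber {V : C} {i : 𝒰.I₀} (s : V ⟶ 𝒰.X i) :
    T.fn.obj (sieveMk s) ⟶ fobj (memberFiber T i) :=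
  T.fn.map (sieveTriangle s (𝟙 _) s (Category.comp_id _))

instance isHomLift_toMemberFiber {V : C} {i : 𝒰.I₀} (s : V ⟶ 𝒰.X i) :
    p.IsHomLift s (toMemberFiber T s) :=
  isHomLift_map_triangle T s (𝟙 _) s (Category.comp_id _)

theorem map_triangle_toMemberFiber {V W : C} {i : 𝒰.I₀} (g : W ⟶ V) (s : V ⟶ 𝒰.X i)
    (s' : W ⟶ 𝒰.X i) (w : g ≫ s = s') :
    T.fn.map (sieveTriangle g s s' w) ≫ toMemberFiber T s = toMemberFiber T s' :=
  map_triangle_comp T g s _ s _ s' w s' w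

variable [IsFiberedInGroupoids p]

/-- The value at `s : V ⟶ U_i` is the pullback of the value at `U_i`. -/
def pullToValue {V : C} {i : 𝒰.I₀} (s : V ⟶ 𝒰.X i) :
    fobj ((pull p s).obj (memberFiber T i)) ⟶ T.fn.obj (sieveMk s) :=
  factor p (𝟙 V) s s (Category.id_comp _) (toMemberFiber T s) (proj p s (memberFiber T i))

instance isHomLift_pullToValue {V : C} {i : 𝒰.I₀} (s : V ⟶ 𝒰.X i) :
    p.IsHomLift (𝟙 V) (pullToValue T s) :=
  isHomLift_factor p _ _ _ _ _ _

instance isIso_pullToValue {V : C} {i : 𝒰.I₀} (s : V ⟶ 𝒰.X i) : IsIso (pullToValue T s) :=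
  isIso_of_isHomLift_id p (X := V) _

theorem pullToValue_toMemberFiber {V : C} {i : 𝒰.I₀} (s : V ⟶ 𝒰.X i) :
    pullToValue T s ≫ toMemberFiber T s = proj p s (memberFiber T i) :=
  factor_comp p _ _ _ _ _ _

theorem pullTrans_pullToValue {V W : C} {i : 𝒰.I₀} (g : W ⟶ V) (s : V ⟶ 𝒰.X i)
    (s' : W ⟶ 𝒰.X i) (w : g ≫ s = s') :
    pullTrans p g s s' w (memberFiber T i) ≫ pullToValue T s =
      pullToValue T s' ≫ T.fn.map (sieveTriangle g s s' w) := by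
  refine eq_of_comp_eq p g (toMemberFiber T s) ?_
  rw [Category.assoc, Category.assoc, pullToValue_toMemberFiber, pullTrans_proj,
    map_triangle_toMemberFiber, pullToValue_toMemberFiber]

/-- The transition isomorphisms. -/
def transition {V : C} {i j : 𝒰.I₀} (s : V ⟶ 𝒰.X i) (t : V ⟶ 𝒰.X j)
    (w : s ≫ 𝒰.f i = t ≫ 𝒰.f j) :
    (pull p s).obj (memberFiber T i) ⟶ (pull p t).obj (memberFiber T j) :=
  fhomMk (pullToValue T s ≫ T.fn.map (sieveChange s t w) ≫ inv (pullToValue T t)) inferInstance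

theorem transition_pullToValue {V : C} {i j : 𝒰.I₀} (s : V ⟶ 𝒰.X i) (t : V ⟶ 𝒰.X j)
    (w : s ≫ 𝒰.f i = t ≫ 𝒰.f j) :
    fhom (transition T s t w) ≫ pullToValue T t =
      pullToValue T s ≫ T.fn.map (sieveChange s t w) := by
  rw [transition, fhom_fhomMk, Category.assoc, Category.assoc, IsIso.inv_hom_id, Category.comp_id]

theorem transition_comp {V : C} {i j k : 𝒰.I₀} (s : V ⟶ 𝒰.X i) (t : V ⟶ 𝒰.X j) (r : V ⟶ 𝒰.X k)
    (w : s ≫ 𝒰.f i = t ≫ 𝒰.f j) (w' : t ≫ 𝒰.f j = r ≫ 𝒰.f k) :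
    transition T s t w ≫ transition T t r w' = transition T s r (w.trans w') := by
  refine fhom_injective ((cancel_mono (pullToValue T r)).1 ?_)
  rw [fhom_comp, Category.assoc, transition_pullToValue,
    comp_assoc_of_square (transition_pullToValue T s t w), map_change_comp, transition_pullToValue]

/-- Reduces the cocycle condition on `U_ijk`, which is phrased with restrictions from the double
overlaps, to `transition_comp` on `U_ijk` itself. -/
theorem res_transition {V W : C} {i j : 𝒰.I₀} (g : W ⟶ V) (s : V ⟶ 𝒰.X i) (t : V ⟶ 𝒰.X j)
    (s' : W ⟶ 𝒰.X i) (t' : W ⟶ 𝒰.X j) (hs : g ≫ s = s') (ht : g ≫ t = t')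
    (w : s ≫ 𝒰.f i = t ≫ 𝒰.f j) (w' : s' ≫ 𝒰.f i = t' ≫ 𝒰.f j) :
    res p g s' t' hs ht (transition T s t w) = transition T s' t' w' := by
  apply res_eq
  refine (cancel_mono (pullToValue T t)).1 ?_
  rw [Category.assoc, Category.assoc, pullTrans_pullToValue, transition_pullToValue,
    comp_assoc_of_square (transition_pullToValue T s' t' w'),
    comp_assoc_of_square (pullTrans_pullToValue T g s s' hs), map_triangle_change]

/-- The comparison morphism between the restrictions of an object `b` over `X` and the values
of `T`, induced by morphisms on the members of the cover. -/
def glueApp {b : p.Fiber X} (β : ∀ i, (pull p (𝒰.f i)).obj b ⟶ memberFiber T i) {V : C} {i : 𝒰.I₀}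
    (s : V ⟶ 𝒰.X i) (r : V ⟶ X) (w : s ≫ 𝒰.f i = r) :
    fobj ((pull p r).obj b) ⟶ T.fn.obj (sieveMk s) :=
  factor p (𝟙 V) s s (Category.id_comp _) (toMemberFiber T s)
    (pullTrans p s (𝒰.f i) r w b ≫ fhom (β i))

section Glue

variable {b : p.Fiber X} (β : ∀ i, (pull p (𝒰.f i)).obj b ⟶ memberFiber T i)

instance isHomLift_glueApp {V : C} {i : 𝒰.I₀}
    (s : V ⟶ 𝒰.X i) (r : V ⟶ X) (w : s ≫ 𝒰.f i = r) :
    p.IsHomLift (𝟙 V) (glueApp T β s r w) :=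
  isHomLift_factor p _ _ _ _ _ _

theorem glueApp_toMemberFiber {V : C} {i : 𝒰.I₀}
    (s : V ⟶ 𝒰.X i) (r : V ⟶ X) (w : s ≫ 𝒰.f i = r) :
    glueApp T β s r w ≫ toMemberFiber T s = pullTrans p s (𝒰.f i) r w b ≫ fhom (β i) :=
  factor_comp p _ _ _ _ _ _

theorem pullTrans_glueApp {V W : C} {i : 𝒰.I₀} (g : W ⟶ V)
    (s : V ⟶ 𝒰.X i) (r : V ⟶ X) (w : s ≫ 𝒰.f i = r) (s' : W ⟶ 𝒰.X i) (hs : g ≫ s = s')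
    (r' : W ⟶ X) (hr : g ≫ r = r') :
    pullTrans p g r r' hr b ≫ glueApp T β s r w =
      glueApp T β s' r' (by rw [← hs, Category.assoc, w, hr]) ≫
        T.fn.map (sieveTriangle g s s' hs) := by
  refine eq_of_comp_eq p g (toMemberFiber T s) ?_
  rw [Category.assoc, Category.assoc, glueApp_toMemberFiber, map_triangle_toMemberFiber,
    glueApp_toMemberFiber, comp_assoc_of_eq (pullTrans_comp p g s (𝒰.f i) r w r' hr s' hs b)]

/-- Links `glueApp`, which takes values in `T`, to the composite with values in chosen pullbacks
that occurs in the gluing condition. -/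
theorem glueApp_eq {V : C} {i : 𝒰.I₀} (s : V ⟶ 𝒰.X i) (r : V ⟶ X) (w : s ≫ 𝒰.f i = r) :
    fhom ((pullComp p s (𝒰.f i) r w b).inv ≫ (pull p s).map (β i)) ≫ pullToValue T s =
      glueApp T β s r w := by
  refine eq_of_comp_eq p (𝟙 V) (toMemberFiber T s) ?_
  rw [Category.assoc, pullToValue_toMemberFiber, glueApp_toMemberFiber, fhom_comp, Category.assoc,
    pull_map_proj, comp_assoc_of_eq (pullComp_inv_proj p s (𝒰.f i) r w b)]

variable [J.HasPullbacks]

/-- The hypothesis is the case of the two projections of `U_ij`. A general pair `s`, `t` factors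
through `U_ij`, and the identity is tested after a morphism lying over that factorization. -/
theorem glueApp_change
    (hβ : ∀ i j,
      ((pullComp p (fst₂ 𝒰 i j) (𝒰.f i) (base₂ 𝒰 i j) rfl b).inv ≫
          (pull p (fst₂ 𝒰 i j)).map (β i)) ≫
            transition T (fst₂ 𝒰 i j) (snd₂ 𝒰 i j) pullback.condition =
        (pullComp p (snd₂ 𝒰 i j) (𝒰.f j) (base₂ 𝒰 i j) (snd₂_f 𝒰 i j) b).inv ≫
          (pull p (snd₂ 𝒰 i j)).map (β j))
    {V : C} {i j : 𝒰.I₀} (s : V ⟶ 𝒰.X i) (t : V ⟶ 𝒰.X j) (r : V ⟶ X)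
    (w : s ≫ 𝒰.f i = r) (w' : t ≫ 𝒰.f j = r) :
    glueApp T β s r w ≫ T.fn.map (sieveChange s t (w.trans w'.symm)) = glueApp T β t r w' := by
  have h0 : glueApp T β (fst₂ 𝒰 i j) (base₂ 𝒰 i j) rfl ≫
      T.fn.map (sieveChange (fst₂ 𝒰 i j) (snd₂ 𝒰 i j) pullback.condition) =
        glueApp T β (snd₂ 𝒰 i j) (base₂ 𝒰 i j) (snd₂_f 𝒰 i j) := by
    rw [← glueApp_eq, ← glueApp_eq, ← hβ, Category.assoc, ← transition_pullToValue, fhom_comp _ (transition T _ _ _),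
      Category.assoc]
  let k : V ⟶ U₂ 𝒰 i j := pullback.lift s t (w.trans w'.symm)
  have hk : k ≫ fst₂ 𝒰 i j = s := pullback.lift_fst _ _ _
  have hk' : k ≫ snd₂ 𝒰 i j = t := pullback.lift_snd _ _ _
  have hr : k ≫ base₂ 𝒰 i j = r := by rw [← Category.assoc, hk, w]
  refine eq_of_comp_eq p (𝟙 V) (T.fn.map (sieveTriangle k _ t hk')) ?_
  rw [← pullTrans_glueApp T β k _ _ (snd₂_f 𝒰 i j) t hk' r hr, ← h0,
    comp_assoc_of_square (pullTrans_glueApp T β k _ _ rfl s hk r hr),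
    map_triangle_change T k _ _ s t hk hk', Category.assoc]

end Glue

end FromSieve

/-! ### Functors on the category of objects mapping to the cover from descent data -/

section ToSieve

variable {C : Type u} [Category.{v} C] {J : Precoverage C} [J.HasPullbacks] {X : C}
  {𝒰 : Precoverage.ZeroHypercover.{w} J X}
  {E : Type u₂} [Category.{v₂} E] {p : E ⥤ C} [IsFiberedInGroupoids p]
  {a : ∀ i, p.Fiber (𝒰.X i)}
  (α : ∀ i j, (pull p (fst₂ 𝒰 i j)).obj (a i) ≅ (pull p (snd₂ 𝒰 i j)).obj (a j))

/-- The isomorphisms between the restrictions of the members of a descent datum. -/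
def cocycleHom {V : C} {i j : 𝒰.I₀} (s : V ⟶ 𝒰.X i) (t : V ⟶ 𝒰.X j)
    (w : s ≫ 𝒰.f i = t ≫ 𝒰.f j) : (pull p s).obj (a i) ⟶ (pull p t).obj (a j) :=
  res p (pullback.lift s t w) s t (pullback.lift_fst _ _ _) (pullback.lift_snd _ _ _) (α i j).hom

theorem res_cocycleHom {V W : C} {i j : 𝒰.I₀} (g : W ⟶ V) (s : V ⟶ 𝒰.X i) (t : V ⟶ 𝒰.X j)
    (s' : W ⟶ 𝒰.X i) (t' : W ⟶ 𝒰.X j) (hs : g ≫ s = s') (ht : g ≫ t = t')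
    (w : s ≫ 𝒰.f i = t ≫ 𝒰.f j) (w' : s' ≫ 𝒰.f i = t' ≫ 𝒰.f j) :
    res p g s' t' hs ht (cocycleHom α s t w) = cocycleHom α s' t' w' := by
  subst hs ht
  refine res_res p _ _ _ _ _ _ _ _ _ _ _ ?_ _
  apply pullback.hom_ext
  · rw [Category.assoc, pullback.lift_fst, pullback.lift_fst]
  · rw [Category.assoc, pullback.lift_snd, pullback.lift_snd]

theorem cocycleHom_self (i j : 𝒰.I₀) :
    cocycleHom α (fst₂ 𝒰 i j) (snd₂ 𝒰 i j) pullback.condition = (α i j).hom := by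
  have h : pullback.lift (fst₂ 𝒰 i j) (snd₂ 𝒰 i j) pullback.condition = 𝟙 (U₂ 𝒰 i j) := by
    apply pullback.hom_ext
    · rw [pullback.lift_fst, Category.id_comp]
    · rw [pullback.lift_snd, Category.id_comp]
  refine Eq.trans ?_ (res_id p (α i j).hom)
  unfold cocycleHom
  congr 1

/-- The cocycle condition for a descent datum. -/
def IsCocycle : Prop :=
  ∀ i j k,
    res p (proj₁₂ 𝒰 i j k) (proj₁ 𝒰 i j k) (proj₂ 𝒰 i j k) rfl rfl (α i j).hom ≫
      res p (proj₂₃ 𝒰 i j k) (proj₂ 𝒰 i j k) (proj₃ 𝒰 i j k)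
        (pullback.lift_fst _ _ _) (pullback.lift_snd _ _ _) (α j k).hom =
    res p (proj₁₃ 𝒰 i j k) (proj₁ 𝒰 i j k) (proj₃ 𝒰 i j k)
        (pullback.lift_fst _ _ _) (pullback.lift_snd _ _ _) (α i k).hom

variable {α}

/-- The maps `s`, `t`, `r` have the same composite to `X` and so define a map to the universal case
`U_ijk`, along which the cocycle condition is pulled back. -/
theorem IsCocycle.cocycleHom_comp (hα : IsCocycle α) {V : C} {i j k : 𝒰.I₀} (s : V ⟶ 𝒰.X i) (t : V ⟶ 𝒰.X j) (r : V ⟶ 𝒰.X k)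
    (w : s ≫ 𝒰.f i = t ≫ 𝒰.f j) (w' : t ≫ 𝒰.f j = r ≫ 𝒰.f k) :
    cocycleHom α s t w ≫ cocycleHom α t r w' = cocycleHom α s r (w.trans w') := by
  let m : V ⟶ U₃ 𝒰 i j k := pullback.lift (pullback.lift s t w) r (by
    rw [← Category.assoc, pullback.lift_fst, w, w'])
  have h12 : m ≫ proj₁₂ 𝒰 i j k = pullback.lift s t w := pullback.lift_fst _ _ _
  have h1 : m ≫ proj₁ 𝒰 i j k = s := by rw [← Category.assoc, h12, pullback.lift_fst]
  have h2 : m ≫ proj₂ 𝒰 i j k = t := by rw [← Category.assoc, h12, pullback.lift_snd]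
  have h3 : m ≫ proj₃ 𝒰 i j k = r := pullback.lift_snd _ _ _
  have e := congrArg (res p m s r h1 h3) (hα i j k)
  rw [res_comp p m s t h1 h2 r h3,
    res_res p _ _ _ _ _ m _ _ _ _ (pullback.lift s t w) h12,
    res_res p _ _ _ _ _ m _ _ _ _ (pullback.lift t r w') (by
      apply pullback.hom_ext
      · rw [Category.assoc, pullback.lift_fst, pullback.lift_fst, h2]
      · rw [Category.assoc, pullback.lift_snd, pullback.lift_snd, pullback.lift_snd]),
    res_res p _ _ _ _ _ m _ _ _ _ (pullback.lift s r (w.trans w')) (by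
      apply pullback.hom_ext
      · rw [Category.assoc, pullback.lift_fst, pullback.lift_fst, h1]
      · rw [Category.assoc, pullback.lift_snd, pullback.lift_snd, pullback.lift_snd])] at e
  exact e

theorem IsCocycle.cocycleHom_refl (hα : IsCocycle α) {V : C} {i : 𝒰.I₀} (s : V ⟶ 𝒰.X i) : cocycleHom α s s rfl = 𝟙 _ :=
  eq_id_of_comp_self (hα.cocycleHom_comp s s s rfl rfl)

variable (α) in
/-- The action on morphisms of the functor associated to a descent datum. -/
def descentMap {V W : C} {i j : 𝒰.I₀} (s : W ⟶ 𝒰.X i) (t : V ⟶ 𝒰.X j) (h : W ⟶ V)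
    (t' : W ⟶ 𝒰.X j) (w : h ≫ t = t') (w' : s ≫ 𝒰.f i = t' ≫ 𝒰.f j) :
    fobj ((pull p s).obj (a i)) ⟶ fobj ((pull p t).obj (a j)) :=
  fhom (cocycleHom α s t' w') ≫ pullTrans p h t t' w (a j)

/-- The second transition is moved past the pullback along `h` by stability of transitions under
restriction; the two transitions, now both over `W`, compose by the cocycle condition. -/
theorem IsCocycle.descentMap_comp (hα : IsCocycle α) {V W Z : C} {i j k : 𝒰.I₀}
    (s : W ⟶ 𝒰.X i) (t : V ⟶ 𝒰.X j) (h : W ⟶ V)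
    (t' : W ⟶ 𝒰.X j) (w : h ≫ t = t') (w' : s ≫ 𝒰.f i = t' ≫ 𝒰.f j)
    (r : Z ⟶ 𝒰.X k) (h' : V ⟶ Z) (r' : V ⟶ 𝒰.X k) (x : h' ≫ r = r')
    (x' : t ≫ 𝒰.f j = r' ≫ 𝒰.f k) (r'' : W ⟶ 𝒰.X k) (y : (h ≫ h') ≫ r = r'')
    (y' : s ≫ 𝒰.f i = r'' ≫ 𝒰.f k) :
    descentMap α s t h t' w w' ≫ descentMap α t r h' r' x x' =
      descentMap α s r (h ≫ h') r'' y y' := by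
  have e : h ≫ r' = r'' := by rw [← x, ← y, Category.assoc]
  unfold descentMap
  rw [Category.assoc, ← comp_assoc_of_square (res_trans p h t' r'' w e (cocycleHom α t r' x')),
    res_cocycleHom α h t r' t' r'' w e x' (w'.symm.trans y'), ← Category.assoc, ← fhom_comp,
    hα.cocycleHom_comp, pullTrans_comp p h h' r r' x r'' e (h ≫ h') rfl]

variable (α) in
instance isHomLift_descentMap {V W : C} {i j : 𝒰.I₀} (s : W ⟶ 𝒰.X i) (t : V ⟶ 𝒰.X j) (h : W ⟶ V)
    (t' : W ⟶ 𝒰.X j) (w : h ≫ t = t') (w' : s ≫ 𝒰.f i = t' ≫ 𝒰.f j) :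
    p.IsHomLift h (descentMap α s t h t' w w') :=
  isHomLift_comp p (𝟙 _) _ _ (Category.id_comp _) _ _

/-- The functor on `SieveCat 𝒰` associated to a descent datum. -/
def IsCocycle.descentFunctor (hα : IsCocycle α) : FunOver (SieveCat.forget 𝒰) p :=
  FunOver.mk'
    { obj := fun P => fobj ((pull p P.pt.hom).obj (a P.pt.idx))
      map := fun {P Q} h => descentMap α P.pt.hom Q.pt.hom (SieveCat.Hom.left h) _ rfl
        (SieveCat.hom_triangle h _ rfl)
      map_id := fun P => by
        have : (𝟙 P.left) ≫ P.pt.hom = P.pt.hom := Category.id_comp _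
        -- The target point is transported to `𝟙 ≫ P.pt.hom`, which equals `P.pt.hom` only
        -- propositionally. `descentMap` takes the transported point as a separate argument so that
        -- it can be replaced here.
        refine (?_ : _ = descentMap α P.pt.hom P.pt.hom (𝟙 P.left) _ this rfl).trans ?_
        · congr 1
        · unfold descentMap
          rw [hα.cocycleHom_refl, fhom_id, pullTrans_id, Category.comp_id]
      map_comp := fun {P Q R} h h' => (hα.descentMap_comp _ _ _ _ _ _ _ _ _ _ _ _ _ _).symm }
    (fun P => ((pull p P.pt.hom).obj (a P.pt.idx)).2)
    (fun {P Q} h => isHomLift_descentMap α _ _ _ _ _ _)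

theorem IsCocycle.descentFunctor_map (hα : IsCocycle α) {P Q : SieveCat 𝒰} (h : P ⟶ Q)
    (t : P.left ⟶ 𝒰.X Q.pt.idx) (w : SieveCat.Hom.left h ≫ Q.pt.hom = t) :
    hα.descentFunctor.fn.map h = descentMap α P.pt.hom Q.pt.hom (SieveCat.Hom.left h) t w
      (SieveCat.hom_triangle h t w) := by
  subst w; rfl

theorem IsCocycle.descentFunctor_map_triangle (hα : IsCocycle α) {V W : C} {i : 𝒰.I₀} (g : W ⟶ V) (s : V ⟶ 𝒰.X i)
    (s' : W ⟶ 𝒰.X i) (w : g ≫ s = s') :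
    hα.descentFunctor.fn.map (sieveTriangle g s s' w) = pullTrans p g s s' w (a i) := by
  refine (hα.descentFunctor_map _ s' w).trans ?_
  refine (congrArg (fhom · ≫ pullTrans p g s s' w (a i)) (hα.cocycleHom_refl s')).trans ?_
  exact Category.id_comp _

theorem IsCocycle.descentFunctor_map_change (hα : IsCocycle α) {V : C} {i j : 𝒰.I₀} (s : V ⟶ 𝒰.X i) (t : V ⟶ 𝒰.X j)
    (w : s ≫ 𝒰.f i = t ≫ 𝒰.f j) :
    hα.descentFunctor.fn.map (sieveChange s t w) = fhom (cocycleHom α s t w) := by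
  refine (hα.descentFunctor_map _ t (Category.id_comp _)).trans ?_
  refine (congrArg (fhom (cocycleHom α s t w) ≫ ·) (pullTrans_id p t (a j))).trans ?_
  exact Category.comp_id _

end ToSieve

/-! ### Effectivity of descent data -/

section ObjGluing

variable {C : Type u} [Category.{v} C] {J : Precoverage C} [J.HasPullbacks] {X : C}
  {𝒰 : Precoverage.ZeroHypercover.{w} J X}
  {E : Type u₂} [Category.{v₂} E] {p : E ⥤ C} [IsFiberedInGroupoids p]

/-- The statement that descent data along a cover are effective. -/
def ObjGluing (p : E ⥤ C) [IsFiberedInGroupoids p] (𝒰 : Precoverage.ZeroHypercover.{w} J X) :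
    Prop :=
  ∀ (a : ∀ i, p.Fiber (𝒰.X i))
    (α : ∀ i j, (pull p (fst₂ 𝒰 i j)).obj (a i) ≅ (pull p (snd₂ 𝒰 i j)).obj (a j))
    (_ : IsCocycle α),
    ∃ (b : p.Fiber X) (β : ∀ i, (pull p (𝒰.f i)).obj b ≅ a i), ∀ i j,
      ((pullComp p (fst₂ 𝒰 i j) (𝒰.f i) (base₂ 𝒰 i j) rfl b).inv ≫
          (pull p (fst₂ 𝒰 i j)).map (β i).hom) ≫ (α i j).hom =
        (pullComp p (snd₂ 𝒰 i j) (𝒰.f j) (base₂ 𝒰 i j) (snd₂_f 𝒰 i j) b).inv ≫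
          (pull p (snd₂ 𝒰 i j)).map (β j).hom

/-- The values of `T` at the members, with their transitions, form a descent datum. An object `b`
gluing it is compared with `T` on the members, and `glueApp` propagates the comparison to all of
`SieveCat 𝒰`. -/
theorem ObjGluing.essSurj (H : ObjGluing p 𝒰) : (fiberRestrict 𝒰 p).EssSurj where
  mem_essImage T := by
    let α (i j : 𝒰.I₀) : (pull p (fst₂ 𝒰 i j)).obj (memberFiber T i) ≅
        (pull p (snd₂ 𝒰 i j)).obj (memberFiber T j) :=
      asIso (transition T (fst₂ 𝒰 i j) (snd₂ 𝒰 i j) pullback.condition)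
    have hα : IsCocycle α := fun i j k => by
      have w₁ : proj₁ 𝒰 i j k ≫ 𝒰.f i = proj₂ 𝒰 i j k ≫ 𝒰.f j := by
        rw [Category.assoc, Category.assoc, snd₂_f]
      have w₂ : proj₂ 𝒰 i j k ≫ 𝒰.f j = proj₃ 𝒰 i j k ≫ 𝒰.f k := by
        rw [Category.assoc, snd₂_f, pullback.condition]
      have e₁ := res_transition T (proj₁₂ 𝒰 i j k) (fst₂ 𝒰 i j) (snd₂ 𝒰 i j) _ _ rfl rfl
        pullback.condition w₁
      have e₂ := res_transition T (proj₂₃ 𝒰 i j k) (fst₂ 𝒰 j k) (snd₂ 𝒰 j k) _ _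
        (pullback.lift_fst _ _ _) (pullback.lift_snd _ _ _) pullback.condition w₂
      have e₃ := res_transition T (proj₁₃ 𝒰 i j k) (fst₂ 𝒰 i k) (snd₂ 𝒰 i k) _ _
        (pullback.lift_fst _ _ _) (pullback.lift_snd _ _ _) pullback.condition (w₁.trans w₂)
      refine Eq.trans ?_ e₃.symm
      refine Eq.trans ?_ (transition_comp T _ _ _ w₁ w₂)
      exact congrArg₂ (· ≫ ·) e₁ e₂
    obtain ⟨b, β, hβ⟩ := H _ α hα
    let η : (fiberRestrict 𝒰 p).obj b ⟶ T := FunOver.mkHom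
      (fun P => glueApp T (fun i => (β i).hom) P.pt.hom P.pt.base rfl)
      (fun {P Q} h => by
        -- Every morphism splits into a change of factorization over an identity and a triangle over
        -- a single `U_i`; naturality is known for each kind.
        have e : h = sieveChange P.pt.hom _ (SieveCat.hom_triangle h _ rfl) ≫
            sieveTriangle (SieveCat.Hom.left h) Q.pt.hom _ rfl :=
          SieveCat.hom_ext (Category.id_comp _).symm
        have e' : T.fn.map h = T.fn.map (sieveChange P.pt.hom _ (SieveCat.hom_triangle h _ rfl)) ≫
            T.fn.map (sieveTriangle (SieveCat.Hom.left h) Q.pt.hom _ rfl) :=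
          (congrArg T.fn.map e).trans (T.fn.map_comp _ _)
        refine (pullTrans_glueApp T (fun i => (β i).hom) (SieveCat.Hom.left h) Q.pt.hom Q.pt.base
          rfl _ rfl P.pt.base (SieveCat.Hom.w h)).trans ?_
        rw [e', ← glueApp_change T (fun i => (β i).hom) hβ P.pt.hom _ P.pt.base rfl
          (SieveCat.hom_triangle h _ rfl).symm]
        exact Category.assoc _ _ _)
      (fun P => isHomLift_glueApp T _ _ _ _)
    have := FunOver.isIso_hom η
    exact ⟨b, ⟨asIso η⟩⟩

theorem objGluing_of_essSurj [(fiberRestrict 𝒰 p).EssSurj] : ObjGluing p 𝒰 := by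
  intro a α hα
  let b := (fiberRestrict 𝒰 p).objPreimage hα.descentFunctor
  let e : (fiberRestrict 𝒰 p).obj b ⟶ hα.descentFunctor :=
    ((fiberRestrict 𝒰 p).objObjPreimageIso hα.descentFunctor).hom
  let ε {V : C} {i : 𝒰.I₀} (s : V ⟶ 𝒰.X i) :
      fobj ((pull p (s ≫ 𝒰.f i)).obj b) ⟶ fobj ((pull p s).obj (a i)) :=
    (FunOver.homFn e).app (sieveMk s)
  have hε {V : C} {i : 𝒰.I₀} (s : V ⟶ 𝒰.X i) : p.IsHomLift (𝟙 V) (ε s) :=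
    FunOver.isHomLift_homFn e (sieveMk s)
  have nat₁ {V W : C} {i : 𝒰.I₀} (g : W ⟶ V) (s : V ⟶ 𝒰.X i) (s' : W ⟶ 𝒰.X i) (w : g ≫ s = s') :
      pullTrans p g (s ≫ 𝒰.f i) (s' ≫ 𝒰.f i) (by rw [← w, Category.assoc]) b ≫ ε s =
        ε s' ≫ pullTrans p g s s' w (a i) := by
    rw [← hα.descentFunctor_map_triangle]
    exact (FunOver.homFn e).naturality (sieveTriangle g s s' w)
  have nat₂ {V : C} {i j : 𝒰.I₀} (s : V ⟶ 𝒰.X i) (t : V ⟶ 𝒰.X j) (w : s ≫ 𝒰.f i = t ≫ 𝒰.f j) :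
      pullTrans p (𝟙 V) (t ≫ 𝒰.f j) (s ≫ 𝒰.f i) ((Category.id_comp _).trans w.symm) b ≫ ε t =
        ε s ≫ fhom (cocycleHom α s t w) := by
    rw [← hα.descentFunctor_map_change]
    exact (FunOver.homFn e).naturality (sieveChange s t w)
  have hid (i : 𝒰.I₀) : 𝟙 (𝒰.X i) ≫ 𝟙 (𝒰.X i) ≫ 𝒰.f i = 𝒰.f i := by simp
  -- Two corrections by identities are needed: the base of the member `U_i` is `𝟙 ≫ 𝒰.f i`, and the
  -- value of the descent functor there is the chosen pullback of `a i` along `𝟙` instead of `a i`.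
  let β (i : 𝒰.I₀) : fobj ((pull p (𝒰.f i)).obj b) ⟶ fobj (a i) :=
    pullTrans p (𝟙 _) (𝟙 _ ≫ 𝒰.f i) (𝒰.f i) (hid i) b ≫ ε (𝟙 (𝒰.X i)) ≫ proj p (𝟙 _) (a i)
  have hβ (i : 𝒰.I₀) : p.IsHomLift (𝟙 (𝒰.X i)) (β i) := by
    have h1 := isHomLift_comp p (𝟙 (𝒰.X i)) (𝟙 _) (𝟙 _) (Category.id_comp _) (ε (𝟙 (𝒰.X i)))
      (proj p (𝟙 (𝒰.X i)) (a i))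
    exact isHomLift_comp p (𝟙 (𝒰.X i)) (𝟙 _) (𝟙 _) (Category.id_comp _) _ _
  have hεβ {V : C} {i : 𝒰.I₀} (s : V ⟶ 𝒰.X i) (r : V ⟶ X) (w : s ≫ 𝒰.f i = r) :
      fhom ((pullComp p s (𝒰.f i) r w b).inv ≫ (pull p s).map (fhomMk (β i) (hβ i))) =
        pullTrans p (𝟙 V) (s ≫ 𝒰.f i) r ((Category.id_comp _).trans w) b ≫ ε s := by
    have := isHomLift_comp p (𝟙 V) (𝟙 V) (𝟙 V) (Category.id_comp _)
      (pullTrans p (𝟙 V) (s ≫ 𝒰.f i) r ((Category.id_comp _).trans w) b) (ε s)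
    refine eq_of_comp_eq p (𝟙 V) (proj p s (a i)) ?_
    rw [fhom_comp, Category.assoc, pull_map_proj,
      comp_assoc_of_eq (pullComp_inv_proj p s (𝒰.f i) r w b), fhom_fhomMk, Category.assoc,
      comp_assoc_of_eq (pullTrans_comp p s (𝟙 _) (𝟙 _ ≫ 𝒰.f i) (𝒰.f i) (hid i) r w s
        (Category.comp_id _) b),
      ← pullTrans_proj p s (𝟙 _) s (Category.comp_id _) (a i),
      ← comp_assoc_of_square (nat₁ s (𝟙 _) s (Category.comp_id _)),
      comp_assoc_of_eq (pullTrans_comp p (𝟙 V) s (𝟙 _ ≫ 𝒰.f i) (s ≫ 𝒰.f i) _ r _ s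
        (Category.id_comp _) b)]
  refine ⟨b, fun i => asIso (fhomMk (β i) (hβ i)), fun i j => ?_⟩
  refine fhom_injective ?_
  have h₁ := hεβ (fst₂ 𝒰 i j) (base₂ 𝒰 i j) rfl
  have h₂ := hεβ (snd₂ 𝒰 i j) (base₂ 𝒰 i j) (snd₂_f 𝒰 i j)
  -- `base₂` is defined through the first projection, so the correction disappears on that side; on
  -- the other side it is the one occurring in `nat₂`.
  rw [pullTrans_id, Category.id_comp] at h₁
  refine (congrArg (· ≫ fhom (α i j).hom) h₁).trans (Eq.trans ?_ h₂.symm)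
  rw [← cocycleHom_self]
  exact (nat₂ _ _ pullback.condition).symm

theorem satisfiesDescent_iff :
    SatisfiesDescent p 𝒰 ↔ (fiberRestrict 𝒰 p).IsEquivalence := by
  constructor
  · intro H
    obtain ⟨_, _⟩ := homGluing_iff.1 (show HomGluing p 𝒰 from H.hom_gluing)
    have : (fiberRestrict 𝒰 p).EssSurj :=
      ObjGluing.essSurj (show ObjGluing p 𝒰 from H.obj_gluing)
    exact {}
  · intro H
    exact ⟨homGluing_iff.2 ⟨inferInstance, inferInstance⟩, objGluing_of_essSurj⟩

end ObjGluing

/-! ### The category of simplices of points of a cover -/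

section Cech

open Simplicial

variable {C : Type u} [Category.{v} C] {J : Precoverage C} {X : C}
  (𝒰 : Precoverage.ZeroHypercover.{w} J X)

/-- The simplices of points of the cover with a common base. -/
structure CechCat where
  deg : SimplexCategory
  left : C
  pt : Fin (deg.len + 1) → CoverPoint 𝒰 left
  base_eq : ∀ k l, (pt k).base = (pt l).base

namespace CechCat

variable {𝒰}

/-- A morphism consists of a simplicial operator and a morphism of the base such that the
source is the pullback of a face of the target. -/
@[ext]
structure Hom (a b : CechCat 𝒰) where
  deg : a.deg ⟶ b.deg
  left : a.left ⟶ b.left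
  w : ∀ k, a.pt k = (b.pt (deg.toOrderHom k)).pullback left

instance : Category (CechCat 𝒰) where
  Hom := Hom
  id a := ⟨𝟙 _, 𝟙 _, fun k => (CoverPoint.pullback_id _).symm⟩
  comp f g := ⟨f.deg ≫ g.deg, f.left ≫ g.left, fun k => by
    rw [CoverPoint.pullback_comp, f.w, g.w]; rfl⟩
  id_comp f := Hom.ext (Category.id_comp _) (Category.id_comp _)
  comp_id f := Hom.ext (Category.comp_id _) (Category.comp_id _)
  assoc f g h := Hom.ext (Category.assoc _ _ _) (Category.assoc _ _ _)

/-- Constructor for morphisms. -/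
def homMk {a b : CechCat 𝒰} (σ : a.deg ⟶ b.deg) (h : a.left ⟶ b.left)
    (w : ∀ k, a.pt k = (b.pt (σ.toOrderHom k)).pullback h) : a ⟶ b :=
  ⟨σ, h, w⟩

theorem hom_ext {a b : CechCat 𝒰} {f g : a ⟶ b} (h : Hom.deg f = Hom.deg g)
    (h' : Hom.left f = Hom.left g) : f = g :=
  Hom.ext h h'

variable (𝒰) in
/-- The projection to `C`. -/
def forget : CechCat 𝒰 ⥤ C where
  obj a := a.left
  map f := Hom.left f

variable (𝒰) in
/-- The initial vertex of a simplex. -/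
def initialVertex : CechCat 𝒰 ⥤ SieveCat 𝒰 where
  obj a := ⟨a.left, a.pt 0⟩
  map {a b} f := SieveCat.homMk (Hom.left f) (by
    change Hom.left f ≫ (b.pt 0).base = (a.pt 0).base
    rw [Hom.w f 0, CoverPoint.base_pullback, b.base_eq 0])

/-- A point as a simplex of dimension zero. -/
abbrev point {V : C} (P : CoverPoint 𝒰 V) : CechCat 𝒰 := ⟨⦋0⦌, V, fun _ => P, fun _ _ => rfl⟩

/-- The inclusion of a vertex into a simplex. -/
def vertex (a : CechCat 𝒰) (k : Fin (a.deg.len + 1)) (P : CoverPoint 𝒰 a.left) (e : a.pt k = P) :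
    point P ⟶ a :=
  homMk (SimplexCategory.const ⦋0⦌ a.deg k) (𝟙 _) (fun _ =>
    e.symm.trans (CoverPoint.pullback_id _).symm)

/-- The morphism between points given by pulling back. -/
def pullPoint {V W : C} (h : W ⟶ V) (P : CoverPoint 𝒰 V) (P' : CoverPoint 𝒰 W)
    (e : P' = P.pullback h) : point P' ⟶ point P :=
  homMk (𝟙 _) h (fun _ => e)

/-- The edge between two points with the same base. -/
abbrev edge {V : C} (P Q : CoverPoint 𝒰 V) (w : P.base = Q.base) : CechCat 𝒰 :=
  ⟨⦋1⦌, V, Fin.cons P fun _ => Q, by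
    intro k l
    refine Fin.cases ?_ (fun _ => ?_) k <;> refine Fin.cases ?_ (fun _ => ?_) l
    exacts [rfl, w, w.symm, rfl]⟩

/-- The triangle on three points with the same base. -/
abbrev triangle {V : C} (P Q R : CoverPoint 𝒰 V) (w : P.base = Q.base) (w' : Q.base = R.base) :
    CechCat 𝒰 :=
  ⟨⦋2⦌, V, Fin.cons P (Fin.cons Q fun _ => R), by
    have h (k : Fin 3) : (Fin.cons P (Fin.cons Q fun _ => R) : Fin 3 → CoverPoint 𝒰 V) k =
      P ∨ (Fin.cons P (Fin.cons Q fun _ => R) : Fin 3 → CoverPoint 𝒰 V) k = Q ∨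
      (Fin.cons P (Fin.cons Q fun _ => R) : Fin 3 → CoverPoint 𝒰 V) k = R := by
      fin_cases k
      exacts [Or.inl rfl, Or.inr (Or.inl rfl), Or.inr (Or.inr rfl)]
    have h' (k : Fin 3) :
        ((Fin.cons P (Fin.cons Q fun _ => R) : Fin 3 → CoverPoint 𝒰 V) k).base = Q.base := by
      rcases h k with h | h | h <;> rw [h]
      exacts [w, w'.symm]
    exact fun k l => (h' k).trans (h' l).symm⟩

/-- The map from an edge to a simplex. -/
def edgeMap (a : CechCat 𝒰) (k l : Fin (a.deg.len + 1)) (hkl : k ≤ l) (P Q : CoverPoint 𝒰 a.left)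
    (eP : a.pt k = P) (eQ : a.pt l = Q) (w : P.base = Q.base) : edge P Q w ⟶ a :=
  homMk (SimplexCategory.mkOfLe k l hkl) (𝟙 _) (by
    subst eP eQ
    intro m
    refine Eq.trans ?_ (CoverPoint.pullback_id _).symm
    match m with
    | 0 => rfl
    | 1 => rfl)

/-- The map between edges given by pulling back. -/
def pullEdge {V W : C} (h : W ⟶ V) (P Q : CoverPoint 𝒰 V) (P' Q' : CoverPoint 𝒰 W)
    (eP : P' = P.pullback h) (eQ : Q' = Q.pullback h) (w : P.base = Q.base)
    (w' : P'.base = Q'.base) : edge P' Q' w' ⟶ edge P Q w :=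
  homMk (𝟙 _) h (by
    intro m
    match m with
    | 0 => exact eP
    | 1 => exact eQ)

theorem vertex_edgeMap_zero (a : CechCat 𝒰) (k l : Fin (a.deg.len + 1)) (hkl : k ≤ l)
    (P Q : CoverPoint 𝒰 a.left) (eP : a.pt k = P) (eQ : a.pt l = Q) (w : P.base = Q.base) :
    vertex (edge P Q w) 0 P rfl ≫ edgeMap a k l hkl P Q eP eQ w = vertex a k P eP :=
  hom_ext (SimplexCategory.Hom.ext _ _ (by ext m; rfl)) (Category.id_comp _)

theorem vertex_edgeMap_one (a : CechCat 𝒰) (k l : Fin (a.deg.len + 1)) (hkl : k ≤ l)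
    (P Q : CoverPoint 𝒰 a.left) (eP : a.pt k = P) (eQ : a.pt l = Q) (w : P.base = Q.base) :
    vertex (edge P Q w) 1 Q rfl ≫ edgeMap a k l hkl P Q eP eQ w = vertex a l Q eQ :=
  hom_ext (SimplexCategory.Hom.ext _ _ (by ext m; rfl)) (Category.id_comp _)

/-- Morphisms of simplices need not preserve the initial vertex; this locates the image of a vertex,
up to pulling back the point. -/
theorem vertex_comp {a b : CechCat 𝒰} (f : a ⟶ b) (k : Fin (a.deg.len + 1))
    (P : CoverPoint 𝒰 a.left) (e : a.pt k = P) (Q : CoverPoint 𝒰 b.left)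
    (e' : b.pt ((Hom.deg f).toOrderHom k) = Q) :
    vertex a k P e ≫ f =
      pullPoint (Hom.left f) Q P (by rw [← e, ← e', Hom.w f]) ≫
        vertex b ((Hom.deg f).toOrderHom k) Q e' :=
  hom_ext (SimplexCategory.Hom.ext _ _ (by ext m; rfl))
    ((Category.id_comp _).trans (Category.comp_id _).symm)

theorem pullPoint_comp {V W Z : C} (k : Z ⟶ W) (h : W ⟶ V) (P : CoverPoint 𝒰 V)
    (P' : CoverPoint 𝒰 W) (e : P' = P.pullback h) (P'' : CoverPoint 𝒰 Z)
    (e' : P'' = P'.pullback k) :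
    pullPoint k P' P'' e' ≫ pullPoint h P P' e =
      pullPoint (k ≫ h) P P'' (by rw [e', e, CoverPoint.pullback_comp]) :=
  hom_ext (Category.id_comp _) rfl

theorem pullPoint_id {V : C} (P : CoverPoint 𝒰 V) (e : P = P.pullback (𝟙 V)) :
    pullPoint (𝟙 V) P P e = 𝟙 (point P) := rfl

end CechCat

open CechCat

variable {𝒰}
variable {E : Type u₂} [Category.{v₂} E] {p : E ⥤ C}

variable (B : FunOver (CechCat.forget 𝒰) p)

instance isHomLift_map_vertex (a : CechCat 𝒰) (k : Fin (a.deg.len + 1)) (P : CoverPoint 𝒰 a.left)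
    (e : a.pt k = P) : p.IsHomLift (𝟙 a.left) (B.fn.map (vertex a k P e)) :=
  B.isHomLift_map (vertex a k P e)

instance isHomLift_map_pullPoint {V W : C} (h : W ⟶ V) (P : CoverPoint 𝒰 V) (P' : CoverPoint 𝒰 W)
    (e : P' = P.pullback h) : p.IsHomLift h (B.fn.map (pullPoint h P P' e)) :=
  B.isHomLift_map (pullPoint h P P' e)

variable [IsFiberedInGroupoids p]

instance isIso_map_vertex (a : CechCat 𝒰) (k : Fin (a.deg.len + 1)) (P : CoverPoint 𝒰 a.left)
    (e : a.pt k = P) : IsIso (B.fn.map (vertex a k P e)) :=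
  isIso_of_isHomLift_id p (X := a.left) _

instance isIso_map_edge {V : C} (P Q : CoverPoint 𝒰 V) (w : P.base = Q.base) :
    IsIso (B.fn.map (vertex (edge P Q w) 1 Q rfl)) :=
  isIso_map_vertex B (edge P Q w) 1 Q rfl

/-- The morphism between the values at two points with the same base which is induced by
the edge between them. -/
def edgeHom {V : C} (P Q : CoverPoint 𝒰 V) (w : P.base = Q.base) :
    B.fn.obj (point P) ⟶ B.fn.obj (point Q) :=
  B.fn.map (vertex (edge P Q w) 0 P rfl) ≫ inv (B.fn.map (vertex (edge P Q w) 1 Q rfl))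

instance isHomLift_edgeHom {V : C} (P Q : CoverPoint 𝒰 V) (w : P.base = Q.base) :
    p.IsHomLift (𝟙 V) (edgeHom B P Q w) := by
  have h0 : p.IsHomLift (𝟙 V) (B.fn.map (vertex (edge P Q w) 0 P rfl)) :=
    isHomLift_map_vertex B (edge P Q w) 0 P rfl
  have h1 : p.IsHomLift (𝟙 V) (B.fn.map (vertex (edge P Q w) 1 Q rfl)) :=
    isHomLift_map_vertex B (edge P Q w) 1 Q rfl
  unfold edgeHom
  infer_instance

instance isIso_edgeHom {V : C} (P Q : CoverPoint 𝒰 V) (w : P.base = Q.base) :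
    IsIso (edgeHom B P Q w) := isIso_of_isHomLift_id p (X := V) _

/-- Both vertices factor through the edge they span. The order assumption is what provides the
operator `[1] ⟶ [n]`; `edgeHom_vertex` removes it. -/
theorem edgeHom_vertex_of_le (a : CechCat 𝒰) (k l : Fin (a.deg.len + 1)) (hkl : k ≤ l)
    (P Q : CoverPoint 𝒰 a.left) (eP : a.pt k = P) (eQ : a.pt l = Q) (w : P.base = Q.base) :
    edgeHom B P Q w ≫ B.fn.map (vertex a l Q eQ) = B.fn.map (vertex a k P eP) := by
  rw [← vertex_edgeMap_one a k l hkl P Q eP eQ w, ← vertex_edgeMap_zero a k l hkl P Q eP eQ w,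
    B.fn.map_comp, B.fn.map_comp, edgeHom, Category.assoc, IsIso.inv_hom_id_assoc]

/-- All three edges lie in the triangle on `P`, `Q`, `R`, and the comparison is made after the
inclusion of its last vertex, which `B` sends to an isomorphism. -/
theorem edgeHom_comp {V : C} (P Q R : CoverPoint 𝒰 V) (w : P.base = Q.base)
    (w' : Q.base = R.base) :
    edgeHom B P Q w ≫ edgeHom B Q R w' = edgeHom B P R (w.trans w') := by
  let a := triangle P Q R w w'
  have h01 := edgeHom_vertex_of_le B a (0 : Fin 3) (1 : Fin 3) (Fin.zero_le _) P Q rfl rfl w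
  have h12 := edgeHom_vertex_of_le B a (1 : Fin 3) (2 : Fin 3) (Fin.mk_le_mk.2 one_le_two) Q R rfl rfl w'
  have h02 := edgeHom_vertex_of_le B a (0 : Fin 3) (2 : Fin 3) (Fin.zero_le _) P R rfl rfl
    (w.trans w')
  have : IsIso (B.fn.map (vertex a (2 : Fin 3) R rfl)) := isIso_map_vertex B a _ R rfl
  refine (cancel_mono (B.fn.map (vertex a (2 : Fin 3) R rfl))).1 ?_
  exact (Category.assoc _ _ _).trans ((congrArg (edgeHom B P Q w ≫ ·) h12).trans
    (h01.trans h02.symm))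

theorem edgeHom_self {V : C} (P : CoverPoint 𝒰 V) : edgeHom B P P rfl = 𝟙 _ :=
  eq_id_of_comp_self (edgeHom_comp B P P P rfl rfl)

/-- In the reversed order the two edge morphisms are mutually inverse by `edgeHom_comp` and
`edgeHom_self`. This order does occur: a simplicial operator can carry the initial vertex to a later
one, which must be compared with vertex `0`. -/
theorem edgeHom_vertex (a : CechCat 𝒰) (k l : Fin (a.deg.len + 1))
    (P Q : CoverPoint 𝒰 a.left) (eP : a.pt k = P) (eQ : a.pt l = Q) (w : P.base = Q.base) :
    edgeHom B P Q w ≫ B.fn.map (vertex a l Q eQ) = B.fn.map (vertex a k P eP) := by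
  rcases le_total k l with h | h
  · exact edgeHom_vertex_of_le B a k l h P Q eP eQ w
  · rw [← edgeHom_vertex_of_le B a l k h Q P eQ eP w.symm, ← Category.assoc, edgeHom_comp,
      edgeHom_self, Category.id_comp]

theorem pullPoint_edgeHom {V W : C} (h : W ⟶ V) (P Q : CoverPoint 𝒰 V) (P' Q' : CoverPoint 𝒰 W)
    (eP : P' = P.pullback h) (eQ : Q' = Q.pullback h) (w : P.base = Q.base)
    (w_pull : P'.base = Q'.base) :
    B.fn.map (pullPoint h P P' eP) ≫ edgeHom B P Q w =
      edgeHom B P' Q' w_pull ≫ B.fn.map (pullPoint h Q Q' eQ) := by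
  have h0 := vertex_comp (pullEdge h P Q P' Q' eP eQ w w_pull) 0 P' rfl P rfl
  have h1 := vertex_comp (pullEdge h P Q P' Q' eP eQ w w_pull) 1 Q' rfl Q rfl
  have g0 := (B.fn.map_comp _ _).symm.trans ((congrArg B.fn.map h0).trans (B.fn.map_comp _ _))
  have g1 := (B.fn.map_comp _ _).symm.trans ((congrArg B.fn.map h1).trans (B.fn.map_comp _ _))
  refine (cancel_mono (B.fn.map (vertex (edge P Q w) 1 Q rfl))).1 ?_
  rw [Category.assoc, Category.assoc, edgeHom_vertex B (edge P Q w) 0 1 P Q rfl rfl w]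
  refine g0.symm.trans (Eq.trans ?_ (congrArg (edgeHom B P' Q' w_pull ≫ ·) g1))
  rw [← Category.assoc, edgeHom_vertex B (edge P' Q' w_pull) 0 1 P' Q' rfl rfl w_pull]

/-- The action on morphisms of the extension to `SieveCat 𝒰` of a functor on `CechCat 𝒰`. -/
def extendMap {V W : C} (P : CoverPoint 𝒰 W) (Q : CoverPoint 𝒰 V) (h : W ⟶ V)
    (Q' : CoverPoint 𝒰 W) (e : Q' = Q.pullback h) (w : P.base = Q'.base) :
    B.fn.obj (point P) ⟶ B.fn.obj (point Q) :=
  edgeHom B P Q' w ≫ B.fn.map (pullPoint h Q Q' e)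

instance isHomLift_extendMap {V W : C} (P : CoverPoint 𝒰 W) (Q : CoverPoint 𝒰 V) (h : W ⟶ V)
    (Q' : CoverPoint 𝒰 W) (e : Q' = Q.pullback h) (w : P.base = Q'.base) :
    p.IsHomLift h (extendMap B P Q h Q' e w) :=
  isHomLift_comp p (𝟙 W) h h (Category.id_comp _) _ _

theorem extendMap_comp {V W Z : C} (P : CoverPoint 𝒰 W) (Q : CoverPoint 𝒰 V) (R : CoverPoint 𝒰 Z)
    (h : W ⟶ V) (h' : V ⟶ Z)
    (Q' : CoverPoint 𝒰 W) (eQ : Q' = Q.pullback h) (wQ : P.base = Q'.base)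
    (R' : CoverPoint 𝒰 V) (eR : R' = R.pullback h') (wR : Q.base = R'.base)
    (R'' : CoverPoint 𝒰 W) (eR' : R'' = R.pullback (h ≫ h')) (wR' : P.base = R''.base) :
    extendMap B P Q h Q' eQ wQ ≫ extendMap B Q R h' R' eR wR =
      extendMap B P R (h ≫ h') R'' eR' wR' := by
  have e : R'' = R'.pullback h := by rw [eR', eR, CoverPoint.pullback_comp]
  unfold extendMap
  rw [Category.assoc, comp_assoc_of_square
    (pullPoint_edgeHom B h Q R' Q' R'' eQ e wR (wQ.symm.trans wR')), ← Category.assoc,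
    edgeHom_comp, ← B.fn.map_comp, pullPoint_comp]

theorem SieveCat.hom_base {P Q : SieveCat 𝒰} (h : P ⟶ Q) :
    P.pt.base = (Q.pt.pullback (SieveCat.Hom.left h)).base := by
  rw [CoverPoint.base_pullback, SieveCat.Hom.w h]

/-- The extension to `SieveCat 𝒰` of a functor on `CechCat 𝒰`. -/
def extend : FunOver (SieveCat.forget 𝒰) p :=
  FunOver.mk'
    { obj := fun P => B.fn.obj (point P.pt)
      map := fun {P Q} h => extendMap B P.pt Q.pt (SieveCat.Hom.left h) _ rfl
        (SieveCat.hom_base h)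
      map_id := fun P => by
        refine (?_ : _ = extendMap B P.pt P.pt (𝟙 P.left) P.pt (CoverPoint.pullback_id _).symm
          rfl).trans ?_
        · congr 1
          exact CoverPoint.pullback_id _
        · unfold extendMap
          rw [edgeHom_self, pullPoint_id, B.fn.map_id, Category.comp_id]
      map_comp := fun {P Q R} h h' => (extendMap_comp B _ _ _ _ _ _ _ _ _ _ _ _ _ _).symm }
    (fun P => B.proj_obj (point P.pt))
    (fun {P Q} h => isHomLift_extendMap B _ _ _ _ _ _)

variable (𝒰 p) in
/-- Restriction along the initial vertex functor. -/
def vertexRestrict : FunOver (SieveCat.forget 𝒰) p ⥤ FunOver (CechCat.forget 𝒰) p :=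
  FunOver.pre p (initialVertex 𝒰) rfl

/-- The inclusion of the initial vertex of a simplex identifies the value of `B` there with its
value at a point, so `B` is recovered from `extend B`. -/
instance : (vertexRestrict 𝒰 p).EssSurj where
  mem_essImage B := by
    let η : (vertexRestrict 𝒰 p).obj (extend B) ⟶ B := FunOver.mkHom
      (fun a => B.fn.map (vertex a 0 (a.pt 0) rfl))
      (fun {a b} f => by
        have h := B.fn.map_comp (vertex a 0 (a.pt 0) rfl) f
        -- The vertex `0` of `a` lands on the vertex `σ(0)` of `b`; the edge from there to vertex
        -- `0` supplies the change of point built into `extendMap`.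
        rw [vertex_comp f 0 _ rfl _ rfl, B.fn.map_comp,
          ← edgeHom_vertex B b _ 0 _ _ rfl rfl (b.base_eq _ _),
          comp_assoc_of_square (pullPoint_edgeHom B (Hom.left f) _ _ _
            ((b.pt 0).pullback (Hom.left f)) _ rfl _ (by
              rw [CoverPoint.base_pullback, ← b.base_eq ((Hom.deg f).toOrderHom 0) 0,
                ← CoverPoint.base_pullback, ← Hom.w f 0]))] at h
        exact (Category.assoc _ _ _).trans h)
      (fun a => isHomLift_map_vertex B a 0 _ rfl)
    have := FunOver.isIso_hom η
    exact ⟨extend B, ⟨asIso η⟩⟩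

instance : (vertexRestrict 𝒰 p).Faithful where
  map_injective h := FunOver.hom_ext fun P =>
    congrArg (fun ζ => (FunOver.homFn ζ).app (point P.pt)) h

instance : (vertexRestrict 𝒰 p).Full where
  map_surjective {T T'} η := by
    let ζ (P : SieveCat 𝒰) : T.fn.obj P ⟶ T'.fn.obj P := (FunOver.homFn η).app (point P.pt)
    have nat {a b : CechCat 𝒰} (f : a ⟶ b) : T.fn.map ((initialVertex 𝒰).map f) ≫
        (FunOver.homFn η).app b =
          (FunOver.homFn η).app a ≫ T'.fn.map ((initialVertex 𝒰).map f) :=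
      (FunOver.homFn η).naturality f
    -- The inclusion of the initial vertex becomes an identity in `SieveCat 𝒰`, so the component at
    -- a simplex is the component at its initial vertex.
    have hv (a : CechCat 𝒰) : (FunOver.homFn η).app a = ζ ⟨a.left, a.pt 0⟩ := by
      have h₁ := congrArg (· ≫ (FunOver.homFn η).app a) (T.fn.map_id ⟨a.left, a.pt 0⟩)
      have h₂ := congrArg (ζ ⟨a.left, a.pt 0⟩ ≫ ·) (T'.fn.map_id ⟨a.left, a.pt 0⟩)
      exact (Category.id_comp _).symm.trans (h₁.symm.trans
        ((nat (vertex a 0 (a.pt 0) rfl)).trans (h₂.trans (Category.comp_id _))))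
    have nat' {a b : CechCat 𝒰} (f : a ⟶ b) : T.fn.map ((initialVertex 𝒰).map f) ≫
        ζ ⟨b.left, b.pt 0⟩ = ζ ⟨a.left, a.pt 0⟩ ≫ T'.fn.map ((initialVertex 𝒰).map f) := by
      rw [← hv, ← hv]; exact nat f
    -- The inclusion of the last vertex `Q` into the edge from `P` to `Q` is sent to the change of
    -- factorization from `Q` to `P`; this gives naturality along such changes.
    have nat₁ {V : C} (P Q : CoverPoint 𝒰 V) (w : P.base = Q.base) :
        T.fn.map (SieveCat.homMk (a := ⟨V, Q⟩) (b := ⟨V, P⟩) (𝟙 V)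
            ((Category.id_comp _).trans w)) ≫ ζ ⟨V, P⟩ =
          ζ ⟨V, Q⟩ ≫ T'.fn.map (SieveCat.homMk (a := ⟨V, Q⟩) (b := ⟨V, P⟩) (𝟙 V)
            ((Category.id_comp _).trans w)) :=
      nat' (vertex (edge P Q w) 1 Q rfl)
    refine ⟨FunOver.mkHom ζ (fun {P Q} h => ?_) (fun P => FunOver.isHomLift_homFn η (point P.pt)),
      FunOver.hom_ext fun a => (hv a).symm⟩
    let g : P.left ⟶ Q.left := SieveCat.Hom.left h
    let Q' : SieveCat 𝒰 := ⟨P.left, Q.pt.pullback g⟩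
    have h₂ := nat' (pullPoint g Q.pt _ rfl)
    have h₁ := nat₁ Q'.pt P.pt (SieveCat.hom_base h).symm
    let f₁ : P ⟶ Q' := SieveCat.homMk (𝟙 P.left)
      ((Category.id_comp _).trans (SieveCat.hom_base h).symm)
    let f₂ : Q' ⟶ Q := SieveCat.homMk g (CoverPoint.base_pullback g Q.pt).symm
    have e : h = f₁ ≫ f₂ := SieveCat.hom_ext (Category.id_comp g).symm
    have h₁' : T.fn.map f₁ ≫ ζ Q' = ζ P ≫ T'.fn.map f₁ := h₁
    have h₂' : T.fn.map f₂ ≫ ζ Q = ζ Q' ≫ T'.fn.map f₂ := h₂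
    rw [e, T.fn.map_comp, T'.fn.map_comp, Category.assoc, h₂', comp_assoc_of_square h₁']

instance : (vertexRestrict 𝒰 p).IsEquivalence where

end Cech

/-! ### Homotopy limits and pseudocones -/

section PseudoCone

variable {I : Type u₁} [Category.{v₁} I] (X : I ⥤ Grpd.{v, u})

/-- The values of a diagram of groupoids. -/
def Val (i : I) : Type u := X.obj i

instance (i : I) : Groupoid.{v} (Val X i) := inferInstanceAs (Groupoid (X.obj i))

/-- The functor between the values of a diagram of groupoids. -/
def act {j i : I} (σ : j ⟶ i) : Val X j ⥤ Val X i := X.map σ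

theorem act_id (i : I) : act X (𝟙 i) = 𝟭 _ := X.map_id i

theorem act_comp {k j i : I} (σ : k ⟶ j) (τ : j ⟶ i) :
    act X (σ ≫ τ) = act X σ ⋙ act X τ := X.map_comp σ τ

theorem act_id_obj (i : I) (x : Val X i) : (act X (𝟙 i)).obj x = x :=
  Functor.congr_obj (act_id X i) x

theorem act_comp_obj {k j i : I} (σ : k ⟶ j) (τ : j ⟶ i) (x : Val X k) :
    (act X (σ ≫ τ)).obj x = (act X τ).obj ((act X σ).obj x) :=
  Functor.congr_obj (act_comp X σ τ) x

theorem act_id_map (i : I) {x y : Val X i} (f : x ⟶ y) :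
    (act X (𝟙 i)).map f = eqToHom (act_id_obj X i x) ≫ f ≫ eqToHom (act_id_obj X i y).symm :=
  Functor.congr_hom (act_id X i) f

theorem act_comp_map {k j i : I} (σ : k ⟶ j) (τ : j ⟶ i) {x y : Val X k} (f : x ⟶ y) :
    (act X (σ ≫ τ)).map f = eqToHom (act_comp_obj X σ τ x) ≫ (act X τ).map ((act X σ).map f) ≫
      eqToHom (act_comp_obj X σ τ y).symm :=
  Functor.congr_hom (act_comp X σ τ) f

/-- A pseudocone on a diagram of groupoids. -/
structure PseudoCone where
  pt : ∀ i, Val X i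
  tr : ∀ {j i : I} (σ : j ⟶ i), (act X σ).obj (pt j) ⟶ pt i
  tr_id : ∀ i, tr (𝟙 i) = eqToHom (act_id_obj X i (pt i))
  tr_comp : ∀ {k j i : I} (σ : k ⟶ j) (τ : j ⟶ i),
    tr (σ ≫ τ) = eqToHom (act_comp_obj X σ τ (pt k)) ≫ (act X τ).map (tr σ) ≫ tr τ

namespace PseudoCone

variable {X}

/-- A morphism of pseudocones. -/
@[ext]
structure Hom (c d : PseudoCone X) where
  app : ∀ i, c.pt i ⟶ d.pt i
  comm : ∀ {j i : I} (σ : j ⟶ i), (act X σ).map (app j) ≫ d.tr σ = c.tr σ ≫ app i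

instance : Category (PseudoCone X) where
  Hom := Hom
  id c := ⟨fun i => 𝟙 _, fun σ => by
    rw [CategoryTheory.Functor.map_id, Category.id_comp, Category.comp_id]⟩
  comp f g := ⟨fun i => f.app i ≫ g.app i, fun σ => by
    rw [CategoryTheory.Functor.map_comp, Category.assoc, g.comm, comp_assoc_of_square (f.comm σ)]⟩
  id_comp f := Hom.ext (funext fun i => Category.id_comp _)
  comp_id f := Hom.ext (funext fun i => Category.comp_id _)
  assoc f g h := Hom.ext (funext fun i => Category.assoc _ _ _)

theorem isIso_hom {c d : PseudoCone X} (f : c ⟶ d) : IsIso f := by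
  refine ⟨⟨⟨fun i => inv (Hom.app f i), fun {j i} σ => ?_⟩, ?_, ?_⟩⟩
  · rw [CategoryTheory.Functor.map_inv, IsIso.inv_comp_eq, ← Category.assoc, IsIso.eq_comp_inv]
    exact (Hom.comm f σ).symm
  · exact Hom.ext (funext fun i => IsIso.hom_inv_id _)
  · exact Hom.ext (funext fun i => IsIso.inv_hom_id _)

end PseudoCone

variable {X}

/-- The functors on the slices of the index category underlying an object of the
homotopy limit. -/
def sliceFunctor (A : HoLim X) (i : I) : Over i ⥤ Val X i := FreeGroupoid.of _ ⋙ A.obj i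

theorem sliceFunctor_map (A : HoLim X) {j i : I} (σ : j ⟶ i) :
    Over.map σ ⋙ sliceFunctor A i = sliceFunctor A j ⋙ act X σ :=
  congrArg (FreeGroupoid.of _ ⋙ ·) (congrFun A.eq (Arrow.mk σ))

/-- The point of an object of the homotopy limit at an index. -/
abbrev holimPt (A : HoLim X) (i : I) : Val X i := (sliceFunctor A i).obj (Over.mk (𝟙 i))

/-- The object `σ` of `I/i` is the image of the terminal object of `I/j`, so the equalizer condition
prescribes the value. That image is literally `𝟙 j ≫ σ`, whence the extra rewriting. -/
theorem sliceFunctor_obj (A : HoLim X) {j i : I} (σ : j ⟶ i) :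
    (sliceFunctor A i).obj (Over.mk σ) = (act X σ).obj (holimPt A j) := by
  have h := Functor.congr_obj (sliceFunctor_map A σ) (Over.mk (𝟙 j))
  refine Eq.trans ?_ h
  exact congrArg (fun τ : j ⟶ i => (sliceFunctor A i).obj (Over.mk τ)) (Category.id_comp σ).symm

/-- The transition morphisms of an object of the homotopy limit. -/
def holimTr (A : HoLim X) {j i : I} (σ : j ⟶ i) : (act X σ).obj (holimPt A j) ⟶ holimPt A i :=
  eqToHom (sliceFunctor_obj A σ).symm ≫
    (sliceFunctor A i).map (Over.homMk σ : Over.mk σ ⟶ Over.mk (𝟙 i))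

theorem sliceFunctor_map_eqToHom (A : HoLim X) {k j i : I} (σ : k ⟶ j) (τ τ' : j ⟶ i) (e : τ = τ')
    (ρ : k ⟶ i) (w : σ ≫ τ = ρ) :
    (sliceFunctor A i).map (Over.homMk σ w : Over.mk ρ ⟶ Over.mk τ) =
      (sliceFunctor A i).map (Over.homMk σ (e ▸ w) : Over.mk ρ ⟶ Over.mk τ') ≫
        eqToHom (by rw [e]) := by
  subst e
  simp

/-- A morphism of `I/i` with target `τ : j ⟶ i` comes from a morphism of `I/j` to the terminal
object. The equalizer condition therefore expresses the slice functors entirely through the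
transitions. -/
theorem sliceFunctor_map_homMk (A : HoLim X) {k j i : I} (σ : k ⟶ j) (τ : j ⟶ i) :
    (sliceFunctor A i).map (Over.homMk σ rfl : Over.mk (σ ≫ τ) ⟶ Over.mk τ) =
      eqToHom ((sliceFunctor_obj A (σ ≫ τ)).trans (act_comp_obj X σ τ _)) ≫
        (act X τ).map (holimTr A σ) ≫ eqToHom (sliceFunctor_obj A τ).symm := by
  have h := Functor.congr_hom (sliceFunctor_map A τ)
    (Over.homMk σ : Over.mk σ ⟶ Over.mk (𝟙 j))
  rw [sliceFunctor_map_eqToHom A σ τ (𝟙 j ≫ τ) (Category.id_comp τ).symm (σ ≫ τ) rfl]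
  refine (congrArg (· ≫ eqToHom _) h).trans ?_
  simp only [holimTr, CategoryTheory.Functor.map_comp, eqToHom_map, Category.assoc, eqToHom_trans,
    eqToHom_trans_assoc, CategoryTheory.Functor.comp_map]

/-- The pseudocone of an object of the homotopy limit. -/
def holimCone (A : HoLim X) : PseudoCone X where
  pt := holimPt A
  tr σ := holimTr A σ
  tr_id i := by
    have h : (Over.homMk (𝟙 i) : Over.mk (𝟙 i) ⟶ Over.mk (𝟙 i)) = 𝟙 _ := rfl
    unfold holimTr
    rw [h, CategoryTheory.Functor.map_id, Category.comp_id]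
  tr_comp {k j i} σ τ := by
    have h : (Over.homMk (σ ≫ τ) : Over.mk (σ ≫ τ) ⟶ Over.mk (𝟙 i)) =
      (Over.homMk σ rfl : Over.mk (σ ≫ τ) ⟶ Over.mk τ) ≫
        (Over.homMk τ : Over.mk τ ⟶ Over.mk (𝟙 i)) := rfl
    have h' := congrArg (sliceFunctor A i).map h
    rw [CategoryTheory.Functor.map_comp, sliceFunctor_map_homMk] at h'
    refine (congrArg (eqToHom _ ≫ ·) h').trans ?_
    simp only [Category.assoc, eqToHom_trans_assoc]
    rfl

/-- The natural transformations on the slices of the index category underlying a morphism of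
the homotopy limit. -/
def sliceHom {A B : HoLim X} (φ : A ⟶ B) (i : I) : sliceFunctor A i ⟶ sliceFunctor B i :=
  Functor.whiskerLeft (FreeGroupoid.of _) (φ.hom i)

theorem holim_hom_ext {A B : HoLim X} {φ ψ : A ⟶ B}
    (h : ∀ {j i : I} (σ : j ⟶ i),
      (sliceHom φ i).app (Over.mk σ) = (sliceHom ψ i).app (Over.mk σ)) : φ = ψ := by
  refine StrictEqualizer.Hom.ext (funext fun i => NatTrans.ext (funext fun f => ?_))
  exact h f.as.as.hom

theorem sliceHom_map {A B : HoLim X} (φ : A ⟶ B) {j i : I} (σ : j ⟶ i) (f : Over j) :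
    (sliceHom φ i).app ((Over.map σ).obj f) =
      eqToHom (Functor.congr_obj (sliceFunctor_map A σ) f) ≫
        (act X σ).map ((sliceHom φ j).app f) ≫
          eqToHom (Functor.congr_obj (sliceFunctor_map B σ) f).symm := by
  have h := NatTrans.congr_app (congrFun φ.eq (Arrow.mk σ)) (FreeGroupoid.mk f)
  simp only [Pi.comp_apply, CategoryTheory.Functor.eqToHom_proj, NatTrans.comp_app,
    eqToHom_app] at h
  exact h

/-- The equalizer condition reduces the component at `σ` to the one at the terminal object of `I/j`;
faithfulness of `holimToCone` and the formula for `coneApp` rest on this. -/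
theorem sliceHom_app {A B : HoLim X} (φ : A ⟶ B) {j i : I} (σ : j ⟶ i) :
    (sliceHom φ i).app (Over.mk σ) =
      eqToHom (sliceFunctor_obj A σ) ≫ (act X σ).map ((sliceHom φ j).app (Over.mk (𝟙 j))) ≫
        eqToHom (sliceFunctor_obj B σ).symm := by
  have h : (sliceHom φ i).app (Over.mk (𝟙 j ≫ σ)) = _ := sliceHom_map φ σ (Over.mk (𝟙 j))
  have e (τ : j ⟶ i) (hτ : σ = τ) : (sliceHom φ i).app (Over.mk σ) =
      eqToHom (by rw [hτ]) ≫ (sliceHom φ i).app (Over.mk τ) ≫ eqToHom (by rw [hτ]) := by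
    subst hτ; simp
  refine (e _ (Category.id_comp σ).symm).trans ?_
  rw [h]
  simp only [Category.assoc, eqToHom_trans, eqToHom_trans_assoc]

/-- The functor from the homotopy limit to pseudocones. -/
def holimToCone (X : I ⥤ Grpd.{v, u}) : HoLim X ⥤ PseudoCone X where
  obj A := holimCone A
  map {A B} φ :=
    { app := fun i => (sliceHom φ i).app (Over.mk (𝟙 i))
      comm := fun {j i} σ => by
        have h := (sliceHom φ i).naturality (Over.homMk σ : Over.mk σ ⟶ Over.mk (𝟙 i))
        rw [sliceHom_app φ σ] at h
        change (act X σ).map ((sliceHom φ j).app (Over.mk (𝟙 j))) ≫ eqToHom _ ≫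
          (sliceFunctor B i).map _ = (eqToHom _ ≫ (sliceFunctor A i).map _) ≫ _
        rw [Category.assoc, h]
        simp only [Category.assoc, eqToHom_trans_assoc, eqToHom_refl, Category.id_comp] }
  map_id A := rfl
  map_comp φ ψ := rfl

instance : (holimToCone X).Faithful where
  map_injective {A B φ ψ} h := holim_hom_ext fun {j i} σ => by
    have hj : (sliceHom φ j).app (Over.mk (𝟙 j)) = (sliceHom ψ j).app (Over.mk (𝟙 j)) :=
      congrArg (fun f => PseudoCone.Hom.app f j) h
    rw [sliceHom_app φ σ, sliceHom_app ψ σ, hj]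

section Lift

variable {A B : HoLim X} (x : ∀ i, holimPt A i ⟶ holimPt B i)

/-- The components on the slices of a morphism of pseudocones. -/
def coneApp {j i : I} (σ : j ⟶ i) :
    (sliceFunctor A i).obj (Over.mk σ) ⟶ (sliceFunctor B i).obj (Over.mk σ) :=
  eqToHom (sliceFunctor_obj A σ) ≫ (act X σ).map (x j) ≫ eqToHom (sliceFunctor_obj B σ).symm

theorem coneApp_comp {k j i : I} (σ : k ⟶ j) (τ : j ⟶ i) :
    coneApp x (σ ≫ τ) =
      eqToHom (Functor.congr_obj (sliceFunctor_map A τ) (Over.mk σ)) ≫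
        (act X τ).map (coneApp x σ) ≫
          eqToHom (Functor.congr_obj (sliceFunctor_map B τ) (Over.mk σ)).symm := by
  simp only [coneApp, act_comp_map, CategoryTheory.Functor.map_comp, eqToHom_map, Category.assoc,
    eqToHom_trans, eqToHom_trans_assoc]

theorem coneApp_id (i : I) : coneApp x (𝟙 i) = x i := by
  simp only [coneApp, act_id_map, Category.assoc, eqToHom_trans, eqToHom_trans_assoc,
    eqToHom_refl, Category.id_comp, Category.comp_id]

theorem coneApp_naturality
    (hx : ∀ {j i : I} (σ : j ⟶ i), (act X σ).map (x j) ≫ holimTr B σ = holimTr A σ ≫ x i)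
    {k j i : I} (σ : k ⟶ j) (τ : j ⟶ i) (ρ : k ⟶ i) (w : σ ≫ τ = ρ) :
    (sliceFunctor A i).map (Over.homMk σ w : Over.mk ρ ⟶ Over.mk τ) ≫ coneApp x τ =
      coneApp x ρ ≫ (sliceFunctor B i).map (Over.homMk σ w : Over.mk ρ ⟶ Over.mk τ) := by
  subst w
  have h := congrArg (act X τ).map (hx σ)
  rw [CategoryTheory.Functor.map_comp, CategoryTheory.Functor.map_comp] at h
  simp only [sliceFunctor_map_homMk, coneApp, act_comp_map, Category.assoc, eqToHom_trans_assoc,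
    eqToHom_refl, Category.id_comp, comp_assoc_of_square h]

/-- The natural isomorphisms on the slices of a morphism of pseudocones. -/
def coneSliceIso
    (hx : ∀ {j i : I} (σ : j ⟶ i), (act X σ).map (x j) ≫ holimTr B σ = holimTr A σ ≫ x i) (i : I) :
    sliceFunctor A i ≅ sliceFunctor B i :=
  NatIso.ofComponents (fun f => asIso (coneApp x f.hom))
    (fun {f f'} g => coneApp_naturality x hx g.left f'.hom f.hom (Over.w g))

/-- The morphism of the homotopy limit induced by a morphism of pseudocones. -/
def holimHomMk
    (hx : ∀ {j i : I} (σ : j ⟶ i), (act X σ).map (x j) ≫ holimTr B σ = holimTr A σ ≫ x i) :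
    A ⟶ B where
  -- Natural isomorphisms on `I/i` extend to the free groupoid; invertibility is automatic since the
  -- values lie in a groupoid.
  hom i := (FreeGroupoid.liftNatIso (A.obj i) (B.obj i) (coneSliceIso x hx i)).hom
  eq := by
    funext α
    refine NatTrans.ext (funext fun f => ?_)
    simp only [Pi.comp_apply, CategoryTheory.Functor.eqToHom_proj, NatTrans.comp_app, eqToHom_app]
    have h₁ := FreeGroupoid.liftNatIso_hom_app (A.obj α.right) (B.obj α.right)
      (coneSliceIso x hx α.right) ((Over.map α.hom).obj f.as.as)
    have h₂ := FreeGroupoid.liftNatIso_hom_app (A.obj α.left) (B.obj α.left)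
      (coneSliceIso x hx α.left) f.as.as
    have h₃ := congrArg (X.map α.hom : X.obj α.left ⥤ X.obj α.right).map h₂
    refine h₁.trans ((coneApp_comp x f.as.as.hom α.hom).trans ?_)
    exact congrArg (fun z => eqToHom _ ≫ z ≫ eqToHom _) h₃.symm

theorem sliceHom_holimHomMk_app
    (hx : ∀ {j i : I} (σ : j ⟶ i), (act X σ).map (x j) ≫ holimTr B σ = holimTr A σ ≫ x i) (i : I) :
    (sliceHom (holimHomMk x hx) i).app (Over.mk (𝟙 i)) = x i :=
  (FreeGroupoid.liftNatIso_hom_app (A.obj i) (B.obj i) (coneSliceIso x hx i) _).trans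
    (coneApp_id x i)

end Lift

instance : (holimToCone X).Full where
  map_surjective {A B} f :=
    ⟨holimHomMk (A := A) (B := B) (fun i => PseudoCone.Hom.app f i)
      (fun σ => PseudoCone.Hom.comm f σ),
    PseudoCone.Hom.ext (funext fun i => sliceHom_holimHomMk_app _ _ i)⟩

namespace PseudoCone

variable (c : PseudoCone X)

/-- The action on morphisms of the functors on slices associated to a pseudocone. -/
def sliceMap {k j i : I} (σ : k ⟶ j) (τ : j ⟶ i) (ρ : k ⟶ i) (w : σ ≫ τ = ρ) :
    (act X ρ).obj (c.pt k) ⟶ (act X τ).obj (c.pt j) :=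
  eqToHom (by rw [← act_comp_obj, w]) ≫ (act X τ).map (c.tr σ)

theorem sliceMap_id {j i : I} (τ : j ⟶ i) :
    c.sliceMap (𝟙 j) τ τ (Category.id_comp τ) = 𝟙 _ := by
  simp only [sliceMap, c.tr_id, eqToHom_map, eqToHom_trans, eqToHom_refl]

theorem sliceMap_comp {l k j i : I} (σ' : l ⟶ k) (σ : k ⟶ j) (τ : j ⟶ i) (ρ : k ⟶ i)
    (w : σ ≫ τ = ρ) (ρ' : l ⟶ i) (w' : σ' ≫ ρ = ρ') (w'' : (σ' ≫ σ) ≫ τ = ρ') :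
    c.sliceMap (σ' ≫ σ) τ ρ' w'' = c.sliceMap σ' ρ ρ' w' ≫ c.sliceMap σ τ ρ w := by
  subst w w'
  simp only [sliceMap, c.tr_comp, act_comp_map, CategoryTheory.Functor.map_comp, eqToHom_map,
    Category.assoc, eqToHom_trans_assoc, eqToHom_refl, Category.id_comp]

theorem sliceMap_act {k j i i' : I} (σ : k ⟶ j) (τ : j ⟶ i) (ρ : k ⟶ i) (w : σ ≫ τ = ρ)
    (κ : i ⟶ i') (w' : σ ≫ τ ≫ κ = ρ ≫ κ) :
    c.sliceMap σ (τ ≫ κ) (ρ ≫ κ) w' = eqToHom (act_comp_obj X ρ κ _) ≫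
      (act X κ).map (c.sliceMap σ τ ρ w) ≫ eqToHom (act_comp_obj X τ κ _).symm := by
  simp only [sliceMap, act_comp_map, CategoryTheory.Functor.map_comp, eqToHom_map,
    Category.assoc, eqToHom_trans_assoc]

/-- The functors on slices associated to a pseudocone. -/
def slice (i : I) : Over i ⥤ Val X i where
  obj f := (act X f.hom).obj (c.pt f.left)
  map {f f'} g := c.sliceMap g.left f'.hom f.hom (Over.w g)
  map_id f := c.sliceMap_id f.hom
  map_comp {f f' f''} g g' := c.sliceMap_comp g.left g'.left f''.hom f'.hom (Over.w g') f.hom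
    (Over.w g) (Over.w (g ≫ g'))

/-- This is an equality of functors because `X` is a strict functor and `slice` evaluates it at the
structure map; it is what rectifies a pseudocone to an object of the strict equalizer. -/
theorem slice_map {j i : I} (σ : j ⟶ i) :
    Over.map σ ⋙ c.slice i = c.slice j ⋙ act X σ :=
  CategoryTheory.Functor.ext (fun f => act_comp_obj X f.hom σ (c.pt f.left))
    (fun f f' g => c.sliceMap_act g.left f'.hom f.hom (Over.w g) σ
      (Over.w ((Over.map σ).map g)))

/-- The object of the homotopy limit associated to a pseudocone. -/
def toHolim : HoLim X where
  obj i := FreeGroupoid.lift (c.slice i)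
  eq := funext fun α =>
    (FreeGroupoid.map_comp_lift (Over.map α.hom) (c.slice α.right)).trans
      ((congrArg FreeGroupoid.lift (c.slice_map α.hom)).trans
        (FreeGroupoid.lift_comp (c.slice α.left) (act X α.hom)))

theorem sliceMap_eq_tr {j i : I} (σ : j ⟶ i) (w : σ ≫ 𝟙 i = σ) :
    c.sliceMap σ (𝟙 i) σ w ≫ eqToHom (act_id_obj X i (c.pt i)) = c.tr σ := by
  simp only [sliceMap, act_id_map, Category.assoc, eqToHom_trans, eqToHom_trans_assoc,
    eqToHom_refl, Category.id_comp, Category.comp_id]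

/-- The rectified object has the point `(act X (𝟙 i)).obj (c.pt i)`, equal to `c.pt i` by
functoriality. The square makes these equalities a morphism of pseudocones, which gives essential
surjectivity. -/
theorem holimTr_toHolim {j i : I} (σ : j ⟶ i) :
    holimTr c.toHolim σ ≫ eqToHom (act_id_obj X i (c.pt i)) =
      (act X σ).map (eqToHom (act_id_obj X j (c.pt j))) ≫ c.tr σ := by
  have h : (sliceFunctor c.toHolim i).map (Over.homMk σ : Over.mk σ ⟶ Over.mk (𝟙 i)) =
      c.sliceMap σ (𝟙 i) σ (Category.comp_id σ) :=
    FreeGroupoid.lift_map_homMk (c.slice i) (Over.homMk σ : Over.mk σ ⟶ Over.mk (𝟙 i))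
  refine (congrArg (fun z => (eqToHom (sliceFunctor_obj c.toHolim σ).symm ≫ z) ≫
    eqToHom (act_id_obj X i (c.pt i))) h).trans ?_
  refine (Category.assoc _ _ _).trans ?_
  refine (congrArg (eqToHom _ ≫ ·) (c.sliceMap_eq_tr σ (Category.comp_id σ))).trans ?_
  rw [eqToHom_map]
  rfl

end PseudoCone

instance : (holimToCone X).EssSurj where
  mem_essImage c := by
    let f : (holimToCone X).obj c.toHolim ⟶ c :=
      { app := fun i => eqToHom (act_id_obj X i (c.pt i))
        comm := fun σ => (c.holimTr_toHolim σ).symm }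
    have := PseudoCone.isIso_hom f
    exact ⟨c.toHolim, ⟨asIso f⟩⟩

instance : (holimToCone X).IsEquivalence where

end PseudoCone

/-! ### Evaluation of the cosimplicial groupoid of a cover -/

section Eval

variable {C : Type u} [Category.{v} C] {J : Precoverage C} [J.HasPullbacks] {X : C}
  {𝒰 : Precoverage.ZeroHypercover.{w} J X}

/-- The points of the cover given by a morphism to `U_{i_0 … i_n}`. -/
def pts {n : ℕ} {V : C} {x : Fin (n + 1) → 𝒰.I₀} (s : V ⟶ cechObj 𝒰 x) (k : Fin (n + 1)) :
    CoverPoint 𝒰 V :=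
  ⟨x k, s ≫ WidePullback.π (fun k => 𝒰.f (x k)) k⟩

theorem pts_base {n : ℕ} {V : C} {x : Fin (n + 1) → 𝒰.I₀} (s : V ⟶ cechObj 𝒰 x)
    (k : Fin (n + 1)) : (pts s k).base = s ≫ cechBase 𝒰 x :=
  (Category.assoc _ _ _).trans (congrArg (s ≫ ·) (WidePullback.π_arrow _ k))

theorem eq_of_pts {n : ℕ} {V W : C} {x : Fin (n + 1) → 𝒰.I₀} {s : V ⟶ cechObj 𝒰 x}
    {t : W ⟶ cechObj 𝒰 x} {h : V ⟶ W} (w : ∀ k, pts s k = (pts t k).pullback h) :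
    h ≫ t = s := by
  apply WidePullback.hom_ext
  · intro k
    have e := w k
    simp only [pts, CoverPoint.pullback, CoverPoint.mk.injEq, heq_eq_eq, true_and] at e
    rw [e, Category.assoc]
  · have e := congrArg CoverPoint.base (w 0)
    rw [CoverPoint.base_pullback, pts_base, pts_base] at e
    rw [Category.assoc]
    exact e.symm

theorem pts_comp {n : ℕ} {V W : C} {x : Fin (n + 1) → 𝒰.I₀} (h : V ⟶ W) (t : W ⟶ cechObj 𝒰 x)
    (k : Fin (n + 1)) : pts (h ≫ t) k = (pts t k).pullback h :=
  congrArg (CoverPoint.mk (x k)) (Category.assoc _ _ _)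

theorem pts_cechMap {m n : ℕ} (σ : Fin (m + 1) → Fin (n + 1)) {V : C} {x : Fin (n + 1) → 𝒰.I₀}
    (s : V ⟶ cechObj 𝒰 x) (k : Fin (m + 1)) :
    pts (s ≫ cechMap 𝒰 σ x) k = pts s (σ k) := by
  refine congrArg (CoverPoint.mk (x (σ k))) ?_
  rw [Category.assoc]
  exact congrArg (s ≫ ·) (WidePullback.lift_π _ _ _ _ _)

/-- The morphism to `U_{i_0 … i_n}` given by a simplex. -/
def liftPt (a : CechCat 𝒰) : a.left ⟶ cechObj 𝒰 (fun k => (a.pt k).idx) :=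
  WidePullback.lift (a.pt 0).base (fun k => (a.pt k).hom) (fun k => a.base_eq k 0)

theorem pts_liftPt (a : CechCat 𝒰) (k : Fin (a.deg.len + 1)) : pts (liftPt a) k = a.pt k :=
  congrArg (CoverPoint.mk (a.pt k).idx) (WidePullback.lift_π _ _ _ _ _)

theorem liftPt_base (a : CechCat 𝒰) : liftPt a ≫ cechBase 𝒰 _ = (a.pt 0).base :=
  WidePullback.lift_base _ _ _ _

/-- The simplex given by a morphism to `U_{i_0 … i_n}`. -/
abbrev simplexOf (n : SimplexCategory) {V : C} {x : Fin (n.len + 1) → 𝒰.I₀}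
    (s : V ⟶ cechObj 𝒰 x) : CechCat 𝒰 :=
  ⟨n, V, pts s, fun k l => (pts_base s k).trans (pts_base s l).symm⟩

theorem pts_liftPt_hom {a b : CechCat 𝒰} (f : a ⟶ b) (k : Fin (a.deg.len + 1)) :
    pts (liftPt a) k =
      (pts (liftPt b) ((CechCat.Hom.deg f).toOrderHom k)).pullback (CechCat.Hom.left f) := by
  rw [pts_liftPt, pts_liftPt, CechCat.Hom.w f k]

variable {E : Type u₂} [Category.{v₂} E] {p : E ⥤ C} [IsFiberedInGroupoids p]

variable (𝒰 p) in
/-- The cosimplicial groupoid of a cover, as a functor. -/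
def cechDiagram : SimplexCategory ⥤ Grpd.{max u v v₂ w, max u v u₂ v₂ w} := cechGroupoid 𝒰 p

section

variable {n : SimplexCategory}

/-- The section over `U_{i_0 … i_n}`. -/
def secAt (S : Val (cechDiagram 𝒰 p) n) (x : Fin (n.len + 1) → 𝒰.I₀) :
    FunOver (Over.forget (cechObj 𝒰 x)) p :=
  (show CechSections 𝒰 p n.len from S) x

/-- The morphism of sections over `U_{i_0 … i_n}`. -/
def secHom {S S' : Val (cechDiagram 𝒰 p) n} (φ : S ⟶ S') (x : Fin (n.len + 1) → 𝒰.I₀) :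
    secAt S x ⟶ secAt S' x :=
  (show (show CechSections 𝒰 p n.len from S) ⟶ (show CechSections 𝒰 p n.len from S') from φ) x

/-- Constructor for families of sections. -/
def secMk (S : ∀ x : Fin (n.len + 1) → 𝒰.I₀, FunOver (Over.forget (cechObj 𝒰 x)) p) :
    Val (cechDiagram 𝒰 p) n :=
  (show CechSections 𝒰 p n.len from S)

/-- Constructor for morphisms of families of sections. -/
def secHomMk {S S' : Val (cechDiagram 𝒰 p) n}
    (φ : ∀ x : Fin (n.len + 1) → 𝒰.I₀, secAt S x ⟶ secAt S' x) : S ⟶ S' :=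
  (show (show CechSections 𝒰 p n.len from S) ⟶ (show CechSections 𝒰 p n.len from S') from φ)

/-- The value of a family of sections. -/
def ev (S : Val (cechDiagram 𝒰 p) n) {x : Fin (n.len + 1) → 𝒰.I₀} {V : C}
    (s : V ⟶ cechObj 𝒰 x) : E :=
  (secAt S x).fn.obj (Over.mk s)

theorem proj_ev (S : Val (cechDiagram 𝒰 p) n) {x : Fin (n.len + 1) → 𝒰.I₀} {V : C}
    (s : V ⟶ cechObj 𝒰 x) : p.obj (ev S s) = V :=
  (secAt S x).proj_obj (Over.mk s)

/-- The value of a morphism of families of sections. -/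
def evHom {S S' : Val (cechDiagram 𝒰 p) n} (φ : S ⟶ S') {x : Fin (n.len + 1) → 𝒰.I₀} {V : C}
    (s : V ⟶ cechObj 𝒰 x) : ev S s ⟶ ev S' s :=
  (FunOver.homFn (secHom φ x)).app (Over.mk s)

instance isHomLift_evHom {S S' : Val (cechDiagram 𝒰 p) n} (φ : S ⟶ S')
    {x : Fin (n.len + 1) → 𝒰.I₀} {V : C} (s : V ⟶ cechObj 𝒰 x) :
    p.IsHomLift (𝟙 V) (evHom φ s) :=
  FunOver.isHomLift_homFn (secHom φ x) (Over.mk s)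

theorem evHom_comp {S S' S'' : Val (cechDiagram 𝒰 p) n} (φ : S ⟶ S') (ψ : S' ⟶ S'')
    {x : Fin (n.len + 1) → 𝒰.I₀} {V : C} (s : V ⟶ cechObj 𝒰 x) :
    evHom (φ ≫ ψ) s = evHom φ s ≫ evHom ψ s := rfl

theorem evHom_eqToHom {S S' : Val (cechDiagram 𝒰 p) n} (e : S = S')
    {x : Fin (n.len + 1) → 𝒰.I₀} {V : C} (s : V ⟶ cechObj 𝒰 x) :
    evHom (eqToHom e) s = eqToHom (by rw [e]) := by
  subst e; rfl

theorem evHom_ext {S S' : Val (cechDiagram 𝒰 p) n} {φ ψ : S ⟶ S'}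
    (h : ∀ (x : Fin (n.len + 1) → 𝒰.I₀) (V : C) (s : V ⟶ cechObj 𝒰 x), evHom φ s = evHom ψ s) :
    φ = ψ := by
  have h_eq : (fun x => secHom φ x) = fun x => secHom ψ x :=
    funext fun x => FunOver.hom_ext fun s => h x s.left s.hom
  exact h_eq

/-- The action of a family of sections on morphisms. -/
def secMap (S : Val (cechDiagram 𝒰 p) n) {x y : Fin (n.len + 1) → 𝒰.I₀} {V W : C}
    (s : V ⟶ cechObj 𝒰 x) (t : W ⟶ cechObj 𝒰 y) (h : V ⟶ W)
    (w : ∀ k, pts s k = (pts t k).pullback h) : ev S s ⟶ ev S t := by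
  -- Equal points have equal indices. Stating compatibility through points allows multi-indices that
  -- agree only propositionally, without transport in the statements.
  have e : x = y := funext fun k => congrArg CoverPoint.idx (w k)
  subst e
  exact (secAt S x).fn.map (Over.homMk h (eq_of_pts w) : Over.mk s ⟶ Over.mk t)

instance isHomLift_secMap (S : Val (cechDiagram 𝒰 p) n) {x y : Fin (n.len + 1) → 𝒰.I₀} {V W : C}
    (s : V ⟶ cechObj 𝒰 x) (t : W ⟶ cechObj 𝒰 y) (h : V ⟶ W)
    (w : ∀ k, pts s k = (pts t k).pullback h) : p.IsHomLift h (secMap S s t h w) := by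
  have e : x = y := funext fun k => congrArg CoverPoint.idx (w k)
  subst e
  exact (secAt S x).isHomLift_map (Over.homMk h (eq_of_pts w) : Over.mk s ⟶ Over.mk t)

theorem secMap_id (S : Val (cechDiagram 𝒰 p) n) {x : Fin (n.len + 1) → 𝒰.I₀} {V : C}
    (s : V ⟶ cechObj 𝒰 x) (w : ∀ k, pts s k = (pts s k).pullback (𝟙 V)) :
    secMap S s s (𝟙 V) w = 𝟙 _ :=
  (secAt S x).fn.map_id (Over.mk s)

theorem secMap_comp (S : Val (cechDiagram 𝒰 p) n) {x y z : Fin (n.len + 1) → 𝒰.I₀} {V W Z : C}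
    (s : V ⟶ cechObj 𝒰 x) (t : W ⟶ cechObj 𝒰 y) (r : Z ⟶ cechObj 𝒰 z) (h : V ⟶ W) (h' : W ⟶ Z)
    (w : ∀ k, pts s k = (pts t k).pullback h) (w' : ∀ k, pts t k = (pts r k).pullback h')
    (w'' : ∀ k, pts s k = (pts r k).pullback (h ≫ h')) :
    secMap S s t h w ≫ secMap S t r h' w' = secMap S s r (h ≫ h') w'' := by
  have e : x = y := funext fun k => congrArg CoverPoint.idx (w k)
  subst e
  have e : x = z := funext fun k => congrArg CoverPoint.idx (w' k)
  subst e
  exact ((secAt S x).fn.map_comp _ _).symm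

theorem secMap_evHom {S S' : Val (cechDiagram 𝒰 p) n} (φ : S ⟶ S')
    {x y : Fin (n.len + 1) → 𝒰.I₀} {V W : C}
    (s : V ⟶ cechObj 𝒰 x) (t : W ⟶ cechObj 𝒰 y) (h : V ⟶ W)
    (w : ∀ k, pts s k = (pts t k).pullback h) :
    secMap S s t h w ≫ evHom φ t = evHom φ s ≫ secMap S' s t h w := by
  have e : x = y := funext fun k => congrArg CoverPoint.idx (w k)
  subst e
  exact (FunOver.homFn (secHom φ x)).naturality _

theorem secMap_eqToHom (S : Val (cechDiagram 𝒰 p) n) {x : Fin (n.len + 1) → 𝒰.I₀} {V : C}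
    (s t : V ⟶ cechObj 𝒰 x) (e : s = t) (w : ∀ k, pts s k = (pts t k).pullback (𝟙 V)) :
    secMap S s t (𝟙 V) w = eqToHom (by rw [e]) := by
  subst e
  exact secMap_id S s w

end

section Act

variable {l m n : SimplexCategory}

theorem pts_act {V W : C} {x : Fin (m.len + 1) → 𝒰.I₀} {y : Fin (n.len + 1) → 𝒰.I₀} (σ : m ⟶ n)
    {s : V ⟶ cechObj 𝒰 x} {t : W ⟶ cechObj 𝒰 y} {h : V ⟶ W}
    (w : ∀ k, pts s k = (pts t (σ.toOrderHom k)).pullback h) (k : Fin (m.len + 1)) :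
    pts s k = (pts (t ≫ cechMap 𝒰 σ.toOrderHom y) k).pullback h := by
  rw [w, pts_cechMap]

/-- The action of a family of sections on morphisms covering a simplicial operator. -/
def secMapAct (S : Val (cechDiagram 𝒰 p) m) (σ : m ⟶ n) {x : Fin (m.len + 1) → 𝒰.I₀}
    {y : Fin (n.len + 1) → 𝒰.I₀} {V W : C} (s : V ⟶ cechObj 𝒰 x) (t : W ⟶ cechObj 𝒰 y) (h : V ⟶ W)
    (w : ∀ k, pts s k = (pts t (σ.toOrderHom k)).pullback h) :
    ev S s ⟶ ev ((act (cechDiagram 𝒰 p) σ).obj S) t :=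
  secMap S s (t ≫ cechMap 𝒰 σ.toOrderHom y) h (pts_act σ w)

instance isHomLift_secMapAct (S : Val (cechDiagram 𝒰 p) m) (σ : m ⟶ n)
    {x : Fin (m.len + 1) → 𝒰.I₀}
    {y : Fin (n.len + 1) → 𝒰.I₀} {V W : C} (s : V ⟶ cechObj 𝒰 x) (t : W ⟶ cechObj 𝒰 y) (h : V ⟶ W)
    (w : ∀ k, pts s k = (pts t (σ.toOrderHom k)).pullback h) :
    p.IsHomLift h (secMapAct S σ s t h w) :=
  isHomLift_secMap S _ _ h (pts_act σ w)

theorem secMap_act (S : Val (cechDiagram 𝒰 p) m) (σ : m ⟶ n)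
    {x y : Fin (n.len + 1) → 𝒰.I₀} {V W : C} (s : V ⟶ cechObj 𝒰 x) (t : W ⟶ cechObj 𝒰 y) (h : V ⟶ W)
    (w : ∀ k, pts s k = (pts t k).pullback h)
    (w' : ∀ k, pts (s ≫ cechMap 𝒰 σ.toOrderHom x) k =
      (pts (t ≫ cechMap 𝒰 σ.toOrderHom y) k).pullback h) :
    secMap ((act (cechDiagram 𝒰 p) σ).obj S) s t h w =
      secMap S (s ≫ cechMap 𝒰 σ.toOrderHom x) (t ≫ cechMap 𝒰 σ.toOrderHom y) h w' := by
  have e : x = y := funext fun k => congrArg CoverPoint.idx (w k)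
  subst e
  rfl

/-- Both sides are the action of `S` on a morphism over `h ≫ h'`. Restricting `r` along `σ ≫ τ` or
in two steps gives the same map by `cechMap_comp`, and the `eqToHom` records this. -/
theorem secMapAct_comp (S : Val (cechDiagram 𝒰 p) l) (σ : l ⟶ m) (τ : m ⟶ n)
    {x : Fin (l.len + 1) → 𝒰.I₀} {y : Fin (m.len + 1) → 𝒰.I₀} {z : Fin (n.len + 1) → 𝒰.I₀}
    {V W Z : C} (s : V ⟶ cechObj 𝒰 x) (t : W ⟶ cechObj 𝒰 y) (r : Z ⟶ cechObj 𝒰 z)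
    (h : V ⟶ W) (h' : W ⟶ Z)
    (w : ∀ k, pts s k = (pts t (σ.toOrderHom k)).pullback h)
    (w' : ∀ k, pts t k = (pts r (τ.toOrderHom k)).pullback h')
    (w'' : ∀ k, pts s k = (pts r ((σ ≫ τ).toOrderHom k)).pullback (h ≫ h')) :
    secMapAct S σ s t h w ≫ secMapAct ((act (cechDiagram 𝒰 p) σ).obj S) τ t r h' w' =
      secMapAct S (σ ≫ τ) s r (h ≫ h') w'' ≫
        evHom (eqToHom (act_comp_obj (cechDiagram 𝒰 p) σ τ S)) r := by
  have e : r ≫ cechMap 𝒰 (σ ≫ τ).toOrderHom z =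
      (r ≫ cechMap 𝒰 τ.toOrderHom z) ≫ cechMap 𝒰 σ.toOrderHom (z ∘ τ.toOrderHom) := by
    rw [Category.assoc]
    exact congrArg (r ≫ ·) (cechMap_comp 𝒰 σ.toOrderHom τ.toOrderHom z)
  have w₁ (k : Fin (l.len + 1)) : pts (t ≫ cechMap 𝒰 σ.toOrderHom y) k =
      (pts ((r ≫ cechMap 𝒰 τ.toOrderHom z) ≫
        cechMap 𝒰 σ.toOrderHom (z ∘ τ.toOrderHom)) k).pullback h' := by
    rw [pts_cechMap, w', pts_cechMap, pts_cechMap]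
  have w₂ (k : Fin (l.len + 1)) : pts (r ≫ cechMap 𝒰 (σ ≫ τ).toOrderHom z) k =
      (pts ((r ≫ cechMap 𝒰 τ.toOrderHom z) ≫
        cechMap 𝒰 σ.toOrderHom (z ∘ τ.toOrderHom)) k).pullback (𝟙 Z) := by
    rw [CoverPoint.pullback_id]
    exact congrArg (fun q => pts q k) e
  have w₃ (k : Fin (l.len + 1)) : pts s k =
      (pts ((r ≫ cechMap 𝒰 τ.toOrderHom z) ≫
        cechMap 𝒰 σ.toOrderHom (z ∘ τ.toOrderHom)) k).pullback (h ≫ h') := by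
    rw [pts_cechMap, pts_cechMap]
    exact w'' k
  rw [evHom_eqToHom]
  have h₁ := secMap_act S σ t (r ≫ cechMap 𝒰 τ.toOrderHom z) h' (pts_act τ w') w₁
  have h₂ := secMap_eqToHom S _ _ e w₂
  refine (congrArg (secMap S s (t ≫ cechMap 𝒰 σ.toOrderHom y) h (pts_act σ w) ≫ ·) h₁).trans ?_
  refine Eq.trans ?_ (congrArg (secMap S s (r ≫ cechMap 𝒰 (σ ≫ τ).toOrderHom z) (h ≫ h')
    (pts_act (σ ≫ τ) w'') ≫ ·) h₂)
  refine (secMap_comp S _ _ _ h h' (pts_act σ w) w₁ w₃).trans (Eq.symm ?_)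
  have w₄ (k : Fin (l.len + 1)) : pts s k =
      (pts ((r ≫ cechMap 𝒰 τ.toOrderHom z) ≫
        cechMap 𝒰 σ.toOrderHom (z ∘ τ.toOrderHom)) k).pullback ((h ≫ h') ≫ 𝟙 Z) := by
    rw [Category.comp_id]; exact w₃ k
  refine (secMap_comp S _ _ _ (h ≫ h') (𝟙 Z) _ w₂ w₄).trans ?_
  congr 1
  exact Category.comp_id _

theorem secMapAct_evHom {S S' : Val (cechDiagram 𝒰 p) m} (φ : S ⟶ S') (σ : m ⟶ n)
    {x : Fin (m.len + 1) → 𝒰.I₀} {y : Fin (n.len + 1) → 𝒰.I₀} {V W : C}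
    (s : V ⟶ cechObj 𝒰 x) (t : W ⟶ cechObj 𝒰 y) (h : V ⟶ W)
    (w : ∀ k, pts s k = (pts t (σ.toOrderHom k)).pullback h) :
    secMapAct S σ s t h w ≫ evHom ((act (cechDiagram 𝒰 p) σ).map φ) t =
      evHom φ s ≫ secMapAct S' σ s t h w :=
  secMap_evHom φ s (t ≫ cechMap 𝒰 σ.toOrderHom y) h (pts_act σ w)

theorem secMapAct_id (S : Val (cechDiagram 𝒰 p) n) {x y : Fin (n.len + 1) → 𝒰.I₀} {V W : C}
    (s : V ⟶ cechObj 𝒰 x) (t : W ⟶ cechObj 𝒰 y) (h : V ⟶ W)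
    (w : ∀ k, pts s k = (pts t k).pullback h) :
    secMapAct S (𝟙 n) s t h w ≫ evHom (eqToHom (act_id_obj (cechDiagram 𝒰 p) n S)) t =
      secMap S s t h w := by
  have e : t ≫ cechMap 𝒰 (SimplexCategory.Hom.toOrderHom (𝟙 n)) y = t :=
    (congrArg (t ≫ ·) (cechMap_id 𝒰 y)).trans (Category.comp_id t)
  have w₁ (k : Fin (n.len + 1)) : pts (t ≫ cechMap 𝒰 (SimplexCategory.Hom.toOrderHom (𝟙 n)) y) k =
      (pts t k).pullback (𝟙 W) := by
    rw [CoverPoint.pullback_id]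
    exact congrArg (fun q => pts q k) e
  have w₂ (k : Fin (n.len + 1)) : pts s k = (pts t k).pullback (h ≫ 𝟙 W) := by
    rw [Category.comp_id]; exact w k
  rw [evHom_eqToHom]
  have h₂ := secMap_eqToHom S _ _ e w₁
  refine (congrArg (secMap S s _ h (pts_act (𝟙 n) w) ≫ ·) h₂).symm.trans ?_
  refine (secMap_comp S _ _ _ h (𝟙 W) _ w₁ w₂).trans ?_
  congr 1
  exact Category.comp_id _

theorem secMapAct_self (S : Val (cechDiagram 𝒰 p) m) (σ : m ⟶ n) {y : Fin (n.len + 1) → 𝒰.I₀}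
    {W : C} (t : W ⟶ cechObj 𝒰 y)
    (w : ∀ k, pts (t ≫ cechMap 𝒰 σ.toOrderHom y) k =
      (pts t (σ.toOrderHom k)).pullback (𝟙 W)) :
    secMapAct S σ (t ≫ cechMap 𝒰 σ.toOrderHom y) t (𝟙 W) w = 𝟙 _ :=
  secMap_id S _ _

end Act

end Eval

/-! ### Pseudocones on the cosimplicial groupoid of a cover -/

section SimplexMap

variable {C : Type u} [Category.{v} C] {J : Precoverage C} [J.HasPullbacks] {X : C}
  {𝒰 : Precoverage.ZeroHypercover.{w} J X}
  {E : Type u₂} [Category.{v₂} E] {p : E ⥤ C}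
  {l m n : SimplexCategory} (B : FunOver (CechCat.forget 𝒰) p)

/-- The action of a functor on simplices on morphisms to `U_{i_0 … i_n}`. -/
def simplexMap (σ : m ⟶ n) {x : Fin (m.len + 1) → 𝒰.I₀}
    {y : Fin (n.len + 1) → 𝒰.I₀} {V W : C} (s : V ⟶ cechObj 𝒰 x) (t : W ⟶ cechObj 𝒰 y) (h : V ⟶ W)
    (w : ∀ k, pts s k = (pts t (σ.toOrderHom k)).pullback h) :
    B.fn.obj (simplexOf m s) ⟶ B.fn.obj (simplexOf n t) :=
  B.fn.map (CechCat.homMk σ h w : simplexOf m s ⟶ simplexOf n t)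

instance isHomLift_simplexMap (σ : m ⟶ n) {x : Fin (m.len + 1) → 𝒰.I₀}
    {y : Fin (n.len + 1) → 𝒰.I₀} {V W : C} (s : V ⟶ cechObj 𝒰 x) (t : W ⟶ cechObj 𝒰 y) (h : V ⟶ W)
    (w : ∀ k, pts s k = (pts t (σ.toOrderHom k)).pullback h) :
    p.IsHomLift h (simplexMap B σ s t h w) :=
  B.isHomLift_map (CechCat.homMk σ h w : simplexOf m s ⟶ simplexOf n t)

theorem simplexMap_comp (σ : l ⟶ m) (τ : m ⟶ n) (ρ : l ⟶ n) (hρ : σ ≫ τ = ρ)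
    {x : Fin (l.len + 1) → 𝒰.I₀} {y : Fin (m.len + 1) → 𝒰.I₀} {z : Fin (n.len + 1) → 𝒰.I₀}
    {V W Z : C} (s : V ⟶ cechObj 𝒰 x) (t : W ⟶ cechObj 𝒰 y) (r : Z ⟶ cechObj 𝒰 z)
    (h : V ⟶ W) (h' : W ⟶ Z) (h'' : V ⟶ Z) (hh : h ≫ h' = h'')
    (w : ∀ k, pts s k = (pts t (σ.toOrderHom k)).pullback h)
    (w' : ∀ k, pts t k = (pts r (τ.toOrderHom k)).pullback h')
    (w'' : ∀ k, pts s k = (pts r (ρ.toOrderHom k)).pullback h'') :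
    simplexMap B σ s t h w ≫ simplexMap B τ t r h' w' = simplexMap B ρ s r h'' w'' := by
  subst hρ hh
  exact (B.fn.map_comp _ _).symm

theorem simplexMap_eqToHom {V : C} {x : Fin (n.len + 1) → 𝒰.I₀}
    (s t : V ⟶ cechObj 𝒰 x) (e : s = t) (w : ∀ k, pts s k = (pts t k).pullback (𝟙 V)) :
    simplexMap B (𝟙 n) s t (𝟙 V) w = eqToHom (by rw [e]) := by
  subst e
  exact B.fn.map_id (simplexOf n s)

theorem pts_left {x : Fin (n.len + 1) → 𝒰.I₀} {s t : Over (cechObj 𝒰 x)} (f : s ⟶ t)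
    (k : Fin (n.len + 1)) : pts s.hom k = (pts t.hom k).pullback f.left := by
  rw [← pts_comp, Over.w]

theorem pts_cechMap_id (σ : m ⟶ n) {y : Fin (n.len + 1) → 𝒰.I₀} {W : C} (t : W ⟶ cechObj 𝒰 y)
    (k : Fin (m.len + 1)) : pts (t ≫ cechMap 𝒰 σ.toOrderHom y) k =
      (pts t (σ.toOrderHom k)).pullback (𝟙 W) := by
  rw [pts_cechMap, CoverPoint.pullback_id]

theorem simplexMap_naturality (σ : m ⟶ n) {y : Fin (n.len + 1) → 𝒰.I₀} {s t : Over (cechObj 𝒰 y)}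
    (f : s ⟶ t) :
    simplexMap B (𝟙 m) _ _ f.left (pts_left ((Over.map (cechMap 𝒰 σ.toOrderHom y)).map f)) ≫
        simplexMap B σ _ _ _ (pts_cechMap_id σ t.hom) =
      simplexMap B σ _ _ _ (pts_cechMap_id σ s.hom) ≫
        simplexMap B (𝟙 n) _ _ f.left (pts_left f) := by
  have w (k : Fin (m.len + 1)) : pts (s.hom ≫ cechMap 𝒰 σ.toOrderHom y) k =
      (pts t.hom (σ.toOrderHom k)).pullback f.left := by
    rw [pts_cechMap, pts_left f]
  exact (simplexMap_comp B _ _ _ (Category.id_comp σ) _ _ _ _ _ _ (Category.comp_id _) _ _ w).trans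
    (simplexMap_comp B _ _ _ (Category.comp_id σ) _ _ _ _ _ _ (Category.id_comp _) _ _ w).symm

end SimplexMap

/-! ### Equivalence of pseudocones with functors on the category of simplices -/

section ConeMap

variable {C : Type u} [Category.{v} C] {J : Precoverage C} [J.HasPullbacks] {X : C}
  {𝒰 : Precoverage.ZeroHypercover.{w} J X}
  {E : Type u₂} [Category.{v₂} E] {p : E ⥤ C} [IsFiberedInGroupoids p]
  {l m n : SimplexCategory}

/-- The action of a pseudocone on the morphisms of simplices. -/
def coneMap (c : PseudoCone (cechDiagram 𝒰 p)) (σ : m ⟶ n) {x : Fin (m.len + 1) → 𝒰.I₀}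
    {y : Fin (n.len + 1) → 𝒰.I₀} {V W : C} (s : V ⟶ cechObj 𝒰 x) (t : W ⟶ cechObj 𝒰 y) (h : V ⟶ W)
    (w : ∀ k, pts s k = (pts t (σ.toOrderHom k)).pullback h) : ev (c.pt m) s ⟶ ev (c.pt n) t :=
  secMapAct (c.pt m) σ s t h w ≫ evHom (c.tr σ) t

instance isHomLift_coneMap (c : PseudoCone (cechDiagram 𝒰 p)) (σ : m ⟶ n)
    {x : Fin (m.len + 1) → 𝒰.I₀}
    {y : Fin (n.len + 1) → 𝒰.I₀} {V W : C} (s : V ⟶ cechObj 𝒰 x) (t : W ⟶ cechObj 𝒰 y) (h : V ⟶ W)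
    (w : ∀ k, pts s k = (pts t (σ.toOrderHom k)).pullback h) :
    p.IsHomLift h (coneMap c σ s t h w) :=
  isHomLift_comp p h (𝟙 W) h (Category.comp_id h) _ _

theorem coneMap_id (c : PseudoCone (cechDiagram 𝒰 p)) {x y : Fin (n.len + 1) → 𝒰.I₀} {V W : C}
    (s : V ⟶ cechObj 𝒰 x) (t : W ⟶ cechObj 𝒰 y) (h : V ⟶ W)
    (w : ∀ k, pts s k = (pts t k).pullback h) :
    coneMap c (𝟙 n) s t h w = secMap (c.pt n) s t h w := by
  refine Eq.trans ?_ (secMapAct_id (c.pt n) s t h w)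
  exact congrArg (fun f => secMapAct (c.pt n) (𝟙 n) s t h w ≫ evHom f t) (c.tr_id n)

/-- Functoriality is `tr_comp` together with naturality of the section action with respect to the
transition of `σ`. -/
theorem coneMap_comp (c : PseudoCone (cechDiagram 𝒰 p)) (σ : l ⟶ m) (τ : m ⟶ n)
    {x : Fin (l.len + 1) → 𝒰.I₀} {y : Fin (m.len + 1) → 𝒰.I₀} {z : Fin (n.len + 1) → 𝒰.I₀}
    {V W Z : C} (s : V ⟶ cechObj 𝒰 x) (t : W ⟶ cechObj 𝒰 y) (r : Z ⟶ cechObj 𝒰 z)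
    (h : V ⟶ W) (h' : W ⟶ Z)
    (w : ∀ k, pts s k = (pts t (σ.toOrderHom k)).pullback h)
    (w' : ∀ k, pts t k = (pts r (τ.toOrderHom k)).pullback h')
    (w'' : ∀ k, pts s k = (pts r ((σ ≫ τ).toOrderHom k)).pullback (h ≫ h')) :
    coneMap c (σ ≫ τ) s r (h ≫ h') w'' = coneMap c σ s t h w ≫ coneMap c τ t r h' w' := by
  have h₁ := secMapAct_evHom (c.tr σ) τ t r h' w'
  have h₂ := secMapAct_comp (c.pt l) σ τ s t r h h' w w' w''
  simp only [coneMap, c.tr_comp, evHom_comp, Category.assoc]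
  rw [← comp_assoc_of_square h₁, comp_assoc_of_square h₂]

theorem coneMap_evHom {c d : PseudoCone (cechDiagram 𝒰 p)} (φ : c ⟶ d) (σ : m ⟶ n)
    {x : Fin (m.len + 1) → 𝒰.I₀}
    {y : Fin (n.len + 1) → 𝒰.I₀} {V W : C} (s : V ⟶ cechObj 𝒰 x) (t : W ⟶ cechObj 𝒰 y) (h : V ⟶ W)
    (w : ∀ k, pts s k = (pts t (σ.toOrderHom k)).pullback h) :
    coneMap c σ s t h w ≫ evHom (PseudoCone.Hom.app φ n) t =
      evHom (PseudoCone.Hom.app φ m) s ≫ coneMap d σ s t h w := by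
  have h₁ := secMapAct_evHom (PseudoCone.Hom.app φ m) σ s t h w
  have h₂ := congrArg (fun f => evHom f t) (PseudoCone.Hom.comm φ σ)
  simp only [evHom_comp] at h₂
  simp only [coneMap, Category.assoc]
  rw [← h₂, comp_assoc_of_square h₁]

/-- Here the section part of `coneMap` is trivial, so the transitions of `c` can be read off from
the action on simplices. -/
theorem coneMap_self (c : PseudoCone (cechDiagram 𝒰 p)) (σ : m ⟶ n) {y : Fin (n.len + 1) → 𝒰.I₀}
    {W : C} (t : W ⟶ cechObj 𝒰 y)
    (w : ∀ k, pts (t ≫ cechMap 𝒰 σ.toOrderHom y) k =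
      (pts t (σ.toOrderHom k)).pullback (𝟙 W)) :
    coneMap c σ (t ≫ cechMap 𝒰 σ.toOrderHom y) t (𝟙 W) w = evHom (c.tr σ) t :=
  (congrArg (· ≫ evHom (c.tr σ) t) (secMapAct_self (c.pt m) σ t w)).trans (Category.id_comp _)

theorem pts_id {V : C} {x : Fin (n.len + 1) → 𝒰.I₀} (s : V ⟶ cechObj 𝒰 x) (k : Fin (n.len + 1)) :
    pts s k = (pts s k).pullback (𝟙 V) := (CoverPoint.pullback_id _).symm

/-- The functor on simplices given by a pseudocone. -/
def coneFunctor (c : PseudoCone (cechDiagram 𝒰 p)) : FunOver (CechCat.forget 𝒰) p :=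
  FunOver.mk'
    { obj := fun a => ev (c.pt a.deg) (liftPt a)
      map := fun {a b} f => coneMap c (CechCat.Hom.deg f) (liftPt a) (liftPt b)
        (CechCat.Hom.left f) (pts_liftPt_hom f)
      map_id := fun a =>
        (coneMap_id c (liftPt a) (liftPt a) (𝟙 a.left) (pts_id _)).trans
          (secMap_id (c.pt a.deg) (liftPt a) (pts_id _))
      map_comp := fun {a b d} f g =>
        coneMap_comp c _ _ (liftPt a) (liftPt b) (liftPt d) _ _ (pts_liftPt_hom f)
          (pts_liftPt_hom g) (pts_liftPt_hom (f ≫ g)) }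
    (fun a => proj_ev (c.pt a.deg) (liftPt a))
    (fun {a b} f => isHomLift_coneMap c (CechCat.Hom.deg f) (liftPt a) (liftPt b)
        (CechCat.Hom.left f) (pts_liftPt_hom f))

variable (𝒰 p) in
/-- The functor from pseudocones to functors on simplices. -/
def coneToCech : PseudoCone (cechDiagram 𝒰 p) ⥤ FunOver (CechCat.forget 𝒰) p where
  obj c := coneFunctor c
  map {c d} φ := FunOver.mkHom (F := coneFunctor c) (G := coneFunctor d)
    (fun a => evHom (PseudoCone.Hom.app φ a.deg) (liftPt a))
    (fun {a b} f => coneMap_evHom φ (CechCat.Hom.deg f) (liftPt a) (liftPt b)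
        (CechCat.Hom.left f) (pts_liftPt_hom f))
    (fun a => isHomLift_evHom _ (liftPt a))
  map_id _ := rfl
  map_comp _ _ := rfl

theorem liftPt_simplexOf (n : SimplexCategory) {V : C} {x : Fin (n.len + 1) → 𝒰.I₀}
    (s : V ⟶ cechObj 𝒰 x) : liftPt (simplexOf n s) = s :=
  (Category.id_comp _).symm.trans (eq_of_pts (h := 𝟙 V) fun k =>
    ((CoverPoint.pullback_id _).trans (pts_liftPt (simplexOf n s) k)).symm)

instance : (coneToCech 𝒰 p).Faithful where
  map_injective {c d φ ψ} h := PseudoCone.Hom.ext (funext fun n => evHom_ext fun x V s => by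
    have h' : evHom (PseudoCone.Hom.app φ n) (liftPt (simplexOf n s)) =
        evHom (PseudoCone.Hom.app ψ n) (liftPt (simplexOf n s)) :=
      congrArg (fun f => (FunOver.homFn f).app (simplexOf n s)) h
    rw [liftPt_simplexOf] at h'
    exact h')

section Full

variable {c d : PseudoCone (cechDiagram 𝒰 p)}

/-- Keeping `s'` and `t'` as variables lets the equalities be eliminated; the intended values are
`liftPt (simplexOf _ s)` and `liftPt (simplexOf _ t)`. -/
theorem coneMap_conj (σ : m ⟶ n) {x : Fin (m.len + 1) → 𝒰.I₀}
    {y : Fin (n.len + 1) → 𝒰.I₀} {V W : C} {s s' : V ⟶ cechObj 𝒰 x} {t t' : W ⟶ cechObj 𝒰 y}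
    (hs : s' = s) (ht : t' = t) (h : V ⟶ W)
    (w : ∀ k, pts s k = (pts t (σ.toOrderHom k)).pullback h)
    (w' : ∀ k, pts s' k = (pts t' (σ.toOrderHom k)).pullback h)
    (e : ev (c.pt m) s' ⟶ ev (d.pt m) s') (e' : ev (c.pt n) t' ⟶ ev (d.pt n) t')
    (he : coneMap c σ s' t' h w' ≫ e' = e ≫ coneMap d σ s' t' h w') :
    coneMap c σ s t h w ≫ eqToHom (congrArg (ev (c.pt n)) ht.symm) ≫ e' ≫
        eqToHom (congrArg (ev (d.pt n)) ht) =
      (eqToHom (congrArg (ev (c.pt m)) hs.symm) ≫ e ≫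
        eqToHom (congrArg (ev (d.pt m)) hs)) ≫ coneMap d σ s t h w := by
  subst hs ht
  simpa only [eqToHom_refl, Category.id_comp, Category.comp_id] using he

variable (η : coneFunctor c ⟶ coneFunctor d)

/-- The components of a morphism of functors on simplices. -/
def simplexHom (a : CechCat 𝒰) : ev (c.pt a.deg) (liftPt a) ⟶ ev (d.pt a.deg) (liftPt a) :=
  (FunOver.homFn η).app a

instance isHomLift_simplexHom (a : CechCat 𝒰) : p.IsHomLift (𝟙 a.left) (simplexHom η a) :=
  FunOver.isHomLift_homFn η a

theorem simplexHom_coneMap {a b : CechCat 𝒰} (f : a ⟶ b) :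
    coneMap c (CechCat.Hom.deg f) (liftPt a) (liftPt b) (CechCat.Hom.left f) (pts_liftPt_hom f) ≫
        simplexHom η b = simplexHom η a ≫
      coneMap d (CechCat.Hom.deg f) (liftPt a) (liftPt b) (CechCat.Hom.left f) (pts_liftPt_hom f) :=
  (FunOver.homFn η).naturality f

/-- The components of a morphism of functors on simplices at a morphism to `U_{i_0 … i_n}`. -/
def coneHomApp (n : SimplexCategory) {V : C} {x : Fin (n.len + 1) → 𝒰.I₀}
    (s : V ⟶ cechObj 𝒰 x) : ev (c.pt n) s ⟶ ev (d.pt n) s :=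
  eqToHom (congrArg (ev (c.pt n)) (liftPt_simplexOf n s).symm) ≫
    simplexHom η (simplexOf n s) ≫ eqToHom (congrArg (ev (d.pt n)) (liftPt_simplexOf n s))

instance isHomLift_coneHomApp (n : SimplexCategory) {V : C} {x : Fin (n.len + 1) → 𝒰.I₀}
    (s : V ⟶ cechObj 𝒰 x) : p.IsHomLift (𝟙 V) (coneHomApp η n s) := by
  have := isHomLift_simplexHom η (simplexOf n s)
  exact (IsHomLift.comp_eqToHom_lift_iff p _ _ _).2
    ((IsHomLift.eqToHom_comp_lift_iff p _ _ _).2 this)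

theorem coneHomApp_coneMap (σ : m ⟶ n) {x : Fin (m.len + 1) → 𝒰.I₀}
    {y : Fin (n.len + 1) → 𝒰.I₀} {V W : C} (s : V ⟶ cechObj 𝒰 x) (t : W ⟶ cechObj 𝒰 y) (h : V ⟶ W)
    (w : ∀ k, pts s k = (pts t (σ.toOrderHom k)).pullback h) :
    coneMap c σ s t h w ≫ coneHomApp η n t = coneHomApp η m s ≫ coneMap d σ s t h w := by
  let f : simplexOf m s ⟶ simplexOf n t := CechCat.homMk σ h w
  exact coneMap_conj σ (liftPt_simplexOf m s) (liftPt_simplexOf n t) h w (pts_liftPt_hom f) _ _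
    (simplexHom_coneMap η f)

/-- The simplices `simplexOf a.deg (liftPt a)` and `a` are joined by a morphism with identity
components. `coneMap` takes it to an `eqToHom`, so naturality of `η` identifies the two components.
-/
theorem coneHomApp_liftPt (a : CechCat 𝒰) :
    coneHomApp η a.deg (liftPt a) = simplexHom η a := by
  let f : simplexOf a.deg (liftPt a) ⟶ a := CechCat.homMk (𝟙 _) (𝟙 _) fun k =>
    (pts_liftPt a k).trans (CoverPoint.pullback_id _).symm
  have hf := simplexHom_coneMap η f
  have e (c : PseudoCone (cechDiagram 𝒰 p)) :
      coneMap c (𝟙 _) (liftPt (simplexOf a.deg (liftPt a))) (liftPt a) (𝟙 _) (pts_liftPt_hom f) =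
        eqToHom (congrArg (ev (c.pt a.deg)) (liftPt_simplexOf a.deg (liftPt a))) :=
    (coneMap_id c _ _ _ _).trans (secMap_eqToHom (c.pt a.deg) _ _ (liftPt_simplexOf a.deg _) _)
  have hf' := (congrArg (· ≫ simplexHom η a) (e c)).symm.trans
    (hf.trans (congrArg (simplexHom η (simplexOf a.deg (liftPt a)) ≫ ·) (e d)))
  refine (congrArg (eqToHom _ ≫ ·) hf'.symm).trans ?_
  exact (comp_assoc_of_eq (eqToHom_trans _ _) _).trans (Category.id_comp _)

end Full

/-- Naturality over identity operators makes the components of `η` into morphisms of sections;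
naturality over an operator `σ` and an identity of `C` gives compatibility with the transitions. -/
instance : (coneToCech 𝒰 p).Full where
  map_surjective {c d} η := by
    have nat (n : SimplexCategory) {x : Fin (n.len + 1) → 𝒰.I₀} {s t : Over (cechObj 𝒰 x)}
        (f : s ⟶ t) : (secAt (c.pt n) x).fn.map f ≫ coneHomApp η n t.hom =
          coneHomApp η n s.hom ≫ (secAt (d.pt n) x).fn.map f := by
      have w (k : Fin (n.len + 1)) : pts s.hom k = (pts t.hom k).pullback f.left := by
        rw [← pts_comp, Over.w]
      have h := coneHomApp_coneMap η (𝟙 n) s.hom t.hom f.left w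
      rw [coneMap_id, coneMap_id] at h
      exact h
    let θ (n : SimplexCategory) : c.pt n ⟶ d.pt n := secHomMk fun x =>
      FunOver.mkHom (fun s => coneHomApp η n s.hom) (fun f => nat n f)
        (fun s => isHomLift_coneHomApp η n s.hom)
    let φ : c ⟶ d :=
      { app := θ
        comm := fun {m n} σ => evHom_ext fun y W t => by
          have w (k : Fin (m.len + 1)) : pts (t ≫ cechMap 𝒰 σ.toOrderHom y) k =
              (pts t (σ.toOrderHom k)).pullback (𝟙 W) := by
            rw [pts_cechMap, CoverPoint.pullback_id]
          have h := coneHomApp_coneMap η σ (t ≫ cechMap 𝒰 σ.toOrderHom y) t (𝟙 W) w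
          rw [coneMap_self, coneMap_self] at h
          exact h.symm }
    exact ⟨φ, FunOver.hom_ext fun a => coneHomApp_liftPt η a⟩

section EssSurj

variable (B : FunOver (CechCat.forget 𝒰) p)

/-- The family of sections given by a functor on simplices. -/
def simplexSections (n : SimplexCategory) : Val (cechDiagram 𝒰 p) n :=
  secMk fun _ => FunOver.mk'
    { obj := fun s => B.fn.obj (simplexOf n s.hom)
      map := fun {s t} f => simplexMap B (𝟙 n) s.hom t.hom f.left (pts_left f)
      map_id := fun s => B.fn.map_id (simplexOf n s.hom)
      map_comp := fun f g => (simplexMap_comp B _ _ _ (Category.comp_id _) _ _ _ _ _ _ rfl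
        (pts_left f) (pts_left g) (pts_left (f ≫ g))).symm }
    (fun s => B.proj_obj (simplexOf n s.hom))
    (fun f => isHomLift_simplexMap B _ _ _ f.left (pts_left f))

/-- The transition morphisms between the sections given by a functor on simplices. -/
def simplexTr (σ : m ⟶ n) :
    (act (cechDiagram 𝒰 p) σ).obj (simplexSections B m) ⟶ simplexSections B n :=
  secHomMk fun _ => FunOver.mkHom
    (fun t => simplexMap B σ _ _ _ (pts_cechMap_id σ t.hom))
    (fun f => simplexMap_naturality B σ f)
    (fun _ => isHomLift_simplexMap B _ _ _ _ _)

/-- The pseudocone given by a functor on simplices. -/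
def simplexCone : PseudoCone (cechDiagram 𝒰 p) where
  pt := simplexSections B
  tr σ := simplexTr B σ
  tr_id n := evHom_ext fun y W t => by
    have e : t ≫ cechMap 𝒰 (SimplexCategory.Hom.toOrderHom (𝟙 n)) y = t :=
      (congrArg (t ≫ ·) (cechMap_id 𝒰 y)).trans (Category.comp_id t)
    rw [evHom_eqToHom]
    exact simplexMap_eqToHom B _ _ e _
  tr_comp {l m n} σ τ := evHom_ext fun z Z r => by
    have e : r ≫ cechMap 𝒰 (σ ≫ τ).toOrderHom z =
        (r ≫ cechMap 𝒰 τ.toOrderHom z) ≫ cechMap 𝒰 σ.toOrderHom (z ∘ τ.toOrderHom) := by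
      rw [Category.assoc]
      exact congrArg (r ≫ ·) (cechMap_comp 𝒰 σ.toOrderHom τ.toOrderHom z)
    have w (k : Fin (l.len + 1)) : pts (r ≫ cechMap 𝒰 (σ ≫ τ).toOrderHom z) k =
        (pts ((r ≫ cechMap 𝒰 τ.toOrderHom z) ≫
          cechMap 𝒰 σ.toOrderHom (z ∘ τ.toOrderHom)) k).pullback (𝟙 Z) := by
      rw [CoverPoint.pullback_id]
      exact congrArg (fun q => pts q k) e
    have w' (k : Fin (l.len + 1)) : pts ((r ≫ cechMap 𝒰 τ.toOrderHom z) ≫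
          cechMap 𝒰 σ.toOrderHom (z ∘ τ.toOrderHom)) k =
        (pts r ((σ ≫ τ).toOrderHom k)).pullback (𝟙 Z) := by
      rw [pts_cechMap, pts_cechMap, CoverPoint.pullback_id]
      rfl
    have h₁ := simplexMap_comp B σ τ _ rfl _ _ _ _ _ _ (Category.comp_id _)
      (pts_cechMap_id σ (r ≫ cechMap 𝒰 τ.toOrderHom z)) (pts_cechMap_id τ r) w'
    have h₂ := simplexMap_comp B (𝟙 l) (σ ≫ τ) _ (Category.id_comp _) _ _ _ _ _ _
      (Category.comp_id _) w w' (pts_cechMap_id (σ ≫ τ) r)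
    rw [evHom_comp, evHom_comp, evHom_eqToHom]
    refine h₂.symm.trans ?_
    exact (congrArg (· ≫ _) (simplexMap_eqToHom B _ _ e w)).trans (congrArg (_ ≫ ·) h₁.symm)

/-- A morphism of simplices `(σ, h)` is `(𝟙, h)` followed by `(σ, 𝟙)`: the first factor is the
action of the sections, the second the transition. -/
theorem coneMap_simplexCone (σ : m ⟶ n) {x : Fin (m.len + 1) → 𝒰.I₀}
    {y : Fin (n.len + 1) → 𝒰.I₀} {V W : C} (s : V ⟶ cechObj 𝒰 x) (t : W ⟶ cechObj 𝒰 y) (h : V ⟶ W)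
    (w : ∀ k, pts s k = (pts t (σ.toOrderHom k)).pullback h) :
    coneMap (simplexCone B) σ s t h w = simplexMap B σ s t h w := by
  have e : x = y ∘ σ.toOrderHom := funext fun k => congrArg CoverPoint.idx (w k)
  subst e
  exact simplexMap_comp B (𝟙 m) σ σ (Category.id_comp σ) _ _ _ _ _ _ (Category.comp_id h)
    (pts_act σ w) (pts_cechMap_id σ t) w

end EssSurj

instance : (coneToCech 𝒰 p).EssSurj where
  mem_essImage B := by
    let f (a : CechCat 𝒰) : simplexOf a.deg (liftPt a) ⟶ a := CechCat.homMk (𝟙 _) (𝟙 _) fun k =>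
      (pts_liftPt a k).trans (CoverPoint.pullback_id _).symm
    let φ : (coneToCech 𝒰 p).obj (simplexCone B) ⟶ B := FunOver.mkHom
      (fun a => B.fn.map (f a))
      (fun {a b} g => by
        have h := coneMap_simplexCone B (CechCat.Hom.deg g) (liftPt a) (liftPt b)
          (CechCat.Hom.left g) (pts_liftPt_hom g)
        refine (congrArg (· ≫ B.fn.map (f b)) h).trans ?_
        refine (B.fn.map_comp _ _).symm.trans ((congrArg B.fn.map ?_).trans (B.fn.map_comp _ _))
        exact CechCat.hom_ext ((Category.comp_id _).trans (Category.id_comp _).symm)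
          ((Category.comp_id _).trans (Category.id_comp _).symm))
      (fun a => B.isHomLift_map (f a))
    have := FunOver.isIso_hom φ
    exact ⟨simplexCone B, ⟨asIso φ⟩⟩

instance : (coneToCech 𝒰 p).IsEquivalence where

end ConeMap

/-! ### The comparison functor -/

section Over

variable {C : Type u} [Category.{v} C] {X : C} {E : Type u₂} [Category.{v₂} E] {p : E ⥤ C}

theorem map_homMk_id (F : FunOver (Over.forget X) p) {V : C} {f g : V ⟶ X} (h : f = g)
    (w : 𝟙 V ≫ g = f) :
    F.fn.map (Over.homMk (𝟙 V) w : Over.mk f ⟶ Over.mk g) = eqToHom (by rw [h]) := by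
  subst h
  exact F.fn.map_id (Over.mk f)

end Over

section Comparison

variable {C : Type u} [Category.{v} C] {J : Precoverage C} [J.HasPullbacks] {X : C}
  (𝒰 : Precoverage.ZeroHypercover.{w} J X)
  {E : Type u₂} [Category.{v₂} E] (p : E ⥤ C) [IsFiberedInGroupoids p]

/-- The comparison functor, with values in the homotopy limit of a functor. -/
def toHoLimDiagram : FunOver (Over.forget X) p ⥤ HoLim (cechDiagram 𝒰 p) := comparison 𝒰 p

/-- The functor from sections to pseudocones. -/
def sectionsToCone : FunOver (Over.forget X) p ⥤ PseudoCone (cechDiagram 𝒰 p) :=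
  toHoLimDiagram 𝒰 p ⋙ holimToCone (cechDiagram 𝒰 p)

theorem isEquivalence_comparison_iff :
    (comparison 𝒰 p).IsEquivalence ↔ (sectionsToCone 𝒰 p).IsEquivalence := by
  have h : (comparison 𝒰 p).IsEquivalence ↔ (toHoLimDiagram 𝒰 p).IsEquivalence := Iff.rfl
  rw [h]
  refine ⟨fun _ => inferInstanceAs (_ ⋙ _).IsEquivalence, fun h' => ?_⟩
  unfold sectionsToCone at h'
  exact isEquivalence_of_comp_right _ (holimToCone (cechDiagram 𝒰 p))

variable {p} (F : FunOver (Over.forget X) p)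

variable {𝒰}

/-- The comparison functor uses constant functors on the slices, so the transitions only record the
strict functoriality of restriction. -/
theorem tr_sectionsToCone {m n : SimplexCategory} (σ : m ⟶ n) :
    ((sectionsToCone 𝒰 p).obj F).tr σ =
      eqToHom (sliceFunctor_obj ((toHoLimDiagram 𝒰 p).obj F) σ).symm :=
  Category.comp_id _

/-- Every restriction of `F` is `F` evaluated on composites with the map to `X`, so only the
morphism of `C/X` underlying the morphism of simplices matters. -/
theorem coneMap_sectionsToCone {m n : SimplexCategory} (σ : m ⟶ n) {x : Fin (m.len + 1) → 𝒰.I₀}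
    {y : Fin (n.len + 1) → 𝒰.I₀} {V W : C} (s : V ⟶ cechObj 𝒰 x) (t : W ⟶ cechObj 𝒰 y) (h : V ⟶ W)
    (w : ∀ k, pts s k = (pts t (σ.toOrderHom k)).pullback h)
    (w' : h ≫ t ≫ cechBase 𝒰 y = s ≫ cechBase 𝒰 x) :
    coneMap ((sectionsToCone 𝒰 p).obj F) σ s t h w =
      F.fn.map (Over.homMk h w' : Over.mk (s ≫ cechBase 𝒰 x) ⟶ Over.mk (t ≫ cechBase 𝒰 y)) := by
  have e : x = y ∘ σ.toOrderHom := funext fun k => congrArg CoverPoint.idx (w k)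
  subst e
  have e : (t ≫ cechMap 𝒰 σ.toOrderHom y) ≫ cechBase 𝒰 (y ∘ σ.toOrderHom) = t ≫ cechBase 𝒰 y := by
    rw [Category.assoc, cechMap_base]
  have h₁ : evHom (((sectionsToCone 𝒰 p).obj F).tr σ) t = F.fn.map
      (Over.homMk (𝟙 W) ((Category.id_comp _).trans e.symm) :
        Over.mk ((t ≫ cechMap 𝒰 σ.toOrderHom y) ≫ cechBase 𝒰 (y ∘ σ.toOrderHom)) ⟶
          Over.mk (t ≫ cechBase 𝒰 y)) := by
    refine (congrArg (fun f => evHom f t) (tr_sectionsToCone F σ)).trans ?_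
    exact (evHom_eqToHom _ t).trans (map_homMk_id F e _).symm
  refine (congrArg (_ ≫ ·) h₁).trans ((F.fn.map_comp _ _).symm.trans (congrArg F.fn.map ?_))
  exact Over.OverMorphism.ext (Category.comp_id h)

theorem liftPt_left {a b : CechCat 𝒰} (f : a ⟶ b) :
    CechCat.Hom.left f ≫ liftPt b ≫ cechBase 𝒰 _ = liftPt a ≫ cechBase 𝒰 _ := by
  rw [liftPt_base, liftPt_base, CechCat.Hom.w f 0, CoverPoint.base_pullback, b.base_eq 0]

/-- The canonical morphism over `X` between the two structure maps of a simplex. -/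
def vertexHom (a : CechCat 𝒰) :
    Over.mk (liftPt a ≫ cechBase 𝒰 (fun k => (a.pt k).idx)) ⟶ Over.mk (a.pt 0).base :=
  Over.homMk (𝟙 a.left) ((Category.id_comp _).trans (liftPt_base a).symm)

/-- The comparison of the two functors on simplices associated to a section over `X`. -/
def sectionsHom : (coneToCech 𝒰 p).obj ((sectionsToCone 𝒰 p).obj F) ⟶
    (vertexRestrict 𝒰 p).obj ((sieveRestrict 𝒰 p).obj F) :=
  FunOver.mkHom
    (fun a => F.fn.map (vertexHom a))
    (fun {a b} f => by
      have h := coneMap_sectionsToCone F (CechCat.Hom.deg f) (liftPt a) (liftPt b)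
        (CechCat.Hom.left f) (pts_liftPt_hom f) (liftPt_left f)
      refine (congrArg (· ≫ _) h).trans ?_
      refine (F.fn.map_comp _ _).symm.trans ((congrArg F.fn.map ?_).trans (F.fn.map_comp _ _))
      exact Over.OverMorphism.ext ((Category.comp_id _).trans (Category.id_comp _).symm))
    (fun a => F.isHomLift_map (vertexHom a))

variable (𝒰 p) in
/-- The two functors on simplices associated to a section over `X` are naturally isomorphic. -/
def sectionsIso :
    sectionsToCone 𝒰 p ⋙ coneToCech 𝒰 p ≅ sieveRestrict 𝒰 p ⋙ vertexRestrict 𝒰 p :=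
  have (F : FunOver (Over.forget X) p) : IsIso (sectionsHom (𝒰 := 𝒰) F) := FunOver.isIso_hom _
  NatIso.ofComponents (fun F => asIso (sectionsHom F)) fun φ => FunOver.hom_ext fun a =>
    ((FunOver.homFn φ).naturality (vertexHom a)).symm

variable (𝒰 p) in
-- In the square of `sectionsIso` both `coneToCech` and `vertexRestrict` are equivalences, so
-- `sectionsToCone` and `sieveRestrict` are equivalences simultaneously; the first stands for the
-- comparison functor, the second for descent.
theorem isEquivalence_comparison_iff_satisfiesDescent :
    (comparison 𝒰 p).IsEquivalence ↔ SatisfiesDescent p 𝒰 := by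
  rw [satisfiesDescent_iff, ← isEquivalence_sieveRestrict_iff, isEquivalence_comparison_iff]
  constructor
  · intro h
    have := isEquivalence_of_iso (sectionsIso 𝒰 p)
    exact isEquivalence_of_comp_right _ (vertexRestrict 𝒰 p)
  · intro h
    have := isEquivalence_of_iso (sectionsIso 𝒰 p).symm
    exact isEquivalence_of_comp_right _ (coneToCech 𝒰 p)

end Comparison

end HomotopySheaf

end

theorem theorem1p1 {C : Type u} [Category.{v} C]
    (J : Precoverage C) [J.HasPullbacks] [J.HasIsos] [J.IsStableUnderBaseChange]
    [J.IsStableUnderComposition]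
    {E : Type u₂} [Category.{v₂} E] (p : E ⥤ C) [HomotopySheaf.IsFiberedInGroupoids p] :
    HomotopySheaf.IsStack.{w} J p ↔
      ∀ (X : C) (𝒰 : Precoverage.ZeroHypercover.{w} J X),
        (HomotopySheaf.comparison 𝒰 p).IsEquivalence := by
  -- Both sides quantify over the same covers, so the equivalence is applied to one cover at a time.
  exact forall_congr' fun X => forall_congr' fun 𝒰 =>
    (HomotopySheaf.isEquivalence_comparison_iff_satisfiesDescent 𝒰 p).symm
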